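/- Let $n\ge 2$. An almost hyper-Hermitian manifold of dimension $4n$ is a smooth manifold $M^{4n}$ with a smooth Riemannian metric $g=\langle\cdot,\cdot\rangle$ and smooth $g$-orthogonal endomorphism fields $I,J,K$ of $TM$ with $I^2=J^2=-1$, $K=IJ=-JI$. Put $\omega_A(Y,Z)=\langle Y,AZ\rangle$ for $A=I,J,K$ and let $\nabla$ be the Levi-Civita connection. At each point $\nabla\omega_A$ lies in $T^*\otimes\mathfrak u(A)^\perp=\mathcal W_1\oplus\mathcal W_2\oplus\mathcal W_3\oplus\mathcal W_4$ (the Gray–Hervella modules of $(g,A)$). A (Gray–Hervella) type is a subset $a\subseteq\{1,2,3,4\}$, with class $\mathcal W_a=\sum_{i\in a}\mathcal W_i$; there are $16$ types and $\binom{18}{3}=816$ unordered triples of types. $M$ is hyperKähler if $\nabla\omega_I=\nabla\omega_J=\nabla\omega_K=0$, and locally conformal hyperKähler if $\nabla\omega_I,\nabla\omega_J,\nabla\omega_K$ all lie in the respective $\mathcal W_4$ and the three Lee forms $\theta_A=\frac1{2n-1}A\,d^*\omega_A$ coincide. Let $V$ be a $4n$-dimensional Euclidean space with an orthogonal quaternionic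 triple $I,J,K$. Say that $(\psi_I,\psi_J,\psi_K)$, trilinear forms on $V$, satisfy the relations if $\psi_A\in V^*\otimes\mathfrak u(A)^\perp$ for each $A$, and $$\psi_I(X,Y,Z)=\psi_J(X,KY,Z)-\psi_K(X,Y,JZ)$$ together with the two identities obtained by cyclically permuting $I,J,K$. A triple of types $(a,b,c)$ reduces to $(a',b',c')$ if $(a',b',c')$ is the smallest triple such that every $(\psi_I,\psi_J,\psi_K)$ satisfying the relations with $\psi_I\in\mathcal W_a$, $\psi_J\in\mathcal W_b$, $\psi_K\in\mathcal W_c$ also has $\psi_I\in\mathcal W_{a'}$, $\psi_J\in\mathcal W_{b'}$, $\psi_K\in\mathcal W_{c'}$. The triple forces hyperKähler if all such $\psi_A$ vanish; it forces locally conformal hyperKähler if it does not force hyperKähler but all such $\psi_I,\psi_J,\psi_K$ lie in the respective $\mathcal W_4$ and have a common Lee form. Then: 1. Every triple of types reduces to some triple. If $4n\ge 12$, the reductions of the $816$ unordered triples are exactly $167$ distinct unordered triples; exactly $276$ of the $816$ unordered triples force hyperKähler and exactly $44$ force locally conformal hyperKähler. If $4n=8$, the corresponding numbers are $144$, $316$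 and $44$. 2. On every almost hyper-Hermitian manifold $M$ of dimension $4n$, the tensors $(\nabla\omega_I,\nabla\omega_J,\nabla\omega_K)$ satisfy the relations at each point. There is a smallest triple of types $(a,b,c)$ with $\nabla\omega_I\in\mathcal W_a$, $\nabla\omega_J\in\mathcal W_b$, $\nabla\omega_K\in\mathcal W_c$ everywhere (the almost hyper-Hermitian type of $M$), and as an unordered triple it is one of the triples counted in 1. Hence at most $167$ unordered almost hyper-Hermitian types occur in a given dimension $4n\ge 12$, and at most $144$ in dimension $8$. If $\nabla\omega_I\in\mathcal W_a$, $\nabla\omega_J\in\mathcal W_b$, $\nabla\omega_K\in\mathcal W_c$ everywhere and the unordered triple $\{a,b,c\}$ forces hyperKähler (respectively locally conformal hyperKähler), then $M$ is hyperKähler (respectively locally conformal hyperKähler). -/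

import Mathlib

open Bundle
open scoped Manifold ContDiff

universe u v

/-! ### Almost Hermitian linear algebra -/

section LinearAlgebra

variable {V : Type*} [NormedAddCommGroup V] [InnerProductSpace ℝ V]

/-- Trilinear forms on `V`. The value `ψ X Y Z` stands for `(∇_X ω)(Y, Z)`. -/
abbrev TriForm (V : Type*) [NormedAddCommGroup V] [InnerProductSpace ℝ V] : Type _ :=
  V →ₗ[ℝ] V →ₗ[ℝ] V →ₗ[ℝ] ℝ

/-- `(I, J, K) = (Q 0, Q 1, Q 2)` is an orthogonal quaternionic triple:
`I² = J² = -1`, `K = IJ = -JI`, and `I, J, K` are isometries. -/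
structure IsHyperHermitian (Q : Fin 3 → V →L[ℝ] V) : Prop where
  sq_I : ∀ v, Q 0 (Q 0 v) = -v
  sq_J : ∀ v, Q 1 (Q 1 v) = -v
  K_eq : ∀ v, Q 2 v = Q 0 (Q 1 v)
  anti : ∀ v, Q 0 (Q 1 v) = -Q 1 (Q 0 v)
  isometry : ∀ i v w, inner ℝ (Q i v) (Q i w) = inner ℝ v w

/-- The trace `Z ↦ ∑ᵢ ψ(eᵢ, eᵢ, Z)` over an orthonormal basis; this is `-d^*ω` if `ψ = ∇ω`. -/
noncomputable def traceForm [FiniteDimensional ℝ V] (ψ : TriForm V) (Z : V) : ℝ :=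
  ∑ i, ψ (stdOrthonormalBasis ℝ V i) (stdOrthonormalBasis ℝ V i) Z

/-- The Lee form `θ_A = (1 / (2n - 1)) A d^*ω_A` in dimension `4n`, where a one-form `β` is acted
on by `(Aβ)(X) = -β(AX)`. -/
noncomputable def leeForm [FiniteDimensional ℝ V] (A : V →L[ℝ] V) (ψ : TriForm V) (X : V) : ℝ :=
  traceForm ψ (A X) / ((Module.finrank ℝ V : ℝ) / 2 - 1)

/-- The space `T^* ⊗ u(A)^⊥` in which `∇ω_A` lives: `ψ` is skew in its last two arguments and
`ψ(X, AY, AZ) = -ψ(X, Y, Z)`. -/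
def hermitianTensors (A : V →L[ℝ] V) : Submodule ℝ (TriForm V) where
  carrier := {ψ | (∀ X Y Z, ψ X Y Z = -ψ X Z Y) ∧ ∀ X Y Z, ψ X (A Y) (A Z) = -ψ X Y Z}
  add_mem' {ψ φ} hψ hφ := by
    refine ⟨fun X Y Z => ?_, fun X Y Z => ?_⟩
    · simp only [LinearMap.add_apply]; rw [hψ.1, hφ.1]; ring
    · simp only [LinearMap.add_apply]; rw [hψ.2, hφ.2]; ring
  zero_mem' := by simp
  smul_mem' c ψ hψ := by
    refine ⟨fun X Y Z => ?_, fun X Y Z => ?_⟩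
    · simp only [LinearMap.smul_apply, smul_eq_mul]; rw [hψ.1]; ring
    · simp only [LinearMap.smul_apply, smul_eq_mul]; rw [hψ.2]; ring

/-- `𝒲₁` (real part of `Λ^{3,0}`): the totally skew elements. -/
def grayHervella₁ (A : V →L[ℝ] V) : Submodule ℝ (TriForm V) :=
  hermitianTensors A ⊓
  { carrier := {ψ | ∀ X Z, ψ X X Z = 0}
    add_mem' := fun {ψ φ} hψ hφ X Z => by
      simp only [LinearMap.add_apply]; rw [hψ, hφ, add_zero]
    zero_mem' := by simp
    smul_mem' := fun c ψ hψ X Z => by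
      simp only [LinearMap.smul_apply]; rw [hψ, smul_zero] }

/-- `𝒲₂` (real part of `U^{3,0}`): the elements with vanishing cyclic sum. -/
def grayHervella₂ (A : V →L[ℝ] V) : Submodule ℝ (TriForm V) :=
  hermitianTensors A ⊓
  { carrier := {ψ | ∀ X Y Z, ψ X Y Z + ψ Y Z X + ψ Z X Y = 0}
    add_mem' := fun {ψ φ} hψ hφ X Y Z => by
      have h₁ := hψ X Y Z
      have h₂ := hφ X Y Z
      simp only [LinearMap.add_apply]
      linarith
    zero_mem' := by simp
    smul_mem' := fun c ψ hψ X Y Z => by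
      simp only [LinearMap.smul_apply, smul_eq_mul]
      rw [← mul_add, ← mul_add, hψ, mul_zero] }

/-- `𝒲₃` (real part of `Λ₀^{2,1}`): the elements with `ψ(AX, AY, Z) = ψ(X, Y, Z)` and vanishing
trace. -/
def grayHervella₃ [FiniteDimensional ℝ V] (A : V →L[ℝ] V) : Submodule ℝ (TriForm V) :=
  hermitianTensors A ⊓
  { carrier := {ψ | (∀ X Y Z, ψ (A X) (A Y) Z = ψ X Y Z) ∧ ∀ Z, traceForm ψ Z = 0}
    add_mem' := fun {ψ φ} hψ hφ => by
      refine ⟨fun X Y Z => ?_, fun Z => ?_⟩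
      · simp only [LinearMap.add_apply]; rw [hψ.1, hφ.1]
      · have h₁ := hψ.2 Z
        have h₂ := hφ.2 Z
        simp only [traceForm] at h₁ h₂
        simp only [traceForm, LinearMap.add_apply, Finset.sum_add_distrib, h₁, h₂, add_zero]
    zero_mem' := by simp [traceForm]
    smul_mem' := fun c ψ hψ => by
      refine ⟨fun X Y Z => ?_, fun Z => ?_⟩
      · simp only [LinearMap.smul_apply]; rw [hψ.1]
      · have h₁ := hψ.2 Z
        simp only [traceForm] at h₁
        simp only [traceForm, LinearMap.smul_apply, ← Finset.smul_sum, h₁, smul_zero] }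

/-- `𝒲₄` (real part of `Λ^{1,0}`): the elements determined by a one-form `θ` through
`ψ(X, Y, Z) = ⟨X, Y⟩ θ(Z) - ⟨X, Z⟩ θ(Y) - ⟨X, AY⟩ θ(AZ) + ⟨X, AZ⟩ θ(AY)`. -/
def grayHervella₄ (A : V →L[ℝ] V) : Submodule ℝ (TriForm V) where
  carrier := {ψ | ∃ θ : V →ₗ[ℝ] ℝ, ∀ X Y Z, ψ X Y Z =
    inner ℝ X Y * θ Z - inner ℝ X Z * θ Y - inner ℝ X (A Y) * θ (A Z) + inner ℝ X (A Z) * θ (A Y)}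
  add_mem' {ψ φ} hψ hφ := by
    obtain ⟨θ, hθ⟩ := hψ
    obtain ⟨η, hη⟩ := hφ
    refine ⟨θ + η, fun X Y Z => ?_⟩
    simp only [LinearMap.add_apply]
    rw [hθ, hη]
    ring
  zero_mem' := ⟨0, by simp⟩
  smul_mem' c ψ hψ := by
    obtain ⟨θ, hθ⟩ := hψ
    refine ⟨c • θ, fun X Y Z => ?_⟩
    simp only [LinearMap.smul_apply, smul_eq_mul]
    rw [hθ]
    ring

/-- The four Gray-Hervella modules; the index `i : Fin 4` stands for `𝒲_{i+1}`. -/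
def grayHervella [FiniteDimensional ℝ V] (A : V →L[ℝ] V) : Fin 4 → Submodule ℝ (TriForm V) :=
  ![grayHervella₁ A, grayHervella₂ A, grayHervella₃ A, grayHervella₄ A]

/-- A Gray-Hervella type: one of the 16 subsets of `{𝒲₁, 𝒲₂, 𝒲₃, 𝒲₄}`. -/
abbrev GHType : Type := Finset (Fin 4)

/-- The class `∑_{i ∈ a} 𝒲_{i+1}` attached to a Gray-Hervella type `a`. -/
def ghClass [FiniteDimensional ℝ V] (A : V →L[ℝ] V) (a : GHType) : Submodule ℝ (TriForm V) :=
  ⨆ i ∈ a, grayHervella A i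

/-- Ordered triples of Gray-Hervella types, of `I`, `J` and `K`, with the componentwise order. -/
abbrev TypeTriple : Type := Fin 3 → GHType

/-- The unordered triple underlying an ordered one. -/
def unordered (t : TypeTriple) : Sym GHType 3 :=
  ⟨Finset.univ.val.map t, by simp⟩

/-- The relations between `∇ω_I`, `∇ω_J`, `∇ω_K` at a point: each `∇ω_A` lies in
`T^* ⊗ u(A)^⊥`, and `∇_X ω_I(Y, Z) = ∇_X ω_J(KY, Z) - ∇_X ω_K(Y, JZ)` with its cyclic
permutations. -/
structure SatisfiesRelations (Q : Fin 3 → V →L[ℝ] V) (ψ : Fin 3 → TriForm V) : Prop where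
  hermitian : ∀ i, ψ i ∈ hermitianTensors (Q i)
  cyclic : ∀ i X Y Z,
    ψ i X Y Z = ψ (i + 1) X (Q (i + 2) Y) Z - ψ (i + 2) X Y (Q (i + 1) Z)

/-- `∇ω_I`, `∇ω_J`, `∇ω_K` belong to the classes prescribed by the triple of types `t`. -/
def HasTypeLE [FiniteDimensional ℝ V] (Q : Fin 3 → V →L[ℝ] V) (ψ : Fin 3 → TriForm V)
    (t : TypeTriple) : Prop :=
  ∀ i, ψ i ∈ ghClass (Q i) (t i)

/-- The three tensors are of locally conformal Kähler type `𝒲₄` and have a common Lee form. -/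
def IsLCHyperKahlerTensor [FiniteDimensional ℝ V] (Q : Fin 3 → V →L[ℝ] V)
    (ψ : Fin 3 → TriForm V) : Prop :=
  (∀ i, ψ i ∈ grayHervella₄ (Q i)) ∧ ∀ i j, leeForm (Q i) (ψ i) = leeForm (Q j) (ψ j)

/-- By the relations, the triple of types `t` reduces to `t'`: the triple `t'` is the smallest one
such that all `ψ` of type `t` which satisfy the relations are of type `t'`. -/
def ReducesTo [FiniteDimensional ℝ V] (Q : Fin 3 → V →L[ℝ] V) (t t' : TypeTriple) : Prop :=
  IsLeast {s | ∀ ψ, SatisfiesRelations Q ψ → HasTypeLE Q ψ t → HasTypeLE Q ψ s} t'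

/-- The almost hyper-Hermitian types: the unordered triples of Gray-Hervella types obtained by
reducing all triples with the relations. -/
def hyperHermitianTypes [FiniteDimensional ℝ V] (Q : Fin 3 → V →L[ℝ] V) : Set (Sym GHType 3) :=
  {u | ∃ t t', ReducesTo Q t t' ∧ u = unordered t'}

/-- The unordered triples of types for which the relations force `∇ω_I = ∇ω_J = ∇ω_K = 0`. -/
def forcesHyperKahler [FiniteDimensional ℝ V] (Q : Fin 3 → V →L[ℝ] V) : Set (Sym GHType 3) :=
  {u | ∀ t, unordered t = u → ∀ ψ, SatisfiesRelations Q ψ → HasTypeLE Q ψ t → ∀ i, ψ i = 0}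

/-- The unordered triples of types for which the relations force the locally conformal hyperKähler
condition, but not the hyperKähler condition. -/
def forcesLCHyperKahler [FiniteDimensional ℝ V] (Q : Fin 3 → V →L[ℝ] V) : Set (Sym GHType 3) :=
  {u | ∀ t, unordered t = u → ∀ ψ, SatisfiesRelations Q ψ → HasTypeLE Q ψ t →
    IsLCHyperKahlerTensor Q ψ} \ forcesHyperKahler Q

end LinearAlgebra

/-! ### Almost hyper-Hermitian manifolds -/

section Manifold

variable {E : Type*} [NormedAddCommGroup E] [NormedSpace ℝ E] [FiniteDimensional ℝ E]
  {M : Type*} [TopologicalSpace M] [ChartedSpace E M]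

instance finiteDimensional_tangentSpace (x : M) :
    FiniteDimensional ℝ (TangentSpace 𝓘(ℝ, E) x) :=
  inferInstanceAs (FiniteDimensional ℝ E)

variable [IsManifold 𝓘(ℝ, E) ∞ M]
  [RiemannianBundle (fun x : M => TangentSpace 𝓘(ℝ, E) x)]
  [IsContMDiffRiemannianBundle 𝓘(ℝ, E) ∞ E (fun x : M => TangentSpace 𝓘(ℝ, E) x)]

variable (E M) in
/-- An almost hyper-Hermitian structure on a Riemannian manifold modelled on `E`: smooth
endomorphism fields `(I, J, K) = (Q 0, Q 1, Q 2)` of the tangent bundle which form an orthogonal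
quaternionic triple at each point. The structure records the Levi-Civita connection `nabla` of the
metric, which is characterized by being metric and torsion-free. -/
structure AlmostHyperHermitian where
  Q : Fin 3 → ∀ x : M, TangentSpace 𝓘(ℝ, E) x →L[ℝ] TangentSpace 𝓘(ℝ, E) x
  smooth : ∀ i, ContMDiff 𝓘(ℝ, E) (𝓘(ℝ, E).prod 𝓘(ℝ, E →L[ℝ] E)) ∞
    (fun x => TotalSpace.mk' (E →L[ℝ] E)
      (E := fun x : M => TangentSpace 𝓘(ℝ, E) x →L[ℝ] TangentSpace 𝓘(ℝ, E) x) x (Q i x))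
  hyperHermitian : ∀ x, IsHyperHermitian (fun i => Q i x)
  nabla : CovariantDerivative 𝓘(ℝ, E) E (fun x : M => TangentSpace 𝓘(ℝ, E) x)
  metric : ∀ (x : M) (Y Z : ∀ x : M, TangentSpace 𝓘(ℝ, E) x),
    MDiffAt (T% Y) x → MDiffAt (T% Z) x → ∀ v : TangentSpace 𝓘(ℝ, E) x,
      mvfderiv 𝓘(ℝ, E) (fun y => (inner ℝ (Y y) (Z y) : ℝ)) x v =
        inner ℝ (nabla Y x v) (Z x) + inner ℝ (Y x) (nabla Z x v)
  torsion_free : ∀ (x : M) (Y Z : ∀ x : M, TangentSpace 𝓘(ℝ, E) x),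
    MDiffAt (T% Y) x → MDiffAt (T% Z) x →
      nabla Z x (Y x) - nabla Y x (Z x) = VectorField.mlieBracket 𝓘(ℝ, E) Y Z x

namespace AlmostHyperHermitian

variable (S : AlmostHyperHermitian E M)

/-- The one-form `X ↦ X(ω(Y, Z)) - ω(∇_X Y, Z) - ω(Y, ∇_X Z)` at `x`, for vector fields `Y`, `Z`
and the Kähler form `ω(Y, Z) = ⟨Y, A Z⟩` of `A = S.Q i`. -/
noncomputable def nablaOmegaAux (i : Fin 3) (Y Z : ∀ x : M, TangentSpace 𝓘(ℝ, E) x) (x : M) :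
    TangentSpace 𝓘(ℝ, E) x →L[ℝ] ℝ :=
  mvfderiv 𝓘(ℝ, E) (fun y => (inner ℝ (Y y) (S.Q i y (Z y)) : ℝ)) x
    - innerSL ℝ (S.Q i x (Z x)) ∘L S.nabla Y x
    - innerSL ℝ (Y x) ∘L S.Q i x ∘L S.nabla Z x

theorem mdifferentiableAt_apply (i : Fin 3) {Z : ∀ x : M, TangentSpace 𝓘(ℝ, E) x} {x : M}
    (hZ : MDiffAt (T% Z) x) : MDiffAt (T% (fun y => S.Q i y (Z y))) x :=
  MDifferentiableAt.clm_bundle_apply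
    ((S.smooth i).contMDiffAt.mdifferentiableAt (by simp)) hZ

theorem mdifferentiableAt_omega (i : Fin 3) {Y Z : ∀ x : M, TangentSpace 𝓘(ℝ, E) x} {x : M}
    (hY : MDiffAt (T% Y) x) (hZ : MDiffAt (T% Z) x) :
    MDiffAt (fun y => (inner ℝ (Y y) (S.Q i y (Z y)) : ℝ)) x :=
  MDifferentiableAt.inner_bundle (E := fun x : M => TangentSpace 𝓘(ℝ, E) x) (F := E)
    (IB := 𝓘(ℝ, E)) (b := fun x : M => x) hY (S.mdifferentiableAt_apply i hZ)

theorem tensorial_left (i : Fin 3) (x : M) (Z : ∀ x : M, TangentSpace 𝓘(ℝ, E) x)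
    (hZ : MDiffAt (T% Z) x) : TensorialAt 𝓘(ℝ, E) E (S.nablaOmegaAux i · Z x) x where
  smul hf hσ := by
    ext X₀
    simp [nablaOmegaAux, mvfderiv_fun_mul hf (S.mdifferentiableAt_omega i hσ hZ),
      S.nabla.isCovariantDerivativeOn.leibniz hσ hf, inner_smul_left, real_inner_comm]
    ring
  add hσ hσ' := by
    ext X₀
    simp [nablaOmegaAux, mvfderiv_fun_add (S.mdifferentiableAt_omega i hσ hZ) (S.mdifferentiableAt_omega i hσ' hZ),
      S.nabla.isCovariantDerivativeOn.add hσ hσ', inner_add_left]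
    abel

theorem tensorial_right (i : Fin 3) (x : M) (Y : ∀ x : M, TangentSpace 𝓘(ℝ, E) x)
    (hY : MDiffAt (T% Y) x) : TensorialAt 𝓘(ℝ, E) E (S.nablaOmegaAux i Y · x) x where
  smul hf hσ := by
    ext X₀
    simp [nablaOmegaAux, mvfderiv_fun_mul hf (S.mdifferentiableAt_omega i hY hσ),
      S.nabla.isCovariantDerivativeOn.leibniz hσ hf, inner_smul_right]
    ring
  add hσ hσ' := by
    ext X₀
    simp [nablaOmegaAux, mvfderiv_fun_add (S.mdifferentiableAt_omega i hY hσ)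
        (S.mdifferentiableAt_omega i hY hσ'),
      S.nabla.isCovariantDerivativeOn.add hσ hσ', inner_add_right]
    abel

/-- The covariant derivative `∇ω_A` of the Kähler form of `A = S.Q i` at `x`, as the trilinear form
`(X, Y, Z) ↦ (∇_X ω_A)(Y, Z)`. -/
noncomputable def nablaOmega (i : Fin 3) (x : M) : TriForm (TangentSpace 𝓘(ℝ, E) x) where
  toFun X := LinearMap.mk₂ ℝ
    (fun Y Z => TensorialAt.mkHom₂ (S.nablaOmegaAux i · · x) x
      (S.tensorial_left i x) (S.tensorial_right i x) Y Z X)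
    (fun _ _ _ => by rw [ContinuousLinearMap.map_add]; rfl)
    (fun _ _ _ => by rw [ContinuousLinearMap.map_smul]; rfl)
    (fun _ _ _ => by rw [ContinuousLinearMap.map_add]; rfl)
    (fun _ _ _ => by rw [ContinuousLinearMap.map_smul]; rfl)
  map_add' _ _ := by
    ext
    simp only [LinearMap.mk₂_apply, LinearMap.add_apply]
    exact ContinuousLinearMap.map_add _ _ _
  map_smul' _ _ := by
    ext
    simp only [LinearMap.mk₂_apply, LinearMap.smul_apply, RingHom.id_apply]
    exact ContinuousLinearMap.map_smul _ _ _

theorem nablaOmega_apply (i : Fin 3) {x : M} (X Y Z : ∀ x : M, TangentSpace 𝓘(ℝ, E) x)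
    (hY : MDiffAt (T% Y) x) (hZ : MDiffAt (T% Z) x) :
    S.nablaOmega i x (X x) (Y x) (Z x) =
      mvfderiv 𝓘(ℝ, E) (fun y => (inner ℝ (Y y) (S.Q i y (Z y)) : ℝ)) x (X x)
        - inner ℝ (S.nabla Y x (X x)) (S.Q i x (Z x))
        - inner ℝ (Y x) (S.Q i x (S.nabla Z x (X x))) := by
  have h := TensorialAt.mkHom₂_apply (Φ := (S.nablaOmegaAux i · · x)) (x := x)
    (S.tensorial_left i x) (S.tensorial_right i x) hY hZ
  have h' := congrArg (fun f : TangentSpace 𝓘(ℝ, E) x →L[ℝ] ℝ => f (X x)) h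
  refine Eq.trans h' ?_
  simp [nablaOmegaAux, real_inner_comm]

/-- `∇ω_I`, `∇ω_J`, `∇ω_K` belong everywhere to the classes prescribed by `t`. -/
def HasTypeLE (t : TypeTriple) : Prop :=
  ∀ x, _root_.HasTypeLE (fun i => S.Q i x) (fun i => S.nablaOmega i x) t

/-- `t` is the triple of Gray-Hervella types of `(g, I)`, `(g, J)`, `(g, K)`: the smallest triple of
classes to which `∇ω_I`, `∇ω_J`, `∇ω_K` belong. -/
def HasExactType (t : TypeTriple) : Prop :=
  IsLeast {s | S.HasTypeLE s} t

/-- The three Kähler forms are parallel. -/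
def IsHyperKahler : Prop :=
  ∀ i x, S.nablaOmega i x = 0

/-- The three structures are locally conformal Kähler (class `𝒲₄`), with a common Lee form. -/
def IsLCHyperKahler : Prop :=
  ∀ x, IsLCHyperKahlerTensor (fun i => S.Q i x) (fun i => S.nablaOmega i x)

end AlmostHyperHermitian

/-- The unordered triples of Gray-Hervella types of the almost hyper-Hermitian manifolds of
dimension `4n`. -/
def manifoldTypes (n : ℕ) : Set (Sym GHType 3) :=
  {s | ∃ (M : Type u) (_ : TopologicalSpace M)
    (_ : ChartedSpace (EuclideanSpace ℝ (Fin (4 * n))) M)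
    (_ : IsManifold 𝓘(ℝ, EuclideanSpace ℝ (Fin (4 * n))) ∞ M)
    (_ : RiemannianBundle (fun x : M => TangentSpace 𝓘(ℝ, EuclideanSpace ℝ (Fin (4 * n))) x))
    (_ : IsContMDiffRiemannianBundle 𝓘(ℝ, EuclideanSpace ℝ (Fin (4 * n))) ∞
      (EuclideanSpace ℝ (Fin (4 * n)))
      (fun x : M => TangentSpace 𝓘(ℝ, EuclideanSpace ℝ (Fin (4 * n))) x))
    (S : AlmostHyperHermitian (EuclideanSpace ℝ (Fin (4 * n))) M) (t : TypeTriple),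
      S.HasExactType t ∧ unordered t = s}

end Manifold

/-! The relations can be solved explicitly. Let U be the space of trilinear forms y for which every
y(X, ·, ·) is symmetric and quaternion-Hermitian (`quatForms`). Solutions of the relations
correspond to triples (y_I, y_J, y_K) in U, through ψ_I(X, Y, Z) = y_J(JX, KY, Z) - y_K(KX, JY, Z)
and its cyclic permutations (`satisfiesRelations_relationTensors`,
`SatisfiesRelations.exists_relationTensors`).

In these terms the Gray-Hervella components become simple. There are projections P and R of U, onto
a "totally skew" part and onto a copy of V*. The components of ψ_I in 𝒲₁, 𝒲₂, 𝒲₃, 𝒲₄ vanish iff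
P(y_J - y_K), (1 - P)(y_J - y_K), (1 - R)(y_J + y_K), R(y_J + y_K) vanish, respectively
(`ghPart_pairTensor_eq_zero_iff`). With D = dim V, the only further relation needed is R P R = l R,
where l = 2(D - 4)/(3(D - 2)) is neither 0 nor 1 (`isProjectionPair`).

Such a pair of projections splits U into three parts: E, spanned by the vectors g and Pg with Rg =
g; K = ker P ∩ ker R; and L = im P ∩ ker R. E and K are nonzero for D ≥ 8. L is nonzero for D ≥ 12
and zero for D = 8, which is the only difference between the two cases. On each part the twelve
vanishing conditions come from twelve scalar functionals, on ℝ⁶ for E and on ℝ³ for K and L.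
Reducing a triple of types is then a question about the dependencies of these functionals: a module
survives iff some vector whose support lies in the triple has that module in its support, and it
disappears as soon as, on each part, it is the only member of the triple on some circuit or its
functional is zero there.

Both outcomes have finite certificates. Vectors of small support are given explicitly, with supports
independent of l (`exists_hasSupport_weightE`). Circuits need no separate list of dependencies: the
configuration is self-dual, exchanging sums with differences, so each support vector also gives the
coefficients of a linear relation (`IsDualPair.sum_eq_zero`). A kernel computation over triples
encoded as 12-bit masks confirms that supports and circuits decide every case, and it counts the
outcomes (`reduceMask_counts`).

On a manifold, the relations follow by differentiating KJ = -I and its cyclic permutations, so the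
pointwise statements apply at every point. -/

/-! ### Bit masks for triples of types, and the finite computation -/

/-- The triple of types whose membership bits are the lowest twelve binary digits of `m`. -/
def typeOfMask (m : ℕ) : TypeTriple :=
  fun A => Finset.univ.filter fun i : Fin 4 => m.testBit (4 * A + i)

/-- The mask with the hexadecimal digits `c b a`. -/
def nibbles (p : ℕ × ℕ × ℕ) : ℕ := p.1 + 16 * p.2.1 + 256 * p.2.2

/-- The masks obtained from three hexadecimal digits in all orders. -/
def orders (p : ℕ × ℕ × ℕ) : List ℕ :=
  [nibbles (p.1, p.2.1, p.2.2), nibbles (p.1, p.2.2, p.2.1), nibbles (p.2.1, p.1, p.2.2),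
    nibbles (p.2.1, p.2.2, p.1), nibbles (p.2.2, p.1, p.2.1), nibbles (p.2.2, p.2.1, p.1)]

/-- The supports of vectors of minimal support in the part of multiplicity six, up to order. -/
def baseE : List (ℕ × ℕ × ℕ) :=
  [(4, 4, 4), (8, 8, 8), (12, 1, 1), (12, 2, 2), (4, 3, 3), (8, 3, 3), (9, 9, 4), (10, 10, 4),
    (8, 5, 5), (8, 6, 6), (7, 7, 0), (11, 11, 0), (13, 13, 0), (14, 14, 0), (15, 6, 1),
    (11, 7, 1), (15, 10, 1), (15, 5, 2), (11, 7, 2), (15, 9, 2), (11, 6, 5), (10, 9, 7)]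

/-- The supports of vectors of minimal support in the part of mixed symmetry, up to order. -/
def baseK : List (ℕ × ℕ × ℕ) := [(4, 4, 4), (2, 2, 4), (6, 6, 0)]

/-- The supports of vectors of minimal support in the totally skew part, up to order. -/
def baseL : List (ℕ × ℕ × ℕ) := [(4, 4, 4), (1, 1, 4), (5, 5, 0)]

/-- The masks obtained from `baseE`. -/
def suppE : List ℕ :=
  [119, 187, 221, 238, 284, 367, 379, 431, 439, 449, 502, 506, 556, 607, 635, 671, 695, 706,
    757, 761, 820, 824, 835, 899, 1075, 1092, 1177, 1194, 1327, 1368, 1387, 1413, 1462, 1522,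
    1567, 1627, 1640, 1670, 1717, 1777, 1799, 1819, 1835, 1904, 1946, 1961, 1969, 1970, 2099,
    2133, 2150, 2184, 2351, 2377, 2426, 2452, 2471, 2546, 2591, 2634, 2681, 2711, 2724, 2801,
    2827, 2839, 2855, 2902, 2917, 2929, 2930, 2992, 3089, 3106, 3341, 3536, 3598, 3808, 3862,
    3866, 3877, 3881, 3922, 3937, 3986, 4001]

/-- The circuits: the images of `suppE` under the exchange `dualE`. -/
def circE : List ℕ :=
  [119, 187, 221, 238, 273, 358, 426, 460, 546, 597, 665, 716, 836, 904, 1076, 1091, 1183,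
    1199, 1246, 1261, 1273, 1274, 1317, 1362, 1423, 1438, 1513, 1528, 1558, 1633, 1679, 1709,
    1754, 1784, 1799, 1904, 2104, 2143, 2159, 2179, 2270, 2285, 2293, 2294, 2345, 2383, 2398,
    2450, 2533, 2548, 2586, 2639, 2669, 2721, 2774, 2804, 2827, 2992, 3100, 3116, 3265, 3266,
    3341, 3406, 3434, 3470, 3494, 3536, 3556, 3560, 3598, 3661, 3673, 3725, 3733, 3796, 3800,
    3808, 3913, 3914, 3928, 3944, 3973, 3974, 3988, 4004]

/-- The masks obtained from `baseK`. -/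
def suppK : List ℕ :=
  [102, 548, 578, 1058, 1092, 1542, 1632]

/-- The circuits: the images of `suppK` under the exchange `dualK`. -/
def circK : List ℕ :=
  [102, 546, 580, 1060, 1090, 1542, 1632]

/-- The masks obtained from `baseL`. -/
def suppL : List ℕ :=
  [85, 276, 321, 1041, 1092, 1285, 1360]

/-- The circuits: the images of `suppL` under the exchange `dualL`. -/
def circL : List ℕ :=
  [85, 273, 324, 1044, 1089, 1285, 1360]

/-- The exchange of modules which turns circuits into supports. -/
def dualE (m : ℕ) : ℕ := (m &&& 0x333) <<< 2 ||| ((m >>> 2) &&& 0x333)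

/-- The exchange of modules which turns circuits into supports. -/
def dualK (m : ℕ) : ℕ := (m &&& 0x222) <<< 1 ||| ((m >>> 1) &&& 0x222)

/-- The exchange of modules which turns circuits into supports. -/
def dualL (m : ℕ) : ℕ := (m &&& 0x111) <<< 2 ||| ((m >>> 2) &&& 0x111)

/-- The union of the supports in a list which are contained in `m`. -/
def unionWithin : List ℕ → ℕ → ℕ
  | [], _ => 0
  | s :: l, m => bif (s &&& m).beq s then s ||| unionWithin l m else unionWithin l m

/-- The elements of `m` which are its only common element with one of the circuits in a list. -/
def forcedWithin : List ℕ → ℕ → ℕ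
  | [], _ => 0
  | c :: l, m => bif ((c &&& m) &&& ((c &&& m) - 1)).beq 0 then (c &&& m) ||| forcedWithin l m
      else forcedWithin l m

/-- The reduction of masks in dimension `8` (`b = false`) or in higher dimensions (`b = true`). -/
def reduceMask (b : Bool) (m : ℕ) : ℕ :=
  unionWithin suppE m ||| unionWithin suppK m ||| bif b then unionWithin suppL m else 0

/-- Every module of the triple `m` is kept by `reduceMask` or is excluded by circuits. -/
def checkMask (b : Bool) (m : ℕ) : Bool :=
  (((reduceMask b m ||| forcedWithin circE m) &&& m).beq m) &&
  (((reduceMask b m ||| forcedWithin circK m ||| 0x999) &&& m).beq m) &&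
  (!b || (((reduceMask b m ||| forcedWithin circL m ||| 0xaaa) &&& m).beq m))

/-- Whether `p` holds for all numbers below a bound. -/
def allBelow (p : ℕ → Bool) : ℕ → Bool
  | 0 => true
  | n + 1 => p n && allBelow p n

/-- The number of numbers below a bound with the property `p`. -/
def countBelow (p : ℕ → Bool) : ℕ → ℕ
  | 0 => 0
  | n + 1 => bif p n then countBelow p n + 1 else countBelow p n

/-- Whether the hexadecimal digits of `m` increase weakly, from the lowest one on. -/
def sortedMask (m : ℕ) : Bool :=
  Nat.ble (m % 16) (m / 16 % 16) && Nat.ble (m / 16 % 16) (m / 256)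

-- Sorted masks represent each unordered triple once, and everything is equivariant under
-- permutations, so no other mask has to be checked. Types that occur are the fixed points of the
-- reduction; the value `0` means hyperKähler, and `0x888`, which is 𝒲₄ in all three places, means
-- locally conformal hyperKähler.
set_option maxRecDepth 100000 in
theorem reduceMask_counts (b : Bool) :
    allBelow (fun m => !sortedMask m || checkMask b m) 4096 = true ∧
    countBelow (fun m => sortedMask m && (reduceMask b m).beq m) 4096 = (bif b then 167 else 144) ∧
    countBelow (fun m => sortedMask m && (reduceMask b m).beq 0) 4096 = (bif b then 276 else 316) ∧
    countBelow (fun m => sortedMask m && (reduceMask b m).beq 0x888) 4096 = 44 := by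
  revert b
  decide +kernel

/-! ### Unordered triples of types as sorted masks -/

/-- The type whose membership bits are the binary digits of `d`. -/
def typeOfDigit (d : Fin 16) : GHType := Finset.univ.filter fun i : Fin 4 => d.val.testBit i

theorem mem_typeOfDigit {d : Fin 16} {i : Fin 4} :
    i ∈ typeOfDigit d ↔ d.val.testBit i = true := by
  simp [typeOfDigit]

theorem typeOfDigit_bijective : Function.Bijective typeOfDigit := by
  rw [Fintype.bijective_iff_injective_and_card]
  exact ⟨by unfold Function.Injective; decide +kernel, by simp [GHType]⟩

/-- The hexadecimal digits of a mask. -/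
def digitsOfMask (m : ℕ) (A : Fin 3) : Fin 16 := ⟨m >>> (4 * A.val) % 16, Nat.mod_lt _ (by simp)⟩

theorem mem_typeOfMask {m : ℕ} {A : Fin 3} {i : Fin 4} :
    i ∈ typeOfMask m A ↔ m.testBit (4 * A + i) = true := by
  simp [typeOfMask]

theorem typeOfDigit_digitsOfMask (m : ℕ) : typeOfDigit ∘ digitsOfMask m = typeOfMask m := by
  ext A i
  have h : i.val < 4 := i.2
  have h16 := Nat.testBit_mod_two_pow (m >>> (4 * A.val)) 4 i
  simp only [h, decide_true, Bool.true_and, Nat.testBit_shiftRight] at h16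
  rw [mem_typeOfMask, Function.comp_apply, mem_typeOfDigit, ← h16]
  rfl

theorem exists_digitsOfMask (f : Fin 3 → Fin 16) : ∃ m < 4096, digitsOfMask m = f := by
  have h0 := (f 0).2
  have h1 := (f 1).2
  have h2 := (f 2).2
  refine ⟨f 0 + 16 * f 1 + 256 * f 2, by omega, ?_⟩
  ext A
  fin_cases A <;> simp [digitsOfMask, Nat.shiftRight_eq_div_pow] <;> omega

theorem digitsOfMask_injOn {m m' : ℕ} (hm : m < 4096) (hm' : m' < 4096)
    (h : digitsOfMask m = digitsOfMask m') : m = m' := by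
  have h0 := congrArg Fin.val (congrFun h 0)
  have h1 := congrArg Fin.val (congrFun h 1)
  have h2 := congrArg Fin.val (congrFun h 2)
  simp [digitsOfMask, Nat.shiftRight_eq_div_pow] at h0 h1 h2
  omega

theorem typeOfMask_injOn {m m' : ℕ} (hm : m < 4096) (hm' : m' < 4096)
    (h : typeOfMask m = typeOfMask m') : m = m' := by
  rw [← typeOfDigit_digitsOfMask, ← typeOfDigit_digitsOfMask] at h
  exact digitsOfMask_injOn hm hm' (typeOfDigit_bijective.injective.comp_left h)

theorem sortedMask_iff {m : ℕ} (hm : m < 4096) :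
    sortedMask m = true ↔ Monotone (digitsOfMask m) := by
  rw [Fin.monotone_iff_le_succ]
  simp [Fin.forall_fin_two, sortedMask, digitsOfMask, Nat.shiftRight_eq_div_pow, Fin.le_def]
  omega

theorem unordered_comp (t : TypeTriple) (σ : Equiv.Perm (Fin 3)) :
    unordered (t ∘ σ) = unordered t := by
  apply Subtype.ext
  simp only [unordered]
  rw [← Multiset.map_map, Multiset.map_univ_val_equiv]

theorem exists_sortedMask (t : TypeTriple) :
    ∃ m < 4096, ∃ σ : Equiv.Perm (Fin 3), sortedMask m = true ∧ typeOfMask m = t ∘ σ := by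
  choose f hf using fun A => typeOfDigit_bijective.surjective (t A)
  obtain ⟨m, hm, h⟩ := exists_digitsOfMask (f ∘ Tuple.sort f)
  refine ⟨m, hm, Tuple.sort f, ?_, ?_⟩
  · rw [sortedMask_iff hm, h]
    exact Tuple.monotone_sort f
  · rw [← typeOfDigit_digitsOfMask, h, ← Function.comp_assoc]
    exact congrArg (· ∘ _) (funext hf)

/-- A weakly increasing list is determined by its multiset of entries. -/
theorem eq_of_unordered_eq {m m' : ℕ} (hm : m < 4096) (hm' : m' < 4096)
    (hs : sortedMask m = true) (hs' : sortedMask m' = true)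
    (h : unordered (typeOfMask m) = unordered (typeOfMask m')) : m = m' := by
  rw [sortedMask_iff hm] at hs
  rw [sortedMask_iff hm'] at hs'
  have h₁ := congrArg Subtype.val h
  simp only [unordered, ← typeOfDigit_digitsOfMask] at h₁
  rw [← Multiset.map_map, ← Multiset.map_map] at h₁
  have h₂ := Multiset.map_injective typeOfDigit_bijective.injective h₁
  rw [Fin.univ_val_map, Fin.univ_val_map, Multiset.coe_eq_coe] at h₂
  exact digitsOfMask_injOn hm hm' (List.ofFn_injective
    (h₂.eq_of_pairwise' hs.sortedLE_ofFn.pairwise hs'.sortedLE_ofFn.pairwise))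

theorem exists_comp_of_unordered_eq {t t' : TypeTriple} (h : unordered t = unordered t') :
    ∃ σ : Equiv.Perm (Fin 3), t' = t ∘ σ := by
  obtain ⟨m, hm, σ, hs, e⟩ := exists_sortedMask t
  obtain ⟨m', hm', σ', hs', e'⟩ := exists_sortedMask t'
  have : m = m' := eq_of_unordered_eq hm hm' hs hs' (by
    rw [e, e', unordered_comp, unordered_comp, h])
  subst this
  refine ⟨σ * σ'⁻¹, funext fun A => ?_⟩
  have := congrFun (e.symm.trans e') (σ'⁻¹ A)
  simpa using this.symm

theorem allBelow_iff {p : ℕ → Bool} {n : ℕ} : allBelow p n = true ↔ ∀ m < n, p m = true := by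
  induction n with
  | zero => simp [allBelow]
  | succ n ih =>
    simp only [allBelow, Bool.and_eq_true, ih]
    exact ⟨fun h m hm => (Nat.lt_succ_iff_lt_or_eq.1 hm).elim (h.2 m) (fun e => e ▸ h.1),
      fun h => ⟨h n (Nat.lt_succ_self n), fun m hm => h m (hm.trans (Nat.lt_succ_self n))⟩⟩

theorem countBelow_eq (p : ℕ → Bool) (n : ℕ) :
    countBelow p n = ((Finset.range n).filter fun m => p m = true).card := by
  induction n with
  | zero => simp [countBelow]
  | succ n ih =>
    rw [countBelow, Finset.range_add_one, Finset.filter_insert, ih]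
    cases h : p n <;> simp

/-- A set of unordered triples of types has as many elements as it has sorted representatives. -/
theorem ncard_eq_countBelow {U : Set (Sym GHType 3)} {p : ℕ → Bool}
    (h : ∀ m < 4096, sortedMask m = true → (unordered (typeOfMask m) ∈ U ↔ p m = true)) :
    U.ncard = countBelow (fun m => sortedMask m && p m) 4096 := by
  rw [countBelow_eq, ← Set.ncard_coe_finset, ← Set.InjOn.ncard_image
    (f := fun m => unordered (typeOfMask m))]
  · congr 1
    ext u
    simp only [Set.mem_image, Finset.coe_filter, Finset.mem_range, Set.mem_ofPred_eq,
      Bool.and_eq_true]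
    constructor
    · intro hu
      obtain ⟨t, rfl⟩ : ∃ t, unordered t = u := by
        obtain ⟨s, hs⟩ := u
        obtain ⟨a, b, c, rfl⟩ := Multiset.card_eq_three.1 hs
        exact ⟨![a, b, c], Subtype.ext (by simp [unordered, Fin.univ_val_map]; rfl)⟩
      obtain ⟨m, hm, σ, hs, e⟩ := exists_sortedMask t
      have he : unordered (typeOfMask m) = unordered t := by rw [e, unordered_comp]
      exact ⟨m, ⟨hm, hs, (h m hm hs).1 (he ▸ hu)⟩, he⟩
    · rintro ⟨m, ⟨hm, hs, hp⟩, rfl⟩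
      exact (h m hm hs).2 hp
  · intro m hm m' hm' e
    simp only [Finset.coe_filter, Finset.mem_range, Set.mem_ofPred_eq, Bool.and_eq_true] at hm hm'
    exact eq_of_unordered_eq hm.1 hm'.1 hm.2.1 hm'.2.1 e

/-! ### Reading supports and circuits off the bit operations -/

theorem exists_supp_of_testBit_unionWithin {l : List ℕ} {m k : ℕ}
    (h : (unionWithin l m).testBit k = true) :
    ∃ s ∈ l, s &&& m = s ∧ s.testBit k = true := by
  induction l with
  | nil => simp [unionWithin] at h
  | cons s l ih =>
    by_cases hs : s &&& m = s
    · simp [unionWithin, hs] at h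
      rcases h with h | h
      · exact ⟨s, by simp, hs, h⟩
      · obtain ⟨s', h₁, h₂⟩ := ih h
        exact ⟨s', by simp [h₁], h₂⟩
    · have : (s &&& m).beq s = false := by
        rw [← Bool.not_eq_true, Nat.beq_eq]; exact hs
      simp [unionWithin, this] at h
      obtain ⟨s', h₁, h₂⟩ := ih h
      exact ⟨s', by simp [h₁], h₂⟩

/-- The operation `x &&& (x - 1)` clears the lowest set bit, so it gives zero only for zero and for
powers of two. -/
theorem eq_of_testBit_of_and_sub_one {x j k : ℕ} (h : x &&& (x - 1) = 0)
    (hj : x.testBit j = true) (hk : x.testBit k = true) : j = k := by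
  have h0 : x ≠ 0 := by rintro rfl; simp at hj
  obtain ⟨a, rfl⟩ := (Nat.and_sub_one_eq_zero_iff_isPowerOfTwo h0).1 h
  rw [Nat.testBit_two_pow] at hj hk
  simp at hj hk
  omega

/-- The circuit that is found has all its other members outside `m`. Those members vanish by
assumption, which is what forces the member `k` to vanish. -/
theorem exists_circ_of_testBit_forcedWithin {l : List ℕ} {m k : ℕ}
    (h : (forcedWithin l m).testBit k = true) :
    ∃ c ∈ l, c.testBit k = true ∧
      ∀ j, c.testBit j = true → m.testBit j = true → j = k := by
  induction l with
  | nil => simp [forcedWithin] at h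
  | cons c l ih =>
    by_cases hc : (c &&& m) &&& ((c &&& m) - 1) = 0
    · simp [forcedWithin, hc] at h
      rcases h with h | h
      · exact ⟨c, by simp, h.1, fun j hj hj' =>
          eq_of_testBit_of_and_sub_one hc (by simp [hj, hj']) (by simp [h])⟩
      · obtain ⟨s', h₁, h₂⟩ := ih h
        exact ⟨s', by simp [h₁], h₂⟩
    · have : ((c &&& m) &&& ((c &&& m) - 1)).beq 0 = false := by
        rw [← Bool.not_eq_true, Nat.beq_eq]; exact hc
      simp [forcedWithin, this] at h
      obtain ⟨s', h₁, h₂⟩ := ih h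
      exact ⟨s', by simp [h₁], h₂⟩

theorem typeOfMask_mono {s m : ℕ} (h : s &&& m = s) : typeOfMask s ≤ typeOfMask m := by
  intro A i hi
  rw [mem_typeOfMask] at hi ⊢
  rw [← h] at hi
  simp at hi
  exact hi.2

theorem suppE_orders : ∀ s ∈ suppE, ∃ p ∈ baseE, s ∈ orders p := by decide +kernel

theorem suppK_orders : ∀ s ∈ suppK, ∃ p ∈ baseK, s ∈ orders p := by decide +kernel

theorem suppL_orders : ∀ s ∈ suppL, ∃ p ∈ baseL, s ∈ orders p := by decide +kernel

/-- Self-duality at the level of masks. The bitwise clause matches the exchange on masks with the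
exchange of indices used in the algebraic pairing. -/
theorem circE_dual : ∀ c ∈ circE, dualE c ∈ suppE ∧ ∀ (A : Fin 3) (i : Fin 4),
    c.testBit (4 * A + i) = (dualE c).testBit (4 * A + (![2, 3, 0, 1] i : Fin 4)) := by
  decide +kernel

/-- `dualK` exchanges only 𝒲₂ and 𝒲₃. The full reversal of indices agrees with it because no mask
here contains 𝒲₁ or 𝒲₄. -/
theorem circK_dual : ∀ c ∈ circK, dualK c ∈ suppK ∧ ∀ (A : Fin 3) (i : Fin 4),
    c.testBit (4 * A + i) = (dualK c).testBit (4 * A + (![3, 2, 1, 0] i : Fin 4)) := by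
  decide +kernel

theorem circL_dual : ∀ c ∈ circL, dualL c ∈ suppL ∧ ∀ (A : Fin 3) (i : Fin 4),
    c.testBit (4 * A + i) = (dualL c).testBit (4 * A + (![2, 3, 0, 1] i : Fin 4)) := by
  decide +kernel

/-- A property of triples of types which is invariant under permutations holds for the masks with
given digits in all orders if it holds in one order. -/
theorem of_mem_orders {G : TypeTriple → Prop} (hG : ∀ t (σ : Equiv.Perm (Fin 3)), G t → G (t ∘ σ))
    {p : ℕ × ℕ × ℕ} (hp : p.1 < 16 ∧ p.2.1 < 16 ∧ p.2.2 < 16) (h : G (typeOfMask (nibbles p)))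
    {s : ℕ} (hs : s ∈ orders p) : G (typeOfMask s) := by
  obtain ⟨a, b, c⟩ := p
  simp only at hp
  have key : ∀ a b c : ℕ, a < 16 → b < 16 → c < 16 →
      digitsOfMask (nibbles (a, b, c)) = ![Fin.ofNat 16 a, Fin.ofNat 16 b, Fin.ofNat 16 c] := by
    intro a b c ha hb hc
    ext A
    fin_cases A <;> simp [digitsOfMask, Nat.shiftRight_eq_div_pow, nibbles] <;> omega
  have h₁ : ∀ a b c : ℕ, a < 16 → b < 16 → c < 16 →
      G (typeOfMask (nibbles (a, b, c))) → G (typeOfMask (nibbles (b, a, c))) := by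
    intro a b c ha hb hc h
    convert hG _ (Equiv.swap 0 1) h using 1
    rw [← typeOfDigit_digitsOfMask, ← typeOfDigit_digitsOfMask, key _ _ _ ha hb hc,
      key _ _ _ hb ha hc, Function.comp_assoc]
    congr 1
    ext A; fin_cases A <;> rfl
  have h₂ : ∀ a b c : ℕ, a < 16 → b < 16 → c < 16 →
      G (typeOfMask (nibbles (a, b, c))) → G (typeOfMask (nibbles (a, c, b))) := by
    intro a b c ha hb hc h
    convert hG _ (Equiv.swap 1 2) h using 1
    rw [← typeOfDigit_digitsOfMask, ← typeOfDigit_digitsOfMask, key _ _ _ ha hb hc,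
      key _ _ _ ha hc hb, Function.comp_assoc]
    congr 1
    ext A; fin_cases A <;> rfl
  obtain ⟨ha, hb, hc⟩ := hp
  simp only [orders, List.mem_cons, List.not_mem_nil, or_false] at hs
  rcases hs with rfl | rfl | rfl | rfl | rfl | rfl
  · exact h
  · exact h₂ _ _ _ ha hb hc h
  · exact h₁ _ _ _ ha hb hc h
  · exact h₂ _ _ _ hb ha hc (h₁ _ _ _ ha hb hc h)
  · exact h₁ _ _ _ ha hc hb (h₂ _ _ _ ha hb hc h)
  · exact h₁ _ _ _ hb hc ha (h₂ _ _ _ hb ha hc (h₁ _ _ _ ha hb hc h))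

theorem card_sym_ghType : Nat.card (Sym GHType 3) = 816 := by
  rw [Nat.card_eq_fintype_card, Sym.card_sym_eq_choose]
  simp [GHType]
  decide

/-! ### Sums and differences of triples, and the duality between supports and circuits -/

section Combination

variable {M N : Type*} [AddCommGroup M] [Module ℝ M] [AddCommGroup N] [Module ℝ N]

/-- The sign in `combine`. -/
def combineSign : Fin 4 → ℝ := ![-1, -1, 1, 1]

/-- The difference (for `𝒲₁`, `𝒲₂`) or sum (for `𝒲₃`, `𝒲₄`) of the entries other than the `A`th. -/
def combine (i : Fin 4) (A : Fin 3) (y : Fin 3 → M) : M := y (A + 1) + combineSign i • y (A + 2)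

theorem map_combine (f : M →ₗ[ℝ] N) (i : Fin 4) (A : Fin 3) (y : Fin 3 → M) :
    combine i A (fun j => f (y j)) = f (combine i A y) := by
  simp [combine]

theorem combineSign_mul_self (i : Fin 4) : combineSign i * combineSign i = 1 := by
  fin_cases i <;> simp [combineSign]

/-- A permutation of three indices carries the pair of indices other than `A` to the pair other than
`σ A`, possibly swapped. A swap multiplies a difference by -1 and leaves a sum alone, so vanishing
is unaffected. -/
theorem combine_comp (i : Fin 4) (A : Fin 3) (y : Fin 3 → M) (σ : Equiv.Perm (Fin 3)) :
    ∃ ε : ℝ, ε ≠ 0 ∧ combine i A (y ∘ σ) = ε • combine i (σ A) y := by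
  have h : ∀ (σ : Equiv.Perm (Fin 3)) (A : Fin 3),
      (σ (A + 1) = σ A + 1 ∧ σ (A + 2) = σ A + 2) ∨
        (σ (A + 1) = σ A + 2 ∧ σ (A + 2) = σ A + 1) := by decide
  rcases h σ A with ⟨h₁, h₂⟩ | ⟨h₁, h₂⟩
  · exact ⟨1, one_ne_zero, by simp [combine, h₁, h₂]⟩
  · refine ⟨combineSign i, fun h => ?_, ?_⟩
    · have := combineSign_mul_self i
      simp [h] at this
    · simp only [combine, Function.comp_apply, h₁, h₂, smul_add, smul_smul,
        combineSign_mul_self, one_smul]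
      abel

/-- The tuple `p` has the support `t` with respect to four functionals `w`. -/
def HasSupport (w : Fin 4 → M →ₗ[ℝ] ℝ) (p : Fin 3 → M) (t : TypeTriple) : Prop :=
  ∀ A i, w i (combine i A p) ≠ 0 ↔ i ∈ t A

theorem HasSupport.comp {w : Fin 4 → M →ₗ[ℝ] ℝ} {p : Fin 3 → M} {t : TypeTriple}
    (h : HasSupport w p t) (σ : Equiv.Perm (Fin 3)) : HasSupport w (p ∘ σ) (t ∘ σ) := by
  intro A i
  obtain ⟨ε, hε, e⟩ := combine_comp i A p σ
  rw [e, map_smul, smul_ne_zero_iff, and_iff_right hε]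
  exact h _ _

/-- The exchange of the modules which pairs supports with circuits. -/
def dualIndex : Fin 4 → Fin 4 := ![2, 3, 0, 1]

/-- The exchange of the modules for the part of mixed symmetry. -/
def dualIndex' : Fin 4 → Fin 4 := ![3, 2, 1, 0]

/-- The functionals `w` are dual to the linear maps `q`. -/
structure IsDualPair (w : Fin 4 → M →ₗ[ℝ] ℝ) (q : Fin 4 → N →ₗ[ℝ] N) (τ : Fin 4 → Fin 4)
    (κ : Fin 4 → ℝ) : Prop where
  sign : ∀ i, combineSign (τ i) = -combineSign i
  ne_zero : ∀ i, κ i ≠ 0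
  pairing : ∀ p u, (κ 0 * w (τ 0) p) • q 0 u + (κ 1 * w (τ 1) p) • q 1 u =
    (κ 2 * w (τ 2) p) • q 2 u + (κ 3 * w (τ 3) p) • q 3 u

/-- Each summand pairs a sum in `p` with a difference in `y`, or the other way round. On expansion,
the terms with equal indices telescope around the cycle of three, and the terms with different
indices cancel by `pairing`. Thus every `p` yields a linear relation among the components of `y`,
whose coefficients are governed by the support of `p`. -/
theorem IsDualPair.sum_eq_zero {w : Fin 4 → M →ₗ[ℝ] ℝ} {q : Fin 4 → N →ₗ[ℝ] N}
    {τ : Fin 4 → Fin 4} {κ : Fin 4 → ℝ} (h : IsDualPair w q τ κ) (p : Fin 3 → M)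
    (y : Fin 3 → N) :
    ∑ A, ∑ i, (κ i * w (τ i) (combine (τ i) A p)) • q i (combine i A y) = 0 := by
  -- These are the six pairs of distinct indices; the diagonal ones are not needed.
  have h₁ := h.pairing (p 1) (y 0)
  have h₂ := h.pairing (p 2) (y 0)
  have h₃ := h.pairing (p 0) (y 1)
  have h₄ := h.pairing (p 2) (y 1)
  have h₅ := h.pairing (p 0) (y 2)
  have h₆ := h.pairing (p 1) (y 2)
  simp only [combine, h.sign]
  simp [Fin.sum_univ_three, Fin.sum_univ_four, combineSign]
  linear_combination (norm := module) h₄ - h₆ + h₅ - h₂ + h₁ - h₃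

/-- If all but one of the members of a circuit vanish, then so does the last. -/
theorem IsDualPair.eq_zero {w : Fin 4 → M →ₗ[ℝ] ℝ} {q : Fin 4 → N →ₗ[ℝ] N}
    {τ : Fin 4 → Fin 4} {κ : Fin 4 → ℝ} (h : IsDualPair w q τ κ) {p : Fin 3 → M}
    {t : TypeTriple} (hp : HasSupport w p t) {y : Fin 3 → N} {A : Fin 3} {i : Fin 4}
    (hi : τ i ∈ t A) (hy : ∀ B j, τ j ∈ t B → (B, j) ≠ (A, i) → q j (combine j B y) = 0) :
    q i (combine i A y) = 0 := by
  have hs := h.sum_eq_zero p y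
  rw [← Finset.sum_product', Finset.sum_eq_single (A, i)] at hs
  · exact (smul_eq_zero.1 hs).resolve_left (mul_ne_zero (h.ne_zero i) ((hp A (τ i)).2 hi))
  · rintro ⟨B, j⟩ - hne
    by_cases hj : τ j ∈ t B
    · simp [hy B j hj hne]
    · have : w (τ j) (combine (τ j) B p) = 0 := by
        by_contra h'
        exact hj ((hp B (τ j)).1 h')
      simp [this]
  · simp

end Combination

/-! ### Explicit vectors of small support -/

section Supports

/-- The functionals for the part of multiplicity six; `l` is the constant in `R P R = l R`. -/
noncomputable def weightE (l : ℝ) : Fin 4 → ℝ × ℝ →ₗ[ℝ] ℝ :=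
  ![LinearMap.fst ℝ ℝ ℝ + LinearMap.snd ℝ ℝ ℝ, LinearMap.fst ℝ ℝ ℝ, LinearMap.snd ℝ ℝ ℝ,
    LinearMap.fst ℝ ℝ ℝ + l • LinearMap.snd ℝ ℝ ℝ]

/-- The functionals for the part of mixed symmetry. -/
noncomputable def weightK : Fin 4 → ℝ →ₗ[ℝ] ℝ := ![0, LinearMap.id, LinearMap.id, 0]

/-- The functionals for the totally skew part. -/
noncomputable def weightL : Fin 4 → ℝ →ₗ[ℝ] ℝ := ![LinearMap.id, 0, LinearMap.id, 0]

theorem hasSupport_typeOfMask_iff {M : Type*} [AddCommGroup M] [Module ℝ M]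
    {w : Fin 4 → M →ₗ[ℝ] ℝ} {p : Fin 3 → M} {m : ℕ} :
    HasSupport w p (typeOfMask m) ↔
      ∀ A i, w i (p (A + 1) + combineSign i • p (A + 2)) ≠ 0 ↔ m.testBit (4 * A + i) = true := by
  simp only [HasSupport, mem_typeOfMask, combine]

theorem exists_hasSupport_of_base {M : Type*} [AddCommGroup M] [Module ℝ M]
    {w : Fin 4 → M →ₗ[ℝ] ℝ} {b : List (ℕ × ℕ × ℕ)} {l : List ℕ}
    (hlt : ∀ p ∈ b, p.1 < 16 ∧ p.2.1 < 16 ∧ p.2.2 < 16) (hl : ∀ s ∈ l, ∃ p ∈ b, s ∈ orders p)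
    (h : ∀ p ∈ b, ∃ x, HasSupport w x (typeOfMask (nibbles p))) :
    ∀ s ∈ l, ∃ x, HasSupport w x (typeOfMask s) := by
  intro s hs
  obtain ⟨p, hp, hsp⟩ := hl s hs
  refine of_mem_orders (G := fun t => ∃ x, HasSupport w x t) ?_ (hlt p hp) (h p hp) hsp
  rintro t σ ⟨x, hx⟩
  exact ⟨x ∘ σ, hx.comp σ⟩

theorem exists_hasSupport_weightK :
    ∀ s ∈ suppK, ∃ p, HasSupport weightK p (typeOfMask s) := by
  refine exists_hasSupport_of_base (by decide) suppK_orders ?_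
  simp only [hasSupport_typeOfMask_iff, baseK, List.forall_mem_cons]
  -- On ℝ³ the functionals are the pairwise sums and differences of coordinates. The three vectors
  -- have all differences zero, one difference and two sums zero, and no sum or difference zero
  -- except for the pair of zero coordinates.
  refine ⟨⟨![1, 1, 1], ?_⟩, ⟨![1, 1, -1], ?_⟩, ⟨![0, 0, 1], ?_⟩, by simp⟩ <;>
  · intro A i
    fin_cases A <;> fin_cases i <;>
      simp [weightK, combineSign, nibbles, Nat.testBit, Nat.shiftRight_eq_div_pow]

theorem exists_hasSupport_weightL :
    ∀ s ∈ suppL, ∃ p, HasSupport weightL p (typeOfMask s) := by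
  refine exists_hasSupport_of_base (by decide) suppL_orders ?_
  simp only [hasSupport_typeOfMask_iff, baseL, List.forall_mem_cons]
  refine ⟨⟨![1, 1, 1], ?_⟩, ⟨![1, 1, -1], ?_⟩, ⟨![0, 0, 1], ?_⟩, by simp⟩ <;>
  · intro A i
    fin_cases A <;> fin_cases i <;>
      simp [weightL, combineSign, nibbles, Nat.testBit, Nat.shiftRight_eq_div_pow]

theorem hasSupport_weightE_iff {l : ℝ} {p : Fin 3 → ℝ × ℝ} {m : ℕ} :
    HasSupport (weightE l) p (typeOfMask m) ↔ ∀ A : Fin 3,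
      (((p (A + 1)).1 + (p (A + 1)).2 - ((p (A + 2)).1 + (p (A + 2)).2) ≠ 0 ↔
        m.testBit (4 * A) = true) ∧
      ((p (A + 1)).1 - (p (A + 2)).1 ≠ 0 ↔ m.testBit (4 * A + 1) = true)) ∧
      ((p (A + 1)).2 + (p (A + 2)).2 ≠ 0 ↔ m.testBit (4 * A + 2) = true) ∧
      ((p (A + 1)).1 + l * (p (A + 1)).2 + ((p (A + 2)).1 + l * (p (A + 2)).2) ≠ 0 ↔
        m.testBit (4 * A + 3) = true) := by
  rw [hasSupport_typeOfMask_iff]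
  refine forall_congr' fun A => ?_
  simp [Fin.forall_fin_succ, weightE, combineSign, sub_eq_add_neg, and_assoc]

-- One vector for each orbit of supports under permutations, with entries polynomial in `l`. The
-- stated supports persist for all `l` other than 0 and 1, which is why a single list serves every
-- dimension.
set_option maxHeartbeats 4000000 in
theorem exists_hasSupport_weightE {l : ℝ} (h₀ : l ≠ 0) (h₁ : 1 - l ≠ 0) :
    ∀ s ∈ suppE, ∃ p, HasSupport (weightE l) p (typeOfMask s) := by
  refine exists_hasSupport_of_base (by decide) suppE_orders ?_
  simp only [hasSupport_weightE_iff, baseE, List.forall_mem_cons]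
  refine ⟨⟨![(-l, 1), (-l, 1), (-l, 1)], ?_⟩, ⟨![(1, 0), (1, 0), (1, 0)], ?_⟩,
    ⟨![(0, -1), (0, 1), (0, 1)], ?_⟩, ⟨![(1, -1), (-1, 1), (-1, 1)], ?_⟩,
    ⟨![(l, -1), (-l, 1), (-l, 1)], ?_⟩, ⟨![(1, 0), (-1, 0), (-1, 0)], ?_⟩,
    ⟨![(-l, 1), (-l, 1), (-l, -1)], ?_⟩, ⟨![(-l, 1), (-l, 1), (2 - l, -1)], ?_⟩,
    ⟨![(-l, 2), (-l, 0), (-l, 0)], ?_⟩, ⟨![(-1 - l, 2), (1 - l, 0), (1 - l, 0)], ?_⟩,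
    ⟨![0, 0, (-l, 1)], ?_⟩, ⟨![0, 0, (-1, 0)], ?_⟩, ⟨![0, 0, (0, -1)], ?_⟩,
    ⟨![0, 0, (-1, 1)], ?_⟩, ⟨![(0, 1 - l), (0, -1 + l), (-2 * l, 1 + l)], ?_⟩,
    ⟨![(0, 1), (0, -1), (-2 * l, 1)], ?_⟩, ⟨![(0, -1), (0, 1), (-2, 1)], ?_⟩,
    ⟨![(l, -l), (-l, l), (l, -2 + l)], ?_⟩, ⟨![(-1, 1), (1, -1), (1 - 2 * l, 1)], ?_⟩,
    ⟨![(1, -1), (-1, 1), (1, 1)], ?_⟩,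
    ⟨![(-l ^ 2, -1 + 2 * l), (-l ^ 2, 1), (2 * l - l ^ 2, -1)], ?_⟩,
    ⟨![(1 - l, 1), (-1 - l, 1), (1 - l, -1)], ?_⟩, by simp⟩ <;>
  · intro A
    fin_cases A <;>
      simp [nibbles, Nat.testBit, Nat.shiftRight_eq_div_pow] <;> grind

end Supports

/-! ### The algebra of two projections with R P R = l R -/

section Projections

variable {M : Type*} [AddCommGroup M] [Module ℝ M]

/-- Two idempotents with `R P R = l R`, where `l ≠ 0, 1`. -/
structure IsProjectionPair (P R : M →ₗ[ℝ] M) (l : ℝ) : Prop where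
  idem_P : ∀ z, P (P z) = P z
  idem_R : ∀ z, R (R z) = R z
  compress : ∀ z, R (P (R z)) = l • R z
  ne_zero : l ≠ 0
  ne_one : 1 - l ≠ 0

/-- The four maps whose vanishing describes the vanishing of the Gray-Hervella components. -/
def components (P R : M →ₗ[ℝ] M) : Fin 4 → M →ₗ[ℝ] M :=
  ![P, LinearMap.id - P, LinearMap.id - R, R]

/-- The totally skew part. -/
noncomputable def partL (P R : M →ₗ[ℝ] M) (l : ℝ) : M →ₗ[ℝ] M := P - l⁻¹ • (P ∘ₗ R ∘ₗ P)

/-- The part of mixed symmetry. -/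
noncomputable def partK (P R : M →ₗ[ℝ] M) (l : ℝ) : M →ₗ[ℝ] M :=
  (LinearMap.id - P) - (1 - l)⁻¹ • ((LinearMap.id - P) ∘ₗ R ∘ₗ (LinearMap.id - P))

/-- The parts of multiplicity six of `components`. -/
def componentsE (P R : M →ₗ[ℝ] M) (l : ℝ) : Fin 4 → M →ₗ[ℝ] M :=
  ![R ∘ₗ P, R - R ∘ₗ P, R ∘ₗ P - l • R, R]

/-- The parts of mixed symmetry of `components`. -/
noncomputable def componentsK (P R : M →ₗ[ℝ] M) (l : ℝ) : Fin 4 → M →ₗ[ℝ] M :=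
  ![0, partK P R l, partK P R l, 0]

/-- The totally skew parts of `components`. -/
noncomputable def componentsL (P R : M →ₗ[ℝ] M) (l : ℝ) : Fin 4 → M →ₗ[ℝ] M :=
  ![partL P R l, 0, partL P R l, 0]

variable {P R : M →ₗ[ℝ] M} {l : ℝ}

theorem combineSign_dualIndex (i : Fin 4) : combineSign (dualIndex i) = -combineSign i := by
  fin_cases i <;> simp [combineSign, dualIndex]

theorem combineSign_dualIndex' (i : Fin 4) : combineSign (dualIndex' i) = -combineSign i := by
  fin_cases i <;> simp [combineSign, dualIndex']

theorem isDualPair_K : IsDualPair weightK (componentsK P R l) dualIndex' 1 where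
  sign := combineSign_dualIndex'
  ne_zero _ := one_ne_zero
  pairing p u := by simp [weightK, componentsK, dualIndex']

theorem isDualPair_L : IsDualPair weightL (componentsL P R l) dualIndex 1 where
  sign := combineSign_dualIndex
  ne_zero _ := one_ne_zero
  pairing p u := by simp [weightL, componentsL, dualIndex]

namespace IsProjectionPair

/-- The constants come from comparing coefficients of `R (P u)` and `R u`. For `p = (a, b)` both
sides equal (a + b) R P u - (a + l b) R u. -/
theorem isDualPair_E (h : IsProjectionPair P R l) :
    IsDualPair (weightE l) (componentsE P R l) dualIndex ![1 - l, -1, 1, l - 1] where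
  sign := combineSign_dualIndex
  ne_zero i := by
    have := h.ne_one
    fin_cases i <;> simp [this, sub_ne_zero]
    rintro rfl
    simp at this
  pairing p u := by
    simp [weightE, componentsE, dualIndex]
    module

/-- The three families see the E, K and L parts of a component. For `P` and `1 - P` the E-family is
obtained by applying `R`; once that vanishes, the correction term in `partL` or `partK` vanishes
too. For `1 - R` the E-family is `R P (1 - R)`, and the vector z - R z is recovered from its images
under `P` and `1 - P`. -/
theorem components_eq_zero_iff (h : IsProjectionPair P R l) (i : Fin 4) (z : M) :
    components P R i z = 0 ↔ componentsE P R l i z = 0 ∧ componentsK P R l i z = 0 ∧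
      componentsL P R l i z = 0 := by
  have h₀ := h.ne_zero
  have h₁ := h.ne_one
  have hR : ∀ a b : ℝ, a • R z = b • R z → a ≠ b → R z = 0 := fun a b e hab => by
    rw [← sub_eq_zero, ← sub_smul, smul_eq_zero, sub_eq_zero] at e
    exact e.resolve_left hab
  fin_cases i
  · simp only [components, componentsE, componentsK, componentsL, partL, Fin.zero_eta,
      Matrix.cons_val_zero, LinearMap.comp_apply, LinearMap.sub_apply, LinearMap.smul_apply,
      LinearMap.zero_apply, true_and]
    constructor
    · intro e; simp [e]
    · rintro ⟨e, e'⟩; simpa [e] using e'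
  · simp only [components, componentsE, componentsK, componentsL, partK, Fin.mk_one,
      Matrix.cons_val_one, Matrix.cons_val_zero, LinearMap.comp_apply, LinearMap.sub_apply,
      LinearMap.smul_apply, LinearMap.zero_apply, LinearMap.id_apply, and_true]
    constructor
    · intro e
      refine ⟨by rw [← map_sub, e, map_zero], by rw [e]; simp⟩
    · rintro ⟨e, e'⟩
      rw [← map_sub] at e
      simpa [e] using e'
  -- Both projections are rewritten in terms of z - R z and of R P z - l R z = R P (z - R z), so
  -- they vanish with z - R z and conversely determine it.
  · have e₁ : partL P R l z = P (z - R z) - l⁻¹ • P (R (P z) - l • R z) := by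
      simp only [partL, LinearMap.comp_apply, LinearMap.sub_apply, LinearMap.smul_apply, map_sub,
        map_smul, smul_sub, smul_smul, inv_mul_cancel₀ h₀, one_smul]
      abel
    have e₂ : partK P R l z = (z - R z) - P (z - R z) +
        (1 - l)⁻¹ • ((R (P z) - l • R z) - P (R (P z) - l • R z)) := by
      have : (R z : M) = (1 - l)⁻¹ • (1 - l) • R z := by
        rw [smul_smul, inv_mul_cancel₀ h₁, one_smul]
      have e' : R z - P (R z) = (1 - l)⁻¹ • (1 - l) • (R z - P (R z)) := by
        rw [smul_smul, inv_mul_cancel₀ h₁, one_smul]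
      simp only [partK, LinearMap.comp_apply, LinearMap.sub_apply, LinearMap.smul_apply, map_sub,
        map_smul, LinearMap.id_apply]
      linear_combination (norm := module) e'
    have e₃ : componentsE P R l 2 z = R (P z) - l • R z := by simp [componentsE]
    have e₄ : R (P (z - R z)) = R (P z) - l • R z := by simp [h.compress]
    have e₅ : componentsK P R l 2 z = partK P R l z := by simp [componentsK]
    have e₆ : componentsL P R l 2 z = partL P R l z := by simp [componentsL]
    have e₇ : components P R 2 z = z - R z := by simp [components]
    change components P R 2 z = 0 ↔ componentsE P R l 2 z = 0 ∧ componentsK P R l 2 z = 0 ∧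
      componentsL P R l 2 z = 0
    rw [e₃, e₅, e₆, e₇, e₁, e₂]
    constructor
    · intro e
      rw [e] at e₄
      simp only [map_zero] at e₄
      rw [← e₄, e]
      simp
    · rintro ⟨e, e', e''⟩
      rw [e] at e' e''
      simp only [map_zero, smul_zero, sub_zero, add_zero] at e' e''
      rwa [e'', sub_zero] at e'
  · simp only [components, componentsE, componentsK, componentsL, Fin.reduceFinMk,
      Matrix.cons_val, LinearMap.zero_apply, and_true]

/-- The components which vanish for given `y`. -/
theorem components_eq_zero_of_reduceMask (h : IsProjectionPair P R l) {b : Bool}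
    (hb : b = false → ∀ z, partL P R l z = 0) {m : ℕ} (hc : checkMask b m = true)
    {y : Fin 3 → M}
    (hy : ∀ A, ∀ i ∉ typeOfMask m A, components P R i (combine i A y) = 0) (A : Fin 3)
    (i : Fin 4) (hi : i ∉ typeOfMask (reduceMask b m) A) :
    components P R i (combine i A y) = 0 := by
  by_cases him : i ∈ typeOfMask m A
  swap
  · exact hy A i him
  rw [mem_typeOfMask] at hi him
  simp only [checkMask, Bool.and_eq_true, Bool.or_eq_true, Bool.not_eq_true', Nat.beq_eq] at hc
  obtain ⟨⟨hE, hK⟩, hL⟩ := hc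
  have key : ∀ {x : ℕ}, x &&& m = m → x.testBit (4 * A + i) = true := by
    intro x hx
    rw [← hx, Nat.testBit_and, Bool.and_eq_true] at him
    exact him.1
  have hne : ∀ {B : Fin 3} {j : Fin 4}, 4 * B.val + j.val = 4 * A.val + i.val →
      (B, j) = (A, i) := by
    intro B j e
    have := j.2
    have := i.2
    ext <;> simp <;> omega
  rw [h.components_eq_zero_iff]
  simp only [h.components_eq_zero_iff] at hy
  -- A component disappears only when its E, K and L parts all do, so each part needs its own
  -- circuit.
  refine ⟨?_, ?_, ?_⟩
  · have := key hE
    simp only [Nat.testBit_or, hi, Bool.false_or] at this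
    obtain ⟨c, hc, hk, hu⟩ := exists_circ_of_testBit_forcedWithin this
    obtain ⟨hs, hd⟩ := circE_dual c hc
    obtain ⟨p, hp⟩ := exists_hasSupport_weightE h.ne_zero h.ne_one _ hs
    have hd' : ∀ (B : Fin 3) (j : Fin 4),
      dualIndex j ∈ typeOfMask (dualE c) B ↔ c.testBit (4 * B + j) = true := fun B j => by
        rw [mem_typeOfMask, hd]; rfl
    refine h.isDualPair_E.eq_zero hp ((hd' _ _).2 hk) fun B j hj hne' => (hy B j fun hm => ?_).1
    exact hne' (hne (hu _ ((hd' _ _).1 hj) (mem_typeOfMask.1 hm)))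
  · have := key hK
    simp only [Nat.testBit_or, hi, Bool.false_or, Bool.or_eq_true] at this
    rcases this with this | this
    swap
    -- The mask `0x999` marks 𝒲₁ and 𝒲₄, which have no K part.
    · have : ∀ (A : Fin 3) (i : Fin 4), (0x999).testBit (4 * A + i) = true →
        i = 0 ∨ i = 3 := by decide
      rcases this A i ‹_› with rfl | rfl <;> simp [componentsK]
    obtain ⟨c, hc, hk, hu⟩ := exists_circ_of_testBit_forcedWithin this
    obtain ⟨hs, hd⟩ := circK_dual c hc
    obtain ⟨p, hp⟩ := exists_hasSupport_weightK _ hs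
    have hd' : ∀ (B : Fin 3) (j : Fin 4),
      dualIndex' j ∈ typeOfMask (dualK c) B ↔ c.testBit (4 * B + j) = true := fun B j => by
        rw [mem_typeOfMask, hd]; rfl
    refine isDualPair_K.eq_zero hp ((hd' _ _).2 hk) fun B j hj hne' => (hy B j fun hm => ?_).2.1
    exact hne' (hne (hu _ ((hd' _ _).1 hj) (mem_typeOfMask.1 hm)))
  -- In dimension 8 there is no L part, so no circuit is required.
  · rcases hL with hL | hL
    · have := hb hL
      fin_cases i <;> simp [componentsL, this]
    have := key hL
    simp only [Nat.testBit_or, hi, Bool.false_or, Bool.or_eq_true] at this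
    rcases this with this | this
    swap
    -- The mask `0xaaa` marks 𝒲₂ and 𝒲₄, which have no L part.
    · have : ∀ (A : Fin 3) (i : Fin 4), (0xaaa).testBit (4 * A + i) = true →
        i = 1 ∨ i = 3 := by decide
      rcases this A i ‹_› with rfl | rfl <;> simp [componentsL]
    obtain ⟨c, hc, hk, hu⟩ := exists_circ_of_testBit_forcedWithin this
    obtain ⟨hs, hd⟩ := circL_dual c hc
    obtain ⟨p, hp⟩ := exists_hasSupport_weightL _ hs
    have hd' : ∀ (B : Fin 3) (j : Fin 4),
      dualIndex j ∈ typeOfMask (dualL c) B ↔ c.testBit (4 * B + j) = true := fun B j => by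
        rw [mem_typeOfMask, hd]; rfl
    refine isDualPair_L.eq_zero hp ((hd' _ _).2 hk) fun B j hj hne' => (hy B j fun hm => ?_).2.2
    exact hne' (hne (hu _ ((hd' _ _).1 hj) (mem_typeOfMask.1 hm)))

/-- A scalar vector of the right support becomes a triple in `M` along any map `f` under which the
components vanish exactly when the functionals do. -/
theorem exists_of_hasSupport {W : Type*} [AddCommGroup W] [Module ℝ W]
    {w : Fin 4 → W →ₗ[ℝ] ℝ} {f : W →ₗ[ℝ] M}
    (hf : ∀ i p, components P R i (f p) = 0 ↔ w i p = 0) {m s : ℕ} (hs : s &&& m = s)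
    (hw : ∃ p, HasSupport w p (typeOfMask s)) {A : Fin 3} {i : Fin 4}
    (hi : s.testBit (4 * A + i) = true) :
    ∃ y : Fin 3 → M, (∀ A, ∀ i ∉ typeOfMask m A, components P R i (combine i A y) = 0) ∧
      components P R i (combine i A y) ≠ 0 := by
  obtain ⟨p, hp⟩ := hw
  refine ⟨fun j => f (p j), fun B j hj => ?_, ?_⟩
  · rw [map_combine, hf]
    by_contra h'
    exact hj (typeOfMask_mono hs B ((hp B j).1 h'))
  · rw [map_combine, Ne, hf]
    exact (hp A i).2 (mem_typeOfMask.2 hi)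

/-- The components allowed by `reduceMask` occur. -/
theorem exists_components_ne_zero (h : IsProjectionPair P R l) {b : Bool}
    (hE : ∃ g, R g = g ∧ g ≠ 0) (hK : ∃ k, P k = 0 ∧ R k = 0 ∧ k ≠ 0)
    (hL : b = true → ∃ k, P k = k ∧ R k = 0 ∧ k ≠ 0) {m : ℕ} {A : Fin 3} {i : Fin 4}
    (hi : i ∈ typeOfMask (reduceMask b m) A) :
    ∃ y : Fin 3 → M, (∀ A, ∀ i ∉ typeOfMask m A, components P R i (combine i A y) = 0) ∧
      components P R i (combine i A y) ≠ 0 := by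
  simp only [mem_typeOfMask, reduceMask, Nat.testBit_or, Bool.or_eq_true] at hi
  have h₀ := h.ne_zero
  have h₁ := h.ne_one
  rcases hi with (hi | hi) | hi
  · obtain ⟨s, hs, hsm, hb⟩ := exists_supp_of_testBit_unionWithin hi
    obtain ⟨g, hg, hg₀⟩ := hE
    have hRP : R (P g) = l • g := by simpa [hg] using h.compress g
    -- On the span of `g` and `P g` the four components of a g + b P g are multiples of P g, g - P
    -- g, P g - l g and g. None of these is zero because `l` is neither 0 nor 1, so the components
    -- vanish exactly with the scalars of `weightE`.
    have hPg : P g ≠ 0 := fun e => by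
      rw [e, map_zero, eq_comm, smul_eq_zero] at hRP
      exact hRP.elim h₀ hg₀
    have hPg' : g - P g ≠ 0 := fun e => by
      have e' : P g = g := (sub_eq_zero.1 e).symm
      rw [e', hg, ← sub_eq_zero] at hRP
      have : (1 - l) • g = 0 := by rw [sub_smul, one_smul]; exact hRP
      exact (smul_eq_zero.1 this).elim h₁ hg₀
    have hPg'' : P g - l • g ≠ 0 := fun e => by
      have := congrArg P e
      rw [map_sub, h.idem_P, map_smul, map_zero] at this
      have : (1 - l) • P g = 0 := by rw [sub_smul, one_smul]; exact this
      exact (smul_eq_zero.1 this).elim h₁ hPg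
    refine exists_of_hasSupport (w := weightE l)
      (f := (LinearMap.fst ℝ ℝ ℝ).smulRight g + (LinearMap.snd ℝ ℝ ℝ).smulRight (P g)) ?_ hsm
      (exists_hasSupport_weightE h₀ h₁ s hs) hb
    rintro i ⟨a, b⟩
    fin_cases i
    · have : components P R 0 (a • g + b • P g) = (a + b) • P g := by
        simp [components, h.idem_P, add_smul]
      simpa [weightE, hPg] using (congrArg (· = 0) this).to_iff.trans (smul_eq_zero (M := M))
    · have : components P R 1 (a • g + b • P g) = a • (g - P g) := by
        simp [components, h.idem_P]; module
      simpa [weightE, hPg'] using (congrArg (· = 0) this).to_iff.trans (smul_eq_zero (M := M))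
    · have : components P R 2 (a • g + b • P g) = b • (P g - l • g) := by
        simp [components, hg, hRP]; module
      simpa [weightE, hPg''] using (congrArg (· = 0) this).to_iff.trans (smul_eq_zero (M := M))
    · have : components P R 3 (a • g + b • P g) = (a + l * b) • g := by
        simp [components, hg, hRP]; module
      simpa [weightE, hg₀] using (congrArg (· = 0) this).to_iff.trans (smul_eq_zero (M := M))
  · obtain ⟨s, hs, hsm, hb⟩ := exists_supp_of_testBit_unionWithin hi
    obtain ⟨k, hPk, hRk, hk⟩ := hK
    refine exists_of_hasSupport (w := weightK) (f := LinearMap.id.smulRight k) ?_ hsm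
      (exists_hasSupport_weightK s hs) hb
    intro i p
    fin_cases i <;> simp [components, weightK, hPk, hRk, hk]
  · cases b with
    | false => simp at hi
    | true =>
      obtain ⟨s, hs, hsm, hb⟩ := exists_supp_of_testBit_unionWithin hi
      obtain ⟨k, hPk, hRk, hk⟩ := hL rfl
      refine exists_of_hasSupport (w := weightL) (f := LinearMap.id.smulRight k) ?_ hsm
        (exists_hasSupport_weightL s hs) hb
      intro i p
      fin_cases i <;> simp [components, weightL, hPk, hRk, hk]

end IsProjectionPair

end Projections

/-! ### Projections to the Gray-Hervella modules -/

section TriForms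

set_option maxSynthPendingDepth 5

variable {V : Type*} [NormedAddCommGroup V] [InnerProductSpace ℝ V]

/-- The trilinear form given by a function which is linear in each argument. -/
def triForm (f : V → V → V → ℝ)
    (add₁ : ∀ X X' Y Z, f (X + X') Y Z = f X Y Z + f X' Y Z := by intros; simp <;> ring)
    (smul₁ : ∀ (c : ℝ) X Y Z, f (c • X) Y Z = c * f X Y Z := by intros; simp <;> ring)
    (add₂ : ∀ X Y Y' Z, f X (Y + Y') Z = f X Y Z + f X Y' Z := by intros; simp <;> ring)
    (smul₂ : ∀ (c : ℝ) X Y Z, f X (c • Y) Z = c * f X Y Z := by intros; simp <;> ring)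
    (add₃ : ∀ X Y Z Z', f X Y (Z + Z') = f X Y Z + f X Y Z' := by intros; simp <;> ring)
    (smul₃ : ∀ (c : ℝ) X Y Z, f X Y (c • Z) = c * f X Y Z := by intros; simp <;> ring) :
    TriForm V where
  toFun X := LinearMap.mk₂ ℝ (f X) (fun Y Y' Z => add₂ X Y Y' Z) (fun c Y Z => smul₂ c X Y Z)
    (fun Y Z Z' => add₃ X Y Z Z') (fun c Y Z => smul₃ c X Y Z)
  map_add' X X' := by ext Y Z; exact add₁ X X' Y Z
  map_smul' c X := by ext Y Z; exact smul₁ c X Y Z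

theorem TriForm.ext {ψ φ : TriForm V} (h : ∀ X Y Z, ψ X Y Z = φ X Y Z) : ψ = φ :=
  LinearMap.ext fun X => LinearMap.ext fun Y => LinearMap.ext fun Z => h X Y Z

/-- The cyclic sum. -/
def cyclicSum : TriForm V →ₗ[ℝ] TriForm V where
  toFun ψ := triForm fun X Y Z => ψ X Y Z + ψ Y Z X + ψ Z X Y
  map_add' ψ φ := TriForm.ext fun X Y Z => by simp [triForm]; ring
  map_smul' c ψ := TriForm.ext fun X Y Z => by simp [triForm]; ring

@[simp]
theorem cyclicSum_apply (ψ : TriForm V) (X Y Z : V) :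
    cyclicSum ψ X Y Z = ψ X Y Z + ψ Y Z X + ψ Z X Y := rfl

/-- The part of `ψ` with `ψ(AX, AY, Z) = -ψ(X, Y, Z)`. -/
noncomputable def antiPart (A : V →L[ℝ] V) : TriForm V →ₗ[ℝ] TriForm V where
  toFun ψ := triForm fun X Y Z => (ψ X Y Z - ψ (A X) (A Y) Z) / 2
  map_add' ψ φ := TriForm.ext fun X Y Z => by simp [triForm]; ring
  map_smul' c ψ := TriForm.ext fun X Y Z => by simp [triForm]; ring

@[simp]
theorem antiPart_apply (A : V →L[ℝ] V) (ψ : TriForm V) (X Y Z : V) :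
    antiPart A ψ X Y Z = (ψ X Y Z - ψ (A X) (A Y) Z) / 2 := rfl

/-- The part of `ψ` with `ψ(AX, AY, Z) = ψ(X, Y, Z)`. -/
noncomputable def invPart (A : V →L[ℝ] V) : TriForm V →ₗ[ℝ] TriForm V where
  toFun ψ := triForm fun X Y Z => (ψ X Y Z + ψ (A X) (A Y) Z) / 2
  map_add' ψ φ := TriForm.ext fun X Y Z => by simp [triForm]; ring
  map_smul' c ψ := TriForm.ext fun X Y Z => by simp [triForm]; ring

@[simp]
theorem invPart_apply (A : V →L[ℝ] V) (ψ : TriForm V) (X Y Z : V) :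
    invPart A ψ X Y Z = (ψ X Y Z + ψ (A X) (A Y) Z) / 2 := rfl

/-- The element of `𝒲₄` determined by a one-form. -/
noncomputable def leeTensor (A : V →L[ℝ] V) : (V →ₗ[ℝ] ℝ) →ₗ[ℝ] TriForm V where
  toFun θ := triForm (fun X Y Z => inner ℝ X Y * θ Z - inner ℝ X Z * θ Y
      - inner ℝ X (A Y) * θ (A Z) + inner ℝ X (A Z) * θ (A Y))
    (by intros; simp [inner_add_left]; ring) (by intros; simp [inner_smul_left]; ring)
    (by intros; simp [inner_add_right]; ring) (by intros; simp [inner_smul_right]; ring)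
    (by intros; simp [inner_add_right]; ring) (by intros; simp [inner_smul_right]; ring)
  map_add' θ η := TriForm.ext fun X Y Z => by simp [triForm]; ring
  map_smul' c θ := TriForm.ext fun X Y Z => by simp [triForm]; ring

@[simp]
theorem leeTensor_apply (A : V →L[ℝ] V) (θ : V →ₗ[ℝ] ℝ) (X Y Z : V) :
    leeTensor A θ X Y Z = inner ℝ X Y * θ Z - inner ℝ X Z * θ Y
      - inner ℝ X (A Y) * θ (A Z) + inner ℝ X (A Z) * θ (A Y) := rfl

section Trace

variable [FiniteDimensional ℝ V]

theorem sum_inner_mul (θ : V →ₗ[ℝ] ℝ) (X : V) :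
    ∑ i, inner ℝ (stdOrthonormalBasis ℝ V i) X * θ (stdOrthonormalBasis ℝ V i) = θ X := by
  conv_rhs => rw [← (stdOrthonormalBasis ℝ V).sum_repr' X]
  simp

omit [FiniteDimensional ℝ V] in
theorem sum_eq_sum_of_orthonormalBasis {ι κ : Type*} [Fintype ι] [Fintype κ]
    (b : OrthonormalBasis ι ℝ V) (c : OrthonormalBasis κ ℝ V) (β : V →ₗ[ℝ] V →ₗ[ℝ] ℝ) :
    ∑ i, β (b i) (b i) = ∑ j, β (c j) (c j) := by
  have h₁ : ∀ i, β (b i) (b i) = ∑ j, inner ℝ (c j) (b i) * β (c j) (b i) := fun i => by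
    conv_lhs => enter [1, 2]; rw [← c.sum_repr' (b i)]
    simp
  have h₂ : ∀ j, β (c j) (c j) = ∑ i, inner ℝ (c j) (b i) * β (c j) (b i) := fun j => by
    conv_lhs => enter [2]; rw [← b.sum_repr' (c j)]
    simp [real_inner_comm]
  simp only [h₁, h₂]
  exact Finset.sum_comm

/-- The trace over the first two arguments. -/
noncomputable def traceMap : TriForm V →ₗ[ℝ] V →ₗ[ℝ] ℝ where
  toFun ψ := ∑ i, ψ (stdOrthonormalBasis ℝ V i) (stdOrthonormalBasis ℝ V i)
  map_add' ψ φ := by simp [Finset.sum_add_distrib]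
  map_smul' c ψ := by simp [Finset.smul_sum]

theorem traceMap_apply (ψ : TriForm V) (Z : V) : traceMap ψ Z = traceForm ψ Z := by
  simp [traceMap, traceForm]

theorem traceMap_eq_sum (ψ : TriForm V) (Z : V) : traceMap ψ Z =
    ∑ i, ψ (stdOrthonormalBasis ℝ V i) (stdOrthonormalBasis ℝ V i) Z := by
  simp [traceMap]

theorem sum_inner_self :
    ∑ i, inner ℝ (stdOrthonormalBasis ℝ V i) (stdOrthonormalBasis ℝ V i) =
      (Module.finrank ℝ V : ℝ) := by
  simp

/-- An orthogonal almost complex structure. -/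
structure IsOrthogonalComplex (A : V →L[ℝ] V) : Prop where
  sq : ∀ v, A (A v) = -v
  skew : ∀ v w, inner ℝ (A v) w = -inner ℝ v (A w)

namespace IsOrthogonalComplex

variable {A : V →L[ℝ] V} (hA : IsOrthogonalComplex A)
include hA

omit [FiniteDimensional ℝ V] in
theorem inner_apply_apply (v w : V) : inner ℝ (A v) (A w) = inner ℝ v w := by
  rw [hA.skew, hA.sq, inner_neg_right, neg_neg]

omit [FiniteDimensional ℝ V] in
theorem inner_self_apply (v : V) : inner ℝ v (A v) = 0 := by
  have h := hA.skew v v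
  rw [real_inner_comm] at h
  linarith

/-- `A` maps an orthonormal basis to an orthonormal basis. -/
theorem sum_apply_apply (β : V →ₗ[ℝ] V →ₗ[ℝ] ℝ) :
    ∑ i, β (A (stdOrthonormalBasis ℝ V i)) (A (stdOrthonormalBasis ℝ V i)) =
      ∑ i, β (stdOrthonormalBasis ℝ V i) (stdOrthonormalBasis ℝ V i) := by
  let e : V ≃ₗᵢ[ℝ] V := LinearIsometryEquiv.mk
    (LinearEquiv.ofLinearMap A.toLinearMap (-A.toLinearMap) (by ext v; simp [hA.sq])
      (by ext v; simp [hA.sq]))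
    (fun v => by
      have := hA.inner_apply_apply v v
      rw [real_inner_self_eq_norm_sq, real_inner_self_eq_norm_sq] at this
      exact (pow_left_inj₀ (norm_nonneg _) (norm_nonneg _) two_ne_zero).1 this)
  have := sum_eq_sum_of_orthonormalBasis ((stdOrthonormalBasis ℝ V).map e)
    (stdOrthonormalBasis ℝ V) β
  simpa [e] using this

/-- The trace does not change when the orthonormal basis is replaced by its image under `A`, so the
part of `ψ` anti-invariant under `A` is traceless. -/
theorem traceMap_invPart (ψ : TriForm V) : traceMap (invPart A ψ) = traceMap ψ := by
  ext Z
  have := hA.sum_apply_apply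
    (LinearMap.mk₂ ℝ (fun X Y => ψ X Y Z) (by simp) (by simp) (by simp) (by simp))
  simp only [LinearMap.mk₂_apply] at this
  simp only [traceMap_eq_sum, invPart_apply, ← Finset.sum_div, Finset.sum_add_distrib, this]
  ring

/-- The first term contributes the dimension; the second and the last contribute -1 each, and the
third vanishes because `A` is skew. -/
theorem traceMap_leeTensor (θ : V →ₗ[ℝ] ℝ) :
    traceMap (leeTensor A θ) = ((Module.finrank ℝ V : ℝ) - 2) • θ := by
  ext Z
  have h₁ := sum_inner_mul (θ.comp A.toLinearMap) (A Z)
  simp only [LinearMap.comp_apply, ContinuousLinearMap.coe_coe, hA.sq, map_neg] at h₁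
  simp only [traceMap_eq_sum, leeTensor_apply, hA.inner_self_apply, zero_mul, sub_zero,
    Finset.sum_add_distrib, Finset.sum_sub_distrib, ← Finset.sum_mul, sum_inner_self,
    sum_inner_mul, h₁, LinearMap.smul_apply, smul_eq_mul]
  ring

end IsOrthogonalComplex

/-- The `𝒲₄`-component. -/
noncomputable def leePart (A : V →L[ℝ] V) : TriForm V →ₗ[ℝ] TriForm V :=
  ((Module.finrank ℝ V : ℝ) - 2)⁻¹ • leeTensor A ∘ₗ traceMap

/-- The components of an element of `T^* ⊗ u(A)^⊥` in the Gray-Hervella modules. -/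
noncomputable def ghPart (A : V →L[ℝ] V) : Fin 4 → TriForm V →ₗ[ℝ] TriForm V :=
  ![(3⁻¹ : ℝ) • cyclicSum ∘ₗ antiPart A, antiPart A - (3⁻¹ : ℝ) • cyclicSum ∘ₗ antiPart A,
    invPart A - leePart A, leePart A]

omit [FiniteDimensional ℝ V] in
theorem antiPart_add_invPart (A : V →L[ℝ] V) (ψ : TriForm V) :
    antiPart A ψ + invPart A ψ = ψ := TriForm.ext fun X Y Z => by simp; ring

theorem sum_ghPart (A : V →L[ℝ] V) (ψ : TriForm V) : ∑ i, ghPart A i ψ = ψ := by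
  conv_rhs => rw [← antiPart_add_invPart A ψ]
  simp [Fin.sum_univ_four, ghPart]
  abel

namespace IsOrthogonalComplex

variable {A : V →L[ℝ] V} (hA : IsOrthogonalComplex A)
include hA

omit [FiniteDimensional ℝ V] in
theorem leeTensor_mem_hermitianTensors (θ : V →ₗ[ℝ] ℝ) : leeTensor A θ ∈ hermitianTensors A := by
  refine ⟨fun X Y Z => ?_, fun X Y Z => ?_⟩
  · simp; ring
  · simp [hA.sq]; ring

omit [FiniteDimensional ℝ V] in
theorem leeTensor_apply_apply (θ : V →ₗ[ℝ] ℝ) (X Y Z : V) :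
    leeTensor A θ (A X) (A Y) Z = leeTensor A θ X Y Z := by
  simp [hA.sq, hA.skew]; ring

/-- In the anti-invariant part `A` can be moved freely between all three arguments, so the
conditions defining `hermitianTensors` survive cyclic permutation and hence the cyclic sum. In the
invariant part the factor D - 2 normalizes the trace correction. -/
theorem ghPart_mem (hD : (Module.finrank ℝ V : ℝ) - 2 ≠ 0) {ψ : TriForm V}
    (hψ : ψ ∈ hermitianTensors A) (i : Fin 4) : ghPart A i ψ ∈ grayHervella A i := by
  obtain ⟨h₁, h₂⟩ := hψ
  have h₃ : ∀ X Y Z, ψ X (A Y) Z = ψ X Y (A Z) := fun X Y Z => by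
    have := h₂ X Y (A Z)
    rw [hA.sq, map_neg] at this
    linarith
  have hanti : ∀ φ : TriForm V, φ = antiPart A ψ → (∀ X Y Z, φ X Y Z = -φ X Z Y) ∧
      (∀ X Y Z, φ X (A Y) Z = φ X Y (A Z)) ∧ (∀ X Y Z, φ (A X) Y Z = φ X Y (A Z)) := by
    rintro φ rfl
    refine ⟨fun X Y Z => ?_, fun X Y Z => ?_, fun X Y Z => ?_⟩
    · simp only [antiPart_apply]
      rw [h₁ X Y Z, h₃, h₁ _ Y (A Z)]; ring
    · simp only [antiPart_apply]
      rw [h₃, h₃]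
    · simp only [antiPart_apply, hA.sq, map_neg, LinearMap.neg_apply]
      rw [h₃, h₃, hA.sq, map_neg]; ring
  fin_cases i
  · obtain ⟨a, b, c⟩ := hanti _ rfl
    refine ⟨⟨fun X Y Z => ?_, fun X Y Z => ?_⟩, fun X Z => ?_⟩
    · simp only [ghPart, Fin.zero_eta, Matrix.cons_val_zero, LinearMap.smul_apply,
        LinearMap.comp_apply, cyclicSum_apply, smul_eq_mul]
      rw [a X Y Z, a Y Z X, a Z X Y]; ring
    · simp only [ghPart, Fin.zero_eta, Matrix.cons_val_zero, LinearMap.smul_apply,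
        LinearMap.comp_apply, cyclicSum_apply, smul_eq_mul]
      rw [b X Y (A Z), c Y (A Z) X, b Y Z, c Z X (A Y), hA.sq, hA.sq, hA.sq]
      simp only [map_neg]; ring
    · simp only [ghPart, Fin.zero_eta, Matrix.cons_val_zero, LinearMap.smul_apply,
        LinearMap.comp_apply, cyclicSum_apply, smul_eq_mul]
      have := a Z X X
      rw [a X X Z]; linarith
  · obtain ⟨a, b, c⟩ := hanti _ rfl
    refine ⟨⟨fun X Y Z => ?_, fun X Y Z => ?_⟩, fun X Y Z => ?_⟩
    · simp only [ghPart, Fin.mk_one, Matrix.cons_val_one, Matrix.cons_val_zero,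
        LinearMap.smul_apply, LinearMap.sub_apply, LinearMap.comp_apply, cyclicSum_apply,
        smul_eq_mul]
      rw [a X Y Z, a Y Z X, a Z X Y]; ring
    · simp only [ghPart, Fin.mk_one, Matrix.cons_val_one, Matrix.cons_val_zero,
        LinearMap.smul_apply, LinearMap.sub_apply, LinearMap.comp_apply, cyclicSum_apply,
        smul_eq_mul]
      rw [b X Y (A Z), c Y (A Z) X, b Y Z, c Z X (A Y), hA.sq, hA.sq, hA.sq]
      simp only [map_neg]; ring
    · simp only [ghPart, Fin.mk_one, Matrix.cons_val_one, Matrix.cons_val_zero,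
        LinearMap.smul_apply, LinearMap.sub_apply, LinearMap.comp_apply, cyclicSum_apply,
        smul_eq_mul]
      ring
  · have hinv : invPart A ψ ∈ hermitianTensors A := by
      refine ⟨fun X Y Z => ?_, fun X Y Z => ?_⟩
      · simp only [invPart_apply]
        rw [h₁ X Y Z, h₃, h₁ _ Y (A Z)]; ring
      · simp only [invPart_apply]
        rw [h₂, h₂]; ring
    refine ⟨Submodule.sub_mem _ hinv (Submodule.smul_mem _ _
      (hA.leeTensor_mem_hermitianTensors _)), fun X Y Z => ?_, fun Z => ?_⟩
    · simp only [ghPart, Fin.reduceFinMk, Matrix.cons_val, LinearMap.sub_apply, leePart,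
        LinearMap.smul_apply, LinearMap.comp_apply, hA.leeTensor_apply_apply, invPart_apply,
        hA.sq, map_neg, LinearMap.neg_apply]
      ring
    · rw [← traceMap_apply]
      simp [ghPart, leePart, hA.traceMap_invPart, hA.traceMap_leeTensor, hD]
  · exact ⟨((Module.finrank ℝ V : ℝ) - 2)⁻¹ • traceMap ψ, fun X Y Z => by
      simp [ghPart, leePart]; ring⟩

/-- Elements of 𝒲₁ and 𝒲₂ have no invariant part, those of 𝒲₃ and 𝒲₄ no anti-invariant part. Within
each pair, the cyclic sum or the trace separates the two modules. -/
theorem ghPart_eq_zero (hD : (Module.finrank ℝ V : ℝ) - 2 ≠ 0) {i j : Fin 4} (hij : i ≠ j)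
    {ψ : TriForm V} (hψ : ψ ∈ grayHervella A j) : ghPart A i ψ = 0 := by
  have hv : ∀ {φ : TriForm V} {i : Fin 4}, antiPart A φ = 0 → i = 0 ∨ i = 1 → ghPart A i φ = 0 := by
    rintro φ i hφ (rfl | rfl) <;> simp [ghPart, hφ]
  have hi : ∀ {φ : TriForm V} {i : Fin 4}, invPart A φ = 0 → i = 2 ∨ i = 3 → ghPart A i φ = 0 := by
    intro φ i hφ hi
    have : leePart A φ = 0 := by
      rw [leePart, LinearMap.smul_apply, LinearMap.comp_apply, ← hA.traceMap_invPart, hφ]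
      simp
    rcases hi with rfl | rfl <;> simp [ghPart, hφ, this]
  fin_cases j
  · obtain ⟨⟨h₁, h₂⟩, h₃⟩ := hψ
    have h₄ : ∀ X Y Z, ψ X Y Z = -ψ Y X Z := fun X Y Z => by
      have := h₃ (X + Y) Z
      simp only [map_add, LinearMap.add_apply] at this
      linarith [h₃ X Z, h₃ Y Z]
    have h₅ : ∀ X Y Z, ψ (A X) (A Y) Z = -ψ X Y Z := fun X Y Z => by
      rw [h₁, h₄, h₂, h₄ Z X, h₁ X Z Y]; ring
    have h₆ : antiPart A ψ = ψ := TriForm.ext fun X Y Z => by rw [antiPart_apply, h₅]; ring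
    have h₇ : invPart A ψ = 0 := TriForm.ext fun X Y Z => by rw [invPart_apply, h₅]; simp
    have : i = 1 ∨ i = 2 ∨ i = 3 := by revert hij; fin_cases i <;> simp
    rcases this with rfl | h
    · refine TriForm.ext fun X Y Z => ?_
      simp only [ghPart, Matrix.cons_val_one, Matrix.cons_val_zero,
        LinearMap.smul_apply, LinearMap.sub_apply, LinearMap.comp_apply, cyclicSum_apply,
        smul_eq_mul, h₆, LinearMap.zero_apply]
      rw [h₄ Y Z X, h₁ Z Y X, h₄ Z X Y, h₁ X Z Y]; ring
    · exact hi h₇ h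
  · obtain ⟨⟨h₁, h₂⟩, h₃⟩ := hψ
    have h₄ : ∀ X Y Z, ψ X (A Y) Z = ψ X Y (A Z) := fun X Y Z => by
      have := h₂ X Y (A Z)
      rw [hA.sq, map_neg] at this
      linarith
    have h₅ : ∀ X Y Z, ψ (A X) (A Y) Z = -ψ X Y Z := fun X Y Z => by
      -- Four instances of the cyclic identity, with `A` inserted in no argument or in two of the
      -- three, combine to give the sign.
      have e₁ := h₃ X Y Z
      have e₂ := h₃ (A X) (A Y) Z
      have e₃ := h₃ (A X) Y (A Z)
      have e₄ := h₃ X (A Y) (A Z)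
      rw [h₂] at e₂ e₃ e₄
      rw [← h₄] at e₂ e₃ e₄
      linarith
    have h₆ : antiPart A ψ = ψ := TriForm.ext fun X Y Z => by rw [antiPart_apply, h₅]; ring
    have h₇ : invPart A ψ = 0 := TriForm.ext fun X Y Z => by rw [invPart_apply, h₅]; simp
    have : i = 0 ∨ i = 2 ∨ i = 3 := by revert hij; fin_cases i <;> simp
    rcases this with rfl | h
    · refine TriForm.ext fun X Y Z => ?_
      have := h₃ X Y Z
      simp [ghPart, h₆, this]
    · exact hi h₇ h
  · obtain ⟨-, h₁, h₂⟩ := hψ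
    have h₆ : antiPart A ψ = 0 := TriForm.ext fun X Y Z => by rw [antiPart_apply, h₁]; simp
    have : i = 3 ∨ (i = 0 ∨ i = 1) := by revert hij; fin_cases i <;> simp
    rcases this with rfl | h
    · have : traceMap ψ = 0 := LinearMap.ext fun Z => by rw [traceMap_apply, h₂]; rfl
      simp [ghPart, leePart, this]
    · exact hv h₆ h
  · obtain ⟨θ, hθ⟩ := hψ
    obtain rfl : ψ = leeTensor A θ := TriForm.ext fun X Y Z => by rw [hθ, leeTensor_apply]
    have h₆ : antiPart A (leeTensor A θ) = 0 :=
      TriForm.ext fun X Y Z => by rw [antiPart_apply, hA.leeTensor_apply_apply]; simp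
    have : i = 2 ∨ (i = 0 ∨ i = 1) := by revert hij; fin_cases i <;> simp
    rcases this with rfl | h
    · have h₇ : invPart A (leeTensor A θ) = leeTensor A θ :=
        TriForm.ext fun X Y Z => by rw [invPart_apply, hA.leeTensor_apply_apply]; ring
      simp [ghPart, leePart, h₇, hA.traceMap_leeTensor, smul_smul, hD]
    · exact hv h₆ h

/-- The four projections add up to the identity and each kills the other modules, so membership in a
sum of modules can be tested componentwise. -/
theorem mem_ghClass_iff (hD : (Module.finrank ℝ V : ℝ) - 2 ≠ 0) {ψ : TriForm V}
    (hψ : ψ ∈ hermitianTensors A) (a : GHType) :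
    ψ ∈ ghClass A a ↔ ∀ i ∉ a, ghPart A i ψ = 0 := by
  constructor
  · intro h i hi
    have : ghClass A a ≤ LinearMap.ker (ghPart A i) := iSup₂_le fun j hj φ hφ =>
      LinearMap.mem_ker.2 (hA.ghPart_eq_zero hD (fun e => hi (by rwa [e])) hφ)
    exact LinearMap.mem_ker.1 (this h)
  · intro h
    rw [← sum_ghPart A ψ]
    refine Submodule.sum_mem _ fun i _ => ?_
    by_cases hi : i ∈ a
    · exact Submodule.mem_iSup_of_mem i (Submodule.mem_iSup_of_mem hi (hA.ghPart_mem hD hψ i))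
    · rw [h i hi]
      exact Submodule.zero_mem _

end IsOrthogonalComplex

end Trace

end TriForms

/-! ### Solving the relations by quaternion-Hermitian forms -/

section Quaternionic

set_option maxSynthPendingDepth 5

variable {V : Type*} [NormedAddCommGroup V] [InnerProductSpace ℝ V]

/-- `A`, `B`, `C` is a quaternionic triple of orthogonal complex structures. -/
structure IsQuaternionicTriple (A B C : V →L[ℝ] V) : Prop where
  cplxA : IsOrthogonalComplex A
  cplxB : IsOrthogonalComplex B
  cplxC : IsOrthogonalComplex C
  AB : ∀ v, A (B v) = C v
  BC : ∀ v, B (C v) = A v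
  CA : ∀ v, C (A v) = B v
  BA : ∀ v, B (A v) = -C v
  CB : ∀ v, C (B v) = -A v
  AC : ∀ v, A (C v) = -B v

theorem IsQuaternionicTriple.rotate {A B C : V →L[ℝ] V} (h : IsQuaternionicTriple A B C) :
    IsQuaternionicTriple B C A :=
  ⟨h.cplxB, h.cplxC, h.cplxA, h.BC, h.CA, h.AB, h.CB, h.AC, h.BA⟩

theorem IsHyperHermitian.isQuaternionicTriple_zero {Q : Fin 3 → V →L[ℝ] V}
    (hQ : IsHyperHermitian Q) : IsQuaternionicTriple (Q 0) (Q 1) (Q 2) := by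
  have hc : ∀ i, (∀ v, Q i (Q i v) = -v) → IsOrthogonalComplex (Q i) := fun i h => ⟨h, fun v w => by
    rw [← hQ.isometry i (Q i v), h, inner_neg_left]⟩
  have h2 : ∀ v, Q 2 (Q 2 v) = -v := fun v => by
    rw [hQ.K_eq v, hQ.K_eq, ← neg_eq_iff_eq_neg.2 (hQ.anti (Q 1 v)), hQ.sq_J]
    simp [hQ.sq_I]
  refine ⟨hc 0 hQ.sq_I, hc 1 hQ.sq_J, hc 2 h2, fun v => (hQ.K_eq v).symm, fun v => ?_, fun v => ?_,
    fun v => ?_, fun v => ?_, fun v => ?_⟩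
  · rw [hQ.K_eq, hQ.anti, map_neg, hQ.sq_J, neg_neg]
  · rw [hQ.K_eq, hQ.anti, hQ.sq_I, map_neg, neg_neg]
  · rw [hQ.K_eq, hQ.anti, neg_neg]
  · rw [hQ.K_eq, hQ.sq_J, map_neg]
  · rw [hQ.K_eq, hQ.sq_I]

theorem IsHyperHermitian.isQuaternionicTriple {Q : Fin 3 → V →L[ℝ] V}
    (hQ : IsHyperHermitian Q) (i : Fin 3) :
    IsQuaternionicTriple (Q i) (Q (i + 1)) (Q (i + 2)) := by
  have h := hQ.isQuaternionicTriple_zero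
  fin_cases i
  exacts [h, h.rotate, h.rotate.rotate]

/-- The trilinear forms which are symmetric and quaternion-Hermitian in the last two arguments. -/
def quatForms (A B C : V →L[ℝ] V) : Submodule ℝ (TriForm V) where
  carrier := {y | (∀ X Y Z, y X Y Z = y X Z Y) ∧ (∀ X Y Z, y X Y (A Z) = -y X (A Y) Z) ∧
    (∀ X Y Z, y X Y (B Z) = -y X (B Y) Z) ∧ ∀ X Y Z, y X Y (C Z) = -y X (C Y) Z}
  add_mem' {y z} hy hz := by
    refine ⟨fun X Y Z => ?_, fun X Y Z => ?_, fun X Y Z => ?_, fun X Y Z => ?_⟩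
    · simp only [LinearMap.add_apply]; rw [hy.1, hz.1]
    · simp only [LinearMap.add_apply]; rw [hy.2.1, hz.2.1]; ring
    · simp only [LinearMap.add_apply]; rw [hy.2.2.1, hz.2.2.1]; ring
    · simp only [LinearMap.add_apply]; rw [hy.2.2.2, hz.2.2.2]; ring
  zero_mem' := by simp
  smul_mem' c y hy := by
    refine ⟨fun X Y Z => ?_, fun X Y Z => ?_, fun X Y Z => ?_, fun X Y Z => ?_⟩
    · simp only [LinearMap.smul_apply]; rw [hy.1]
    · simp only [LinearMap.smul_apply, smul_eq_mul]; rw [hy.2.1]; ring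
    · simp only [LinearMap.smul_apply, smul_eq_mul]; rw [hy.2.2.1]; ring
    · simp only [LinearMap.smul_apply, smul_eq_mul]; rw [hy.2.2.2]; ring

theorem quatForms_rotate (A B C : V →L[ℝ] V) : quatForms B C A = quatForms A B C := by
  ext y
  exact ⟨fun h => ⟨h.1, h.2.2.2, h.2.1, h.2.2.1⟩, fun h => ⟨h.1, h.2.2.1, h.2.2.2, h.2.1⟩⟩

/-- The projection of `quatForms` to its totally skew part. -/
noncomputable def skewProj (A B C : V →L[ℝ] V) : TriForm V →ₗ[ℝ] TriForm V where
  toFun y := triForm fun X Y Z => (2 * y X Y Z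
    + (-y Y X Z + y (A Y) (A X) Z + y (B Y) (B X) Z + y (C Y) (C X) Z)
    + (-y Z X Y + y (A Z) (A X) Y + y (B Z) (B X) Y + y (C Z) (C X) Y)) / 6
  map_add' ψ φ := TriForm.ext fun X Y Z => by simp [triForm]; ring
  map_smul' c ψ := TriForm.ext fun X Y Z => by simp [triForm]; ring

theorem skewProj_apply (A B C : V →L[ℝ] V) (y : TriForm V) (X Y Z : V) :
    skewProj A B C y X Y Z = (2 * y X Y Z
    + (-y Y X Z + y (A Y) (A X) Z + y (B Y) (B X) Z + y (C Y) (C X) Z)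
    + (-y Z X Y + y (A Z) (A X) Y + y (B Z) (B X) Y + y (C Z) (C X) Y)) / 6 := rfl

theorem skewProj_rotate (A B C : V →L[ℝ] V) : skewProj B C A = skewProj A B C :=
  LinearMap.ext fun y => TriForm.ext fun X Y Z => by simp only [skewProj_apply]; ring

/-- The tensor `ψ_A` determined by `y_B` and `y_C`. -/
noncomputable def pairTensor (B C : V →L[ℝ] V) (y z : TriForm V) : TriForm V :=
  triForm fun X Y Z => y (B X) (C Y) Z - z (C X) (B Y) Z

@[simp]
theorem pairTensor_apply (B C : V →L[ℝ] V) (y z : TriForm V) (X Y Z : V) :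
    pairTensor B C y z X Y Z = y (B X) (C Y) Z - z (C X) (B Y) Z := rfl

/-- The form `y_A` recovered from `ψ_C`. -/
noncomputable def recoverForm (A B : V →L[ℝ] V) (ψ : TriForm V) : TriForm V :=
  triForm fun X Y Z => (ψ (A X) (B Y) Z - ψ (A X) Y (B Z)) / 2

@[simp]
theorem recoverForm_apply (A B : V →L[ℝ] V) (ψ : TriForm V) (X Y Z : V) :
    recoverForm A B ψ X Y Z = (ψ (A X) (B Y) Z - ψ (A X) Y (B Z)) / 2 := rfl

namespace IsQuaternionicTriple

variable {A B C : V →L[ℝ] V} (h : IsQuaternionicTriple A B C)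
include h

theorem recoverForm_mem {ψ : TriForm V} (hψ : ψ ∈ hermitianTensors C) :
    recoverForm A B ψ ∈ quatForms A B C := by
  obtain ⟨h₁, h₂⟩ := hψ
  have h₃ : ∀ X Y Z, ψ X Y (C Z) = ψ X (C Y) Z := fun X Y Z => by
    have := h₂ X Y (C Z)
    rw [h.cplxC.sq, map_neg] at this
    linarith
  have hB : ∀ X Y Z, recoverForm A B ψ X Y (B Z) = -recoverForm A B ψ X (B Y) Z := fun X Y Z => by
    simp [h.cplxB.sq]; ring
  have hC : ∀ X Y Z, recoverForm A B ψ X Y (C Z) = -recoverForm A B ψ X (C Y) Z := fun X Y Z => by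
    have e₁ := h₃ (A X) Y (B Z)
    have e₂ := h₃ (A X) (B Y) Z
    rw [h.CB, map_neg] at e₁
    rw [h.CB, map_neg, LinearMap.neg_apply] at e₂
    simp only [recoverForm_apply, h.BC]
    linarith
  refine ⟨fun X Y Z => ?_, fun X Y Z => ?_, hB, hC⟩
  · simp only [recoverForm_apply]
    rw [h₁ _ (B Y), h₁ _ Y]; ring
  · rw [← h.BC, hB, hC, h.CB, ← h.BC]
    simp [h.CB, h.BC]

/-- The tensors ψ_A and ψ_B yield y_B and y_C. Replacing them by their definitions leaves an
expression that reduces to ψ_A by the relation at (X, Y, Z) and at (X, CY, CZ). -/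
theorem pairTensor_recoverForm {ψA ψB ψC : TriForm V} (hA : ψA ∈ hermitianTensors A)
    (hB : ψB ∈ hermitianTensors B) (hC : ψC ∈ hermitianTensors C)
    (hr : ∀ X Y Z, ψA X Y Z = ψB X (C Y) Z - ψC X Y (B Z)) :
    pairTensor B C (recoverForm B C ψA) (recoverForm C A ψB) = ψA := by
  refine TriForm.ext fun X Y Z => ?_
  have e₁ := hr X (C Y) (C Z)
  have e₂ := hC.2 X Y (B Z)
  have e₃ := hB.2 X Y (C Z)
  have e₄ := hr X Y Z
  rw [h.cplxC.sq, h.BC] at e₁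
  rw [h.BC] at e₃
  rw [h.CB] at e₂
  simp only [map_neg, LinearMap.neg_apply] at e₁ e₂
  simp [h.cplxB.sq, h.cplxC.sq, h.AB]
  linarith

theorem pairTensor_mem {y z : TriForm V} (hy : y ∈ quatForms A B C) (hz : z ∈ quatForms A B C) :
    pairTensor B C y z ∈ hermitianTensors A := by
  refine ⟨fun X Y Z => ?_, fun X Y Z => ?_⟩
  · simp only [pairTensor_apply]
    rw [hy.1, hy.2.2.2, hz.1, hz.2.2.1]; ring
  · simp only [pairTensor_apply]
    rw [hy.2.1, hz.2.1, h.CA, h.BA, h.AB, map_neg, h.AC]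
    simp
    ring

/-- On the right, both tensors contain the term y_A(AX, Y, Z), which cancels; the remaining terms in
y_B and y_C are those on the left. -/
theorem pairTensor_relation {yA yB yC : TriForm V} (hA : yA ∈ quatForms A B C)
    (hB : yB ∈ quatForms A B C) (hC : yC ∈ quatForms A B C) (X Y Z : V) :
    pairTensor B C yB yC X Y Z =
      pairTensor C A yC yA X (C Y) Z - pairTensor A B yA yB X Y (B Z) := by
  simp only [pairTensor_apply]
  rw [hA.2.2.1, hB.2.2.1, h.cplxB.sq, h.BA, h.AC, h.cplxC.sq]
  simp
  ring

theorem antiPart_pairTensor (y z : TriForm V) : antiPart A (pairTensor B C y z) =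
    (2⁻¹ : ℝ) • pairTensor B C (y - z) (-(y - z)) := by
  refine TriForm.ext fun X Y Z => ?_
  simp [h.BA, h.CA]; ring

theorem invPart_pairTensor (y z : TriForm V) : invPart A (pairTensor B C y z) =
    (2⁻¹ : ℝ) • pairTensor B C (y + z) (y + z) := by
  refine TriForm.ext fun X Y Z => ?_
  simp [h.BA, h.CA]; ring

omit h in
theorem mem_swap {y : TriForm V} (hy : y ∈ quatForms A B C) (X Y Z : V) :
    y X Y Z = y X Z Y ∧ y X (A Y) Z = -y X (A Z) Y ∧ y X (B Y) Z = -y X (B Z) Y ∧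
      y X (C Y) Z = -y X (C Z) Y := by
  refine ⟨hy.1 X Y Z, ?_, ?_, ?_⟩
  · rw [hy.1, hy.2.1]
  · rw [hy.1, hy.2.2.1]
  · rw [hy.1, hy.2.2.2]

theorem skewProj_mem {y : TriForm V} (hy : y ∈ quatForms A B C) :
    skewProj A B C y ∈ quatForms A B C := by
  refine ⟨fun X Y Z => ?_, fun X Y Z => ?_, fun X Y Z => ?_, fun X Y Z => ?_⟩
  · simp only [skewProj_apply]
    rw [hy.1 X Y Z]; ring
  all_goals
    simp only [skewProj_apply, h.cplxA.sq, h.cplxB.sq, h.cplxC.sq, h.AB, h.BC, h.CA, h.BA, h.CB, h.AC,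
      map_neg, LinearMap.neg_apply, neg_neg, hy.2.1, hy.2.2.1, hy.2.2.2,
      fun a => (mem_swap hy a Z X).1, fun a => (mem_swap hy a Z X).2.1,
      fun a => (mem_swap hy a Z X).2.2.1, fun a => (mem_swap hy a Z X).2.2.2,
      fun a => (mem_swap hy a Z Y).1, fun a => (mem_swap hy a Z Y).2.1,
      fun a => (mem_swap hy a Z Y).2.2.1, fun a => (mem_swap hy a Z Y).2.2.2,
      fun a => (mem_swap hy a Y X).1, fun a => (mem_swap hy a Y X).2.1,
      fun a => (mem_swap hy a Y X).2.2.1, fun a => (mem_swap hy a Y X).2.2.2]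
    ring

theorem skewProj_skewProj {y : TriForm V} (hy : y ∈ quatForms A B C) :
    skewProj A B C (skewProj A B C y) = skewProj A B C y := by
  refine TriForm.ext fun X Y Z => ?_
  simp only [skewProj_apply, h.cplxA.sq, h.cplxB.sq, h.cplxC.sq, h.AB, h.BC, h.CA, h.BA, h.CB, h.AC,
      map_neg, LinearMap.neg_apply, neg_neg, hy.2.1, hy.2.2.1, hy.2.2.2,
      fun a => (mem_swap hy a Z X).1, fun a => (mem_swap hy a Z X).2.1,
      fun a => (mem_swap hy a Z X).2.2.1, fun a => (mem_swap hy a Z X).2.2.2,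
      fun a => (mem_swap hy a Z Y).1, fun a => (mem_swap hy a Z Y).2.1,
      fun a => (mem_swap hy a Z Y).2.2.1, fun a => (mem_swap hy a Z Y).2.2.2,
      fun a => (mem_swap hy a Y X).1, fun a => (mem_swap hy a Y X).2.1,
      fun a => (mem_swap hy a Y X).2.2.1, fun a => (mem_swap hy a Y X).2.2.2]
  ring

/-- This is the origin of the formula for `skewProj`: it is one third of the cyclic sum, transported
to `quatForms`. -/
theorem cyclicSum_pairTensor {y : TriForm V} (hy : y ∈ quatForms A B C) :
    (3⁻¹ : ℝ) • cyclicSum (pairTensor B C y (-y)) =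
      pairTensor B C (skewProj A B C y) (-skewProj A B C y) := by
  refine TriForm.ext fun X Y Z => ?_
  simp only [LinearMap.smul_apply, smul_eq_mul, cyclicSum_apply, pairTensor_apply,
      skewProj_apply, h.cplxA.sq, h.cplxB.sq, h.cplxC.sq, h.AB, h.BC, h.CA, h.BA, h.CB, h.AC,
      map_neg, LinearMap.neg_apply, neg_neg, hy.2.1, hy.2.2.1, hy.2.2.2,
      fun a => (mem_swap hy a Z X).1, fun a => (mem_swap hy a Z X).2.1,
      fun a => (mem_swap hy a Z X).2.2.1, fun a => (mem_swap hy a Z X).2.2.2,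
      fun a => (mem_swap hy a Z Y).1, fun a => (mem_swap hy a Z Y).2.1,
      fun a => (mem_swap hy a Z Y).2.2.1, fun a => (mem_swap hy a Z Y).2.2.2,
      fun a => (mem_swap hy a Y X).1, fun a => (mem_swap hy a Y X).2.1,
      fun a => (mem_swap hy a Y X).2.2.1, fun a => (mem_swap hy a Y X).2.2.2]
  ring

/-- The hypothesis makes `y` invariant under `A` in its first two arguments. Exchanging the last two
arguments by symmetry and moving `A` across reverses the sign, so y = -y. -/
theorem eq_zero_of_pairTensor_neg {y : TriForm V} (hy : y ∈ quatForms A B C)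
    (h₀ : pairTensor B C y (-y) = 0) : y = 0 := by
  have h₁ : ∀ X Y Z, y X Y Z = y (A X) (A Y) Z := fun X Y Z => by
    have := congrArg (fun φ : TriForm V => φ (B X) (C Y) Z) h₀
    simp [h.cplxB.sq, h.cplxC.sq, h.CB, h.BC] at this
    linarith
  refine TriForm.ext fun X Y Z => ?_
  have e₁ := h₁ X Y Z
  have e₂ := h₁ X Z Y
  rw [hy.1, hy.1 (A X), hy.2.1] at e₂
  simp only [LinearMap.zero_apply]
  linarith

theorem eq_zero_of_pairTensor_self {y : TriForm V} (hy : y ∈ quatForms A B C)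
    (h₀ : pairTensor B C y y = 0) : y = 0 := by
  have h₁ : ∀ X Y Z, y X Y Z = -y (A X) (A Y) Z := fun X Y Z => by
    have := congrArg (fun φ : TriForm V => φ (B X) (C Y) Z) h₀
    simp [h.cplxB.sq, h.cplxC.sq, h.CB, h.BC] at this
    linarith
  refine TriForm.ext fun X Y Z => ?_
  have e₁ := h₁ X Y Z
  have e₂ := h₁ X Z Y
  rw [hy.1, hy.1 (A X), hy.2.1] at e₂
  simp only [LinearMap.zero_apply]
  linarith

end IsQuaternionicTriple

end Quaternionic

/-! ### Traces and the copy of V* in the quaternion-Hermitian forms -/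

section QuaternionicTrace

set_option maxSynthPendingDepth 5

variable {V : Type*} [NormedAddCommGroup V] [InnerProductSpace ℝ V]

/-- The element of `quatForms` determined by a one-form. -/
noncomputable def quatTensor (A B C : V →L[ℝ] V) : (V →ₗ[ℝ] ℝ) →ₗ[ℝ] TriForm V where
  toFun w := triForm (fun X Y Z => inner ℝ X Y * w Z + inner ℝ X (A Y) * w (A Z)
      + inner ℝ X (B Y) * w (B Z) + inner ℝ X (C Y) * w (C Z)
      + (inner ℝ X Z * w Y + inner ℝ X (A Z) * w (A Y)
      + inner ℝ X (B Z) * w (B Y) + inner ℝ X (C Z) * w (C Y)))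
    (by intros; simp [inner_add_left]; ring) (by intros; simp [inner_smul_left]; ring)
    (by intros; simp [inner_add_right]; ring) (by intros; simp [inner_smul_right]; ring)
    (by intros; simp [inner_add_right]; ring) (by intros; simp [inner_smul_right]; ring)
  map_add' θ η := TriForm.ext fun X Y Z => by simp [triForm]; ring
  map_smul' c θ := TriForm.ext fun X Y Z => by simp [triForm]; ring

theorem quatTensor_apply (A B C : V →L[ℝ] V) (w : V →ₗ[ℝ] ℝ) (X Y Z : V) :
    quatTensor A B C w X Y Z = inner ℝ X Y * w Z + inner ℝ X (A Y) * w (A Z)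
      + inner ℝ X (B Y) * w (B Z) + inner ℝ X (C Y) * w (C Z)
      + (inner ℝ X Z * w Y + inner ℝ X (A Z) * w (A Y)
      + inner ℝ X (B Z) * w (B Y) + inner ℝ X (C Z) * w (C Y)) := rfl

theorem quatTensor_rotate (A B C : V →L[ℝ] V) : quatTensor B C A = quatTensor A B C :=
  LinearMap.ext fun y => TriForm.ext fun X Y Z => by simp only [quatTensor_apply]; ring

/-- The product of a one-form with a symmetric quaternion-Hermitian form. -/
noncomputable def productForm (A B C : V →L[ℝ] V) (v a b : V) : TriForm V :=
  triForm (fun X Y Z => inner ℝ X v * ((inner ℝ Y a * inner ℝ Z b + inner ℝ Y (A a) * inner ℝ Z (A b)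
      + inner ℝ Y (B a) * inner ℝ Z (B b) + inner ℝ Y (C a) * inner ℝ Z (C b))
      + (inner ℝ Z a * inner ℝ Y b + inner ℝ Z (A a) * inner ℝ Y (A b)
      + inner ℝ Z (B a) * inner ℝ Y (B b) + inner ℝ Z (C a) * inner ℝ Y (C b))))
    (by intros; simp [inner_add_left]; ring) (by intros; simp [inner_smul_left]; ring)
    (by intros; simp [inner_add_left]; ring) (by intros; simp [inner_smul_left]; ring)
    (by intros; simp [inner_add_left]; ring) (by intros; simp [inner_smul_left]; ring)

theorem productForm_apply (A B C : V →L[ℝ] V) (v a b X Y Z : V) :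
    productForm A B C v a b X Y Z =
      inner ℝ X v * ((inner ℝ Y a * inner ℝ Z b + inner ℝ Y (A a) * inner ℝ Z (A b)
      + inner ℝ Y (B a) * inner ℝ Z (B b) + inner ℝ Y (C a) * inner ℝ Z (C b))
      + (inner ℝ Z a * inner ℝ Y b + inner ℝ Z (A a) * inner ℝ Y (A b)
      + inner ℝ Z (B a) * inner ℝ Y (B b) + inner ℝ Z (C a) * inner ℝ Y (C b))) := rfl

namespace IsQuaternionicTriple

variable {A B C : V →L[ℝ] V} (h : IsQuaternionicTriple A B C)
include h

theorem quatTensor_mem (w : V →ₗ[ℝ] ℝ) : quatTensor A B C w ∈ quatForms A B C := by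
  refine ⟨fun X Y Z => ?_, fun X Y Z => ?_, fun X Y Z => ?_, fun X Y Z => ?_⟩
  · simp only [quatTensor_apply]; ring
  all_goals
    simp only [quatTensor_apply, h.cplxA.sq, h.cplxB.sq, h.cplxC.sq, h.AB, h.BC, h.CA, h.BA, h.CB,
      h.AC, map_neg, inner_neg_right]
    ring

theorem productForm_mem (v a b : V) : productForm A B C v a b ∈ quatForms A B C := by
  refine ⟨fun X Y Z => ?_, fun X Y Z => ?_, fun X Y Z => ?_, fun X Y Z => ?_⟩
  · simp only [productForm_apply]; ring
  all_goals
    simp only [productForm_apply, h.cplxA.skew, h.cplxB.skew, h.cplxC.skew, h.cplxA.sq, h.cplxB.sq,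
      h.cplxC.sq, h.AB, h.BC, h.CA, h.BA, h.CB, h.AC, map_neg, inner_neg_right]
    ring

theorem pairTensor_quatTensor (w : V →ₗ[ℝ] ℝ) :
    pairTensor B C (quatTensor A B C w) (quatTensor A B C w) =
      leeTensor A ((-2 : ℝ) • w ∘ₗ A.toLinearMap) := by
  refine TriForm.ext fun X Y Z => ?_
  simp only [quatTensor_apply, pairTensor_apply, leeTensor_apply, LinearMap.smul_apply,
    LinearMap.comp_apply, ContinuousLinearMap.coe_coe, h.cplxB.skew, h.cplxC.skew, h.cplxA.sq,
    h.cplxB.sq, h.cplxC.sq, h.AB, h.BC, h.CA, h.BA, h.CB, h.AC, map_neg, inner_neg_right,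
    smul_eq_mul]
  ring

variable [FiniteDimensional ℝ V]

theorem traceMap_pairTensor {y : TriForm V} (hy : y ∈ quatForms A B C) :
    traceMap (pairTensor B C y y) = (-2 : ℝ) • traceMap y ∘ₗ A.toLinearMap := by
  ext Z
  have hβ : ∀ Z : V, ∀ J : V →L[ℝ] V, IsOrthogonalComplex J →
      ∑ i, y (J (stdOrthonormalBasis ℝ V i)) (J (stdOrthonormalBasis ℝ V i)) Z =
        ∑ i, y (stdOrthonormalBasis ℝ V i) (stdOrthonormalBasis ℝ V i) Z := fun Z J hJ =>
    hJ.sum_apply_apply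
      (LinearMap.mk₂ ℝ (fun X Y => y X Y Z) (by simp) (by simp) (by simp) (by simp))
  have e : ∀ v, pairTensor B C y y v v Z = -y (B v) (B v) (A Z) - y (C v) (C v) (A Z) := by
    intro v
    simp [hy.2.1, h.AB, h.AC]
  simp only [traceMap_eq_sum, e, Finset.sum_sub_distrib, Finset.sum_neg_distrib,
    hβ _ B h.cplxB, hβ _ C h.cplxC, LinearMap.smul_apply, LinearMap.comp_apply, smul_eq_mul,
    ContinuousLinearMap.coe_coe]
  ring

theorem traceMap_quatTensor (w : V →ₗ[ℝ] ℝ) :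
    traceMap (quatTensor A B C w) = ((Module.finrank ℝ V : ℝ) - 2) • w := by
  ext Z
  have hJ : ∀ J : V →L[ℝ] V, IsOrthogonalComplex J →
      ∑ i, inner ℝ (stdOrthonormalBasis ℝ V i) (J Z) * w (J (stdOrthonormalBasis ℝ V i)) =
        -w Z := fun J hJ => by
    have := sum_inner_mul (w ∘ₗ J.toLinearMap) (J Z)
    simpa [hJ.sq] using this
  simp only [traceMap_eq_sum, quatTensor_apply, h.cplxA.inner_self_apply,
    h.cplxB.inner_self_apply, h.cplxC.inner_self_apply, zero_mul, add_zero,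
    Finset.sum_add_distrib, ← Finset.sum_mul, sum_inner_self, sum_inner_mul, hJ A h.cplxA,
    hJ B h.cplxB, hJ C h.cplxC, LinearMap.smul_apply, smul_eq_mul]
  ring

theorem traceMap_skewProj {y : TriForm V} (hy : y ∈ quatForms A B C) (Z : V) :
    traceMap (skewProj A B C y) Z = (4 * traceMap y Z -
      ∑ i, y Z (stdOrthonormalBasis ℝ V i) (stdOrthonormalBasis ℝ V i)) / 6 := by
  have hβ : ∀ J : V →L[ℝ] V, IsOrthogonalComplex J →
      ∑ i, y (J (stdOrthonormalBasis ℝ V i)) (J (stdOrthonormalBasis ℝ V i)) Z =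
        ∑ i, y (stdOrthonormalBasis ℝ V i) (stdOrthonormalBasis ℝ V i) Z := fun J hJ =>
    hJ.sum_apply_apply
      (LinearMap.mk₂ ℝ (fun X Y => y X Y Z) (by simp) (by simp) (by simp) (by simp))
  have e₁ : ∀ X v, y X (A v) v = 0 := fun X v => by
    have h₁ := hy.1 X v (A v)
    rw [hy.2.1] at h₁
    linarith
  have e₂ : ∀ X v, y X (B v) v = 0 := fun X v => by
    have h₁ := hy.1 X v (B v)
    rw [hy.2.2.1] at h₁
    linarith
  have e₃ : ∀ X v, y X (C v) v = 0 := fun X v => by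
    have h₁ := hy.1 X v (C v)
    rw [hy.2.2.2] at h₁
    linarith
  simp only [traceMap_eq_sum, skewProj_apply, e₁, e₂, e₃, ← Finset.sum_div,
    Finset.sum_add_distrib, Finset.sum_neg_distrib, ← Finset.mul_sum, hβ A h.cplxA, hβ B h.cplxB,
    hβ C h.cplxC, Finset.sum_const_zero]
  ring

/-- Dividing this factor by D - 2, the factor of `traceMap_quatTensor`, gives the constant l of R P
R = l R. -/
theorem traceMap_skewProj_quatTensor (w : V →ₗ[ℝ] ℝ) :
    traceMap (skewProj A B C (quatTensor A B C w)) =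
      (2 * ((Module.finrank ℝ V : ℝ) - 4) / 3) • w := by
  ext Z
  have hJ : ∀ J : V →L[ℝ] V, IsOrthogonalComplex J →
      ∑ i, inner ℝ Z (J (stdOrthonormalBasis ℝ V i)) * w (J (stdOrthonormalBasis ℝ V i)) =
        w Z := fun J hJ => by
    have := sum_inner_mul (w ∘ₗ J.toLinearMap) (J Z)
    simp only [LinearMap.comp_apply, ContinuousLinearMap.coe_coe, hJ.sq, map_neg] at this
    rw [← neg_inj, ← this, ← Finset.sum_neg_distrib]
    refine Finset.sum_congr rfl fun i _ => ?_
    rw [← neg_mul, ← hJ.skew, real_inner_comm]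
  have h₁ : ∑ i, inner ℝ Z (stdOrthonormalBasis ℝ V i) * w (stdOrthonormalBasis ℝ V i) = w Z := by
    rw [← sum_inner_mul w Z]
    exact Finset.sum_congr rfl fun i _ => by rw [real_inner_comm]
  rw [h.traceMap_skewProj (h.quatTensor_mem w), h.traceMap_quatTensor]
  simp only [quatTensor_apply, Finset.sum_add_distrib, h₁, hJ A h.cplxA, hJ B h.cplxB,
    hJ C h.cplxC, LinearMap.smul_apply, smul_eq_mul]
  ring

theorem traceMap_productForm (v a b : V) (Z : V) :
    traceMap (productForm A B C v a b) Z =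
      (inner ℝ v a * inner ℝ Z b + inner ℝ v (A a) * inner ℝ Z (A b)
      + inner ℝ v (B a) * inner ℝ Z (B b) + inner ℝ v (C a) * inner ℝ Z (C b))
      + (inner ℝ Z a * inner ℝ v b + inner ℝ Z (A a) * inner ℝ v (A b)
      + inner ℝ Z (B a) * inner ℝ v (B b) + inner ℝ Z (C a) * inner ℝ v (C b)) := by
  have := sum_inner_mul (LinearMap.mk₂ ℝ (fun Z Y => (inner ℝ Y a * inner ℝ Z b + inner ℝ Y (A a) * inner ℝ Z (A b)
      + inner ℝ Y (B a) * inner ℝ Z (B b) + inner ℝ Y (C a) * inner ℝ Z (C b))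
      + (inner ℝ Z a * inner ℝ Y b + inner ℝ Z (A a) * inner ℝ Y (A b)
      + inner ℝ Z (B a) * inner ℝ Y (B b) + inner ℝ Z (C a) * inner ℝ Y (C b)))
    (by intros; simp [inner_add_left]; ring) (by intros; simp [inner_smul_left]; ring)
    (by intros; simp [inner_add_left]; ring) (by intros; simp [inner_smul_left]; ring) Z) v
  simpa [traceMap_eq_sum, productForm_apply] using this

theorem sum_productForm (v a b : V) (Z : V) :
    ∑ i, productForm A B C v a b Z (stdOrthonormalBasis ℝ V i) (stdOrthonormalBasis ℝ V i) =
      8 * inner ℝ Z v * inner ℝ a b := by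
  have key : ∀ p q : V, ∑ i, inner ℝ (stdOrthonormalBasis ℝ V i) p *
      inner ℝ (stdOrthonormalBasis ℝ V i) q = inner ℝ p q := fun p q => by
    rw [← (stdOrthonormalBasis ℝ V).sum_inner_mul_inner p q]
    exact Finset.sum_congr rfl fun i _ => by rw [real_inner_comm]
  simp only [productForm_apply, ← Finset.mul_sum, Finset.sum_add_distrib, key,
    h.cplxA.inner_apply_apply, h.cplxB.inner_apply_apply, h.cplxC.inner_apply_apply]
  ring

end IsQuaternionicTriple

end QuaternionicTrace

/-! ### Gray-Hervella components in terms of P and R; nonvanishing of the three parts -/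

section Correspondence

set_option maxSynthPendingDepth 5

variable {V : Type*} [NormedAddCommGroup V] [InnerProductSpace ℝ V]

theorem pairTensor_zero (B C : V →L[ℝ] V) : pairTensor B C 0 0 = 0 :=
  TriForm.ext fun X Y Z => by simp

theorem pairTensor_smul_smul (B C : V →L[ℝ] V) (c : ℝ) (y z : TriForm V) :
    pairTensor B C (c • y) (c • z) = c • pairTensor B C y z :=
  TriForm.ext fun X Y Z => by simp; ring

variable [FiniteDimensional ℝ V]

/-- The projection of `quatForms` to the image of `quatTensor`. -/
noncomputable def quatLeePart (A B C : V →L[ℝ] V) : TriForm V →ₗ[ℝ] TriForm V :=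
  ((Module.finrank ℝ V : ℝ) - 2)⁻¹ • quatTensor A B C ∘ₗ traceMap

theorem quatLeePart_apply (A B C : V →L[ℝ] V) (y : TriForm V) : quatLeePart A B C y =
    ((Module.finrank ℝ V : ℝ) - 2)⁻¹ • quatTensor A B C (traceMap y) := rfl

theorem quatLeePart_rotate (A B C : V →L[ℝ] V) : quatLeePart B C A = quatLeePart A B C := by
  rw [quatLeePart, quatTensor_rotate, quatLeePart]

/-- The analogue of `components` on all trilinear forms. -/
noncomputable def formComponents (A B C : V →L[ℝ] V) : Fin 4 → TriForm V →ₗ[ℝ] TriForm V :=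
  components (skewProj A B C) (quatLeePart A B C)

theorem formComponents_rotate (A B C : V →L[ℝ] V) :
    formComponents B C A = formComponents A B C := by
  rw [formComponents, skewProj_rotate, quatLeePart_rotate, formComponents]

namespace IsQuaternionicTriple

variable {A B C : V →L[ℝ] V} (h : IsQuaternionicTriple A B C)
include h

theorem quatLeePart_mem (y : TriForm V) : quatLeePart A B C y ∈ quatForms A B C :=
  Submodule.smul_mem _ _ (h.quatTensor_mem _)

theorem formComponents_mem {y : TriForm V} (hy : y ∈ quatForms A B C) (i : Fin 4) :
    formComponents A B C i y ∈ quatForms A B C := by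
  fin_cases i
  exacts [h.skewProj_mem hy, Submodule.sub_mem _ hy (h.skewProj_mem hy),
    Submodule.sub_mem _ hy (h.quatLeePart_mem y), h.quatLeePart_mem y]

theorem leePart_pairTensor {y z : TriForm V} (hy : y ∈ quatForms A B C)
    (hz : z ∈ quatForms A B C) : leePart A (pairTensor B C y z) =
      (2⁻¹ : ℝ) • pairTensor B C (quatLeePart A B C (y + z)) (quatLeePart A B C (y + z)) := by
  rw [leePart, LinearMap.smul_apply, LinearMap.comp_apply, ← h.cplxA.traceMap_invPart,
    h.invPart_pairTensor, map_smul, h.traceMap_pairTensor (Submodule.add_mem _ hy hz), map_smul,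
    quatLeePart_apply, pairTensor_smul_smul, h.pairTensor_quatTensor, smul_comm]

/-- The anti-invariant modules 𝒲₁ and 𝒲₂ see only y - z, the invariant ones 𝒲₃ and 𝒲₄ only y + z.
Inside each, the splitting is by P or by R, acting on a single form. -/
theorem ghPart_pairTensor {y z : TriForm V} (hy : y ∈ quatForms A B C)
    (hz : z ∈ quatForms A B C) (i : Fin 4) : ghPart A i (pairTensor B C y z) =
      (2⁻¹ : ℝ) • pairTensor B C (formComponents A B C i (y + combineSign i • z))
        (combineSign i • formComponents A B C i (y + combineSign i • z)) := by
  have h₀ : (3⁻¹ : ℝ) • cyclicSum (antiPart A (pairTensor B C y z)) = (2⁻¹ : ℝ) •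
      pairTensor B C (skewProj A B C (y - z)) (-skewProj A B C (y - z)) := by
    rw [h.antiPart_pairTensor, map_smul, smul_comm,
      h.cyclicSum_pairTensor (Submodule.sub_mem _ hy hz)]
  fin_cases i
  · simp only [ghPart, formComponents, components, combineSign, Fin.zero_eta,
      Matrix.cons_val_zero, neg_smul, one_smul, ← sub_eq_add_neg]
    exact h₀
  · simp only [ghPart, formComponents, components, combineSign, Fin.mk_one,
      Matrix.cons_val_one, Matrix.cons_val_zero, neg_smul, one_smul, ← sub_eq_add_neg]
    change antiPart A _ - (3⁻¹ : ℝ) • cyclicSum (antiPart A _) = _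
    rw [h₀, h.antiPart_pairTensor]
    refine TriForm.ext fun X Y Z => ?_
    simp; ring
  · simp only [ghPart, formComponents, components, combineSign, Fin.reduceFinMk,
      Matrix.cons_val, one_smul, LinearMap.sub_apply, h.leePart_pairTensor hy hz,
      h.invPart_pairTensor]
    refine TriForm.ext fun X Y Z => ?_
    simp; ring
  · simp only [ghPart, formComponents, components, combineSign, Fin.reduceFinMk,
      Matrix.cons_val, one_smul]
    exact h.leePart_pairTensor hy hz

/-- Nothing is lost in passing from forms to tensors, because forming the pair tensor is injective
on pairs (y, y) and on pairs (y, -y). -/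
theorem ghPart_pairTensor_eq_zero_iff {y z : TriForm V} (hy : y ∈ quatForms A B C)
    (hz : z ∈ quatForms A B C) (i : Fin 4) : ghPart A i (pairTensor B C y z) = 0 ↔
      formComponents A B C i (y + combineSign i • z) = 0 := by
  rw [h.ghPart_pairTensor hy hz]
  have hm := h.formComponents_mem (Submodule.add_mem _ hy (Submodule.smul_mem _ (combineSign i) hz)) i
  refine ⟨fun e => ?_, fun e => by rw [e, smul_zero, pairTensor_zero, smul_zero]⟩
  replace e := (smul_eq_zero.1 e).resolve_left (by norm_num)
  have : combineSign i = -1 ∨ combineSign i = 1 := by fin_cases i <;> simp [combineSign]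
  rcases this with hs | hs
  · rw [hs] at e hm ⊢
    exact h.eq_zero_of_pairTensor_neg hm (by rwa [neg_one_smul ℝ (formComponents A B C i _)] at e)
  · rw [hs] at e hm ⊢
    exact h.eq_zero_of_pairTensor_self hm (by rwa [one_smul ℝ (formComponents A B C i _)] at e)

/-- `skewProj` as an endomorphism of `quatForms`. -/
noncomputable def skewEnd : quatForms A B C →ₗ[ℝ] quatForms A B C :=
  (skewProj A B C).restrict fun _ hy => h.skewProj_mem hy

/-- `quatLeePart` as an endomorphism of `quatForms`. -/
noncomputable def leeEnd : quatForms A B C →ₗ[ℝ] quatForms A B C :=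
  (quatLeePart A B C).restrict fun y _ => h.quatLeePart_mem y

theorem coe_components (i : Fin 4) (y : quatForms A B C) :
    (components h.skewEnd h.leeEnd i y : TriForm V) = formComponents A B C i y := by
  fin_cases i <;> rfl

theorem quatLeePart_quatTensor (hD : (Module.finrank ℝ V : ℝ) - 2 ≠ 0) (w : V →ₗ[ℝ] ℝ) :
    quatLeePart A B C (quatTensor A B C w) = quatTensor A B C w := by
  rw [quatLeePart_apply, h.traceMap_quatTensor, map_smul, smul_smul, inv_mul_cancel₀ hD, one_smul]

/-- Here 1 - l = (D + 2)/(3(D - 2)), so both l and 1 - l are positive for D ≥ 8. -/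
theorem isProjectionPair (hD : 8 ≤ Module.finrank ℝ V) :
    IsProjectionPair h.skewEnd h.leeEnd
      (2 * ((Module.finrank ℝ V : ℝ) - 4) / (3 * ((Module.finrank ℝ V : ℝ) - 2))) := by
  have hD' : (8 : ℝ) ≤ Module.finrank ℝ V := by exact_mod_cast hD
  have hD₂ : (Module.finrank ℝ V : ℝ) - 2 ≠ 0 := by linarith
  have hD₄ : (Module.finrank ℝ V : ℝ) - 4 ≠ 0 := by linarith
  have hD₅ : (Module.finrank ℝ V : ℝ) + 2 ≠ 0 := by linarith
  refine ⟨fun z => Subtype.ext (h.skewProj_skewProj z.2), fun z => Subtype.ext ?_,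
    fun z => Subtype.ext ?_, by positivity, ?_⟩
  · change quatLeePart A B C (quatLeePart A B C z) = quatLeePart A B C z
    rw [quatLeePart_apply _ _ _ (z : TriForm V), map_smul, h.quatLeePart_quatTensor hD₂]
  · change quatLeePart A B C (skewProj A B C (quatLeePart A B C z)) = _ • quatLeePart A B C z
    rw [quatLeePart_apply _ _ _ (z : TriForm V), map_smul, map_smul, quatLeePart_apply,
      h.traceMap_skewProj_quatTensor, map_smul]
    simp only [smul_smul]
    congr 1
    field_simp
  · have : 1 - 2 * ((Module.finrank ℝ V : ℝ) - 4) / (3 * ((Module.finrank ℝ V : ℝ) - 2)) =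
        ((Module.finrank ℝ V : ℝ) + 2) / (3 * ((Module.finrank ℝ V : ℝ) - 2)) := by
      field_simp
      ring
    rw [this]
    positivity

theorem traceMap_eq_zero_of_leeEnd (hD : (Module.finrank ℝ V : ℝ) - 2 ≠ 0) {y : quatForms A B C}
    (hy : h.leeEnd y = 0) : traceMap (y : TriForm V) = 0 := by
  have : quatLeePart A B C y = 0 := congrArg Subtype.val hy
  have := congrArg traceMap this
  rwa [quatLeePart_apply, map_smul, h.traceMap_quatTensor, smul_smul, inv_mul_cancel₀ hD, one_smul,
    map_zero] at this

theorem leeEnd_eq_zero {y : quatForms A B C} (hy : traceMap (y : TriForm V) = 0) :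
    h.leeEnd y = 0 :=
  Subtype.ext (by change quatLeePart A B C y = 0; rw [quatLeePart_apply, hy, map_zero, smul_zero])

end IsQuaternionicTriple

theorem exists_inner_self_eq_one_of_card_lt_finrank (s : Finset V)
    (hs : s.card < Module.finrank ℝ V) :
    ∃ v : V, inner ℝ v v = (1 : ℝ) ∧ ∀ u ∈ s, inner ℝ u v = (0 : ℝ) := by
  have h₁ := finrank_span_finset_le_card (R := ℝ) s
  have h₂ : (Submodule.span ℝ (s : Set V))ᗮ ≠ ⊥ := fun h => by
    rw [Submodule.orthogonal_eq_bot_iff] at h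
    have : Module.finrank ℝ (Submodule.span ℝ (s : Set V)) = Module.finrank ℝ V := by
      rw [h, finrank_top]
    rw [Set.finrank] at h₁
    omega
  obtain ⟨v, hv, hv₀⟩ := (Submodule.ne_bot_iff _).1 h₂
  refine ⟨(‖v‖)⁻¹ • v, ?_, fun u hu => ?_⟩
  · rw [real_inner_self_eq_norm_sq, norm_smul, norm_inv, norm_norm,
      inv_mul_cancel₀ (norm_ne_zero_iff.2 hv₀), one_pow]
  · rw [inner_smul_right, hv u (Submodule.subset_span hu), mul_zero]

omit [FiniteDimensional ℝ V] in
/-- `y` is orthogonal to the quaternionic line of `x`. -/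
def IsQuatOrthogonal (A B C : V →L[ℝ] V) (x y : V) : Prop :=
  inner ℝ x y = (0 : ℝ) ∧ inner ℝ x (A y) = (0 : ℝ) ∧ inner ℝ x (B y) = (0 : ℝ) ∧
    inner ℝ x (C y) = (0 : ℝ)

namespace IsQuaternionicTriple

variable {A B C : V →L[ℝ] V} (h : IsQuaternionicTriple A B C)
include h

omit [FiniteDimensional ℝ V] in
theorem isQuatOrthogonal_symm {x y : V} (hxy : IsQuatOrthogonal A B C x y) :
    IsQuatOrthogonal A B C y x := by
  obtain ⟨h₀, h₁, h₂, h₃⟩ := hxy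
  refine ⟨by rw [real_inner_comm, h₀], ?_, ?_, ?_⟩
  · rw [real_inner_comm, h.cplxA.skew, h₁, neg_zero]
  · rw [real_inner_comm, h.cplxB.skew, h₂, neg_zero]
  · rw [real_inner_comm, h.cplxC.skew, h₃, neg_zero]

/-- Each vector of `s` imposes at most four linear conditions, one for each of 1, A, B, C. -/
theorem exists_isQuatOrthogonal (s : Finset V) (hs : 4 * s.card < Module.finrank ℝ V) :
    ∃ v : V, inner ℝ v v = (1 : ℝ) ∧ ∀ u ∈ s, IsQuatOrthogonal A B C u v := by
  classical
  obtain ⟨v, hv, hv'⟩ := exists_inner_self_eq_one_of_card_lt_finrank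
    ((s ∪ s.image A) ∪ (s.image B ∪ s.image C)) (by
      have h₁ := Finset.card_union_le (s ∪ s.image A) (s.image B ∪ s.image C)
      have h₂ := Finset.card_union_le s (s.image A)
      have h₃ := Finset.card_union_le (s.image B) (s.image C)
      have h₄ := Finset.card_image_le (s := s) (f := A)
      have h₅ := Finset.card_image_le (s := s) (f := B)
      have h₆ := Finset.card_image_le (s := s) (f := C)
      omega)
  have hJ : ∀ J : V →L[ℝ] V, IsOrthogonalComplex J → ∀ u, inner ℝ (J u) v = (0 : ℝ) →
      inner ℝ u (J v) = (0 : ℝ) := fun J hJ u e => by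
    rw [← neg_eq_zero, ← hJ.skew, e]
  refine ⟨v, hv, fun u hu => ⟨hv' u (by simp [hu]), hJ A h.cplxA u (hv' _ ?_),
    hJ B h.cplxB u (hv' _ ?_), hJ C h.cplxC u (hv' _ ?_)⟩⟩ <;>
  · simp only [Finset.mem_union, Finset.mem_image]
    grind

theorem exists_leeEnd_eq_self (hD : 8 ≤ Module.finrank ℝ V) :
    ∃ g, h.leeEnd g = g ∧ g ≠ 0 := by
  have hD₂ : (Module.finrank ℝ V : ℝ) - 2 ≠ 0 := by
    have : (8 : ℝ) ≤ Module.finrank ℝ V := by exact_mod_cast hD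
    linarith
  obtain ⟨e, he, -⟩ := exists_inner_self_eq_one_of_card_lt_finrank (∅ : Finset V) (by simp; omega)
  refine ⟨⟨quatTensor A B C (innerₗ V e), h.quatTensor_mem _⟩,
    Subtype.ext (h.quatLeePart_quatTensor hD₂ _), fun h₀ => ?_⟩
  have := congrArg (fun y : quatForms A B C => traceMap (y : TriForm V) e) h₀
  simp [h.traceMap_quatTensor, hD₂] at this
  simp [this] at he

/-- Start from a form for which both traces vanish; then its image under 1 - P lies in ker P and in
ker R. Two orthogonal quaternionic lines are enough for this. -/
theorem exists_skewEnd_eq_zero (hD : 8 ≤ Module.finrank ℝ V) :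
    ∃ k, h.skewEnd k = 0 ∧ h.leeEnd k = 0 ∧ k ≠ 0 := by
  obtain ⟨e, he, -⟩ := exists_inner_self_eq_one_of_card_lt_finrank (∅ : Finset V) (by simp; omega)
  obtain ⟨f, hf, hef⟩ := h.exists_isQuatOrthogonal {e} (by simp; omega)
  obtain ⟨x₀, x₁, x₂, x₃⟩ := hef e (by simp)
  obtain ⟨y₀, y₁, y₂, y₃⟩ := h.isQuatOrthogonal_symm (hef e (by simp))
  -- Each summand alone has a nonzero trace, along `B f`; the second is chosen to cancel the trace
  -- of the first.
  set y : TriForm V := productForm A B C e (B e) f + productForm A B C (A e) (C e) f with hy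
  have hym : y ∈ quatForms A B C :=
    Submodule.add_mem _ (h.productForm_mem _ _ _) (h.productForm_mem _ _ _)
  have ht : traceMap y = 0 := by
    ext Z
    simp only [hy, map_add, LinearMap.add_apply, h.traceMap_productForm]
    norm_num [-real_inner_self_eq_norm_sq, -inner_self_eq_norm_sq_to_K, h.cplxA.skew, h.cplxB.skew, h.cplxC.skew, h.cplxA.sq, h.cplxB.sq, h.cplxC.sq, h.AB, h.BC,
      h.CA, h.BA, h.CB, h.AC, he, hf, h.cplxA.inner_self_apply, h.cplxB.inner_self_apply,
      h.cplxC.inner_self_apply, x₀, x₁, x₂, x₃, y₀, y₁, y₂, y₃]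
  have hs : traceMap (skewProj A B C y) = 0 := by
    ext Z
    rw [h.traceMap_skewProj hym, ht, hy]
    simp only [LinearMap.add_apply, Finset.sum_add_distrib, h.sum_productForm]
    simp [h.cplxA.skew, h.cplxB.skew, h.cplxC.skew, x₀, x₁, x₂, x₃]
  refine ⟨⟨y, hym⟩ - h.skewEnd ⟨y, hym⟩, ?_, ?_, fun h₀ => ?_⟩
  · rw [map_sub, (h.isProjectionPair hD).idem_P, sub_self]
  · refine h.leeEnd_eq_zero ?_
    change traceMap (y - skewProj A B C y) = 0
    rw [map_sub, ht, hs, sub_zero]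
  · have := congrArg (fun z : quatForms A B C => (z : TriForm V) e (B e) f) h₀
    change y e (B e) f - skewProj A B C y e (B e) f = 0 at this
    simp only [skewProj_apply, hy, LinearMap.add_apply, productForm_apply] at this
    norm_num [-real_inner_self_eq_norm_sq, -inner_self_eq_norm_sq_to_K, h.cplxA.skew, h.cplxB.skew, h.cplxC.skew, h.cplxA.sq, h.cplxB.sq, h.cplxC.sq, h.AB, h.BC,
      h.CA, h.BA, h.CB, h.AC, he, hf, h.cplxA.inner_self_apply, h.cplxB.inner_self_apply,
      h.cplxC.inner_self_apply, x₀, x₁, x₂, x₃, y₀, y₁, y₂, y₃] at this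

/-- Three mutually orthogonal quaternionic lines make all contractions of the product form vanish,
and its skew projection does not vanish at (e, f, g). This is where dimension 12 enters. -/
theorem exists_skewEnd_eq_self (hD : 12 ≤ Module.finrank ℝ V) :
    ∃ k, h.skewEnd k = k ∧ h.leeEnd k = 0 ∧ k ≠ 0 := by
  classical
  obtain ⟨e, he, -⟩ := exists_inner_self_eq_one_of_card_lt_finrank (∅ : Finset V) (by simp; omega)
  obtain ⟨f, hf, hef⟩ := h.exists_isQuatOrthogonal {e} (by simp; omega)
  obtain ⟨g, hg, hefg⟩ := h.exists_isQuatOrthogonal {e, f} (by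
    have := Finset.card_le_two (a := e) (b := f)
    omega)
  obtain ⟨x₀, x₁, x₂, x₃⟩ := hef e (by simp)
  obtain ⟨y₀, y₁, y₂, y₃⟩ := h.isQuatOrthogonal_symm (hef e (by simp))
  obtain ⟨z₀, z₁, z₂, z₃⟩ := hefg e (by simp)
  obtain ⟨w₀, w₁, w₂, w₃⟩ := h.isQuatOrthogonal_symm (hefg e (by simp))
  obtain ⟨u₀, u₁, u₂, u₃⟩ := hefg f (by simp)
  obtain ⟨v₀, v₁, v₂, v₃⟩ := h.isQuatOrthogonal_symm (hefg f (by simp))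
  set y : TriForm V := productForm A B C e f g with hy
  have hym : y ∈ quatForms A B C := h.productForm_mem _ _ _
  have hs : traceMap (skewProj A B C y) = 0 := by
    ext Z
    rw [h.traceMap_skewProj hym, hy, h.sum_productForm, h.traceMap_productForm]
    simp [h.cplxA.skew, h.cplxB.skew, h.cplxC.skew, x₀, x₁, x₂, x₃, y₀, y₁, y₂, y₃, z₀, z₁, z₂, z₃,
      u₀]
  refine ⟨h.skewEnd ⟨y, hym⟩, (h.isProjectionPair (by omega)).idem_P _, h.leeEnd_eq_zero hs,
    fun h₀ => ?_⟩
  have := congrArg (fun z : quatForms A B C => (z : TriForm V) e f g) h₀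
  change skewProj A B C y e f g = 0 at this
  simp only [skewProj_apply, hy, productForm_apply] at this
  simp [h.cplxA.skew, h.cplxB.skew, h.cplxC.skew, h.cplxA.sq, h.cplxB.sq, h.cplxC.sq, h.AB, h.BC,
    h.CA, h.BA, h.CB, h.AC, he, hf, hg, h.cplxA.inner_self_apply, h.cplxB.inner_self_apply,
    h.cplxC.inner_self_apply, x₀, x₁, x₂, x₃, y₀, y₁, y₂, y₃, z₀, z₁, z₂, z₃, w₀, w₁, w₂, w₃, u₀,
    u₁, u₂, u₃, v₀, v₁, v₂, v₃] at this
  rcases this with rfl | rfl | rfl <;> simp at he hf hg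

end IsQuaternionicTriple

end Correspondence

/-! ### Absence of the L part in dimension 8 -/

section DimensionEight

set_option maxSynthPendingDepth 5

variable {V : Type*} [NormedAddCommGroup V] [InnerProductSpace ℝ V] [FiniteDimensional ℝ V]

namespace IsQuaternionicTriple

variable {A B C : V →L[ℝ] V} (h : IsQuaternionicTriple A B C)
include h

/-- The orthonormal basis of an eight-dimensional space given by two orthogonal quaternionic
lines. -/
theorem exists_orthonormalBasis (hD : Module.finrank ℝ V = 8) {e f : V}
    (he : inner ℝ e e = (1 : ℝ)) (hf : inner ℝ f f = (1 : ℝ)) (hef : IsQuatOrthogonal A B C e f) :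
    ∃ b : OrthonormalBasis (Fin 2 × Fin 4) ℝ V,
      ∀ p, b p = ![![e, A e, B e, C e], ![f, A f, B f, C f]] p.1 p.2 := by
  obtain ⟨y₀, y₁, y₂, y₃⟩ := h.isQuatOrthogonal_symm hef
  obtain ⟨x₀, x₁, x₂, x₃⟩ := hef
  have hon : Orthonormal ℝ fun p : Fin 2 × Fin 4 =>
      ![![e, A e, B e, C e], ![f, A f, B f, C f]] p.1 p.2 := by
    rw [orthonormal_iff_ite]
    rintro ⟨i, p⟩ ⟨j, q⟩
    fin_cases i <;> fin_cases j <;> fin_cases p <;> fin_cases q <;>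
    simp [-real_inner_self_eq_norm_sq, -inner_self_eq_norm_sq_to_K, h.cplxA.skew, h.cplxB.skew, h.cplxC.skew, h.cplxA.sq,
      h.cplxB.sq, h.cplxC.sq, h.AB, h.BC, h.CA, h.BA, h.CB, h.AC, he, hf,
      h.cplxA.inner_self_apply, h.cplxB.inner_self_apply, h.cplxC.inner_self_apply, x₀, x₁, x₂,
      x₃, y₀, y₁, y₂, y₃]
  exact ⟨OrthonormalBasis.mk hon (hon.linearIndependent.span_eq_top_of_card_eq_finrank'
    (by simp [hD])).ge, fun p => by simp⟩

/-- Such a form is the real part of a (3,0)-form on ℂ⁴ that is traceless for the complex symplectic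
form; there are none besides zero. The contraction φ(x, Bx, ·) vanishes on the quaternionic line of
x. With two orthogonal lines spanning V, the trace condition identifies it up to sign with the
contraction along the other line, so it vanishes everywhere. -/
theorem eq_zero_of_totallySkew (hD : Module.finrank ℝ V = 8) {φ : TriForm V}
    (hs : ∀ X Y Z, φ X Y Z = -φ X Z Y) (hc : ∀ X Y Z, φ X Y Z = φ Y Z X)
    (hA : ∀ X Y Z, φ X (A Y) (A Z) = -φ X Y Z)
    (ht : ∀ Z, ∑ i, φ (stdOrthonormalBasis ℝ V i) (B (stdOrthonormalBasis ℝ V i)) Z = 0) :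
    φ = 0 := by
  have hs' : ∀ X Y Z, φ X Y Z = -φ Y X Z := fun X Y Z => by rw [hc, hs]
  have h₂₃ : ∀ X Y Z, φ X (A Y) Z = φ X Y (A Z) := fun X Y Z => by
    have := hA X Y (A Z)
    rw [h.cplxA.sq, map_neg] at this
    linarith
  have h₁₂ : ∀ X Y Z, φ (A X) Y Z = φ X (A Y) Z := fun X Y Z => by
    rw [hc, ← h₂₃, ← hc, ← h₂₃]
  have h₀ : ∀ X Z, φ X X Z = 0 := fun X Z => by linarith [hs' X X Z]
  have h₁ : ∀ X Y, φ X Y X = 0 := fun X Y => by rw [← hc, h₀]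
  have h₂ : ∀ X Y, φ Y X X = 0 := fun X Y => by rw [hc, h₀]
  have hAx : ∀ x Z, φ (A x) (B (A x)) Z = φ x (B x) Z := fun x Z => by
    rw [h.BA, h₁₂, map_neg, h.AC, neg_neg]
  have hBx : ∀ x Z, φ (B x) (B (B x)) Z = φ x (B x) Z := fun x Z => by
    rw [h.cplxB.sq, hs']
    simp
  have hCx : ∀ x Z, φ (C x) (B (C x)) Z = φ x (B x) Z := fun x Z => by
    rw [← h.AB, hAx, hBx]
  have hx : ∀ x, φ x (B x) (A x) = 0 ∧ φ x (B x) (C x) = 0 := fun x => by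
    refine ⟨by rw [← h₂₃, h₁], ?_⟩
    rw [← h.AB, ← h₂₃, ← h₁₂, h₂]
  have key : ∀ e : V, inner ℝ e e = (1 : ℝ) → φ e (B e) = 0 := fun e he => by
    obtain ⟨f, hf, hef⟩ := h.exists_isQuatOrthogonal {e} (by simp; omega)
    obtain ⟨b, hb⟩ := h.exists_orthonormalBasis hD he hf (hef e (by simp))
    have hef' : ∀ Z, φ e (B e) Z = -φ f (B f) Z := fun Z => by
      have := sum_eq_sum_of_orthonormalBasis (stdOrthonormalBasis ℝ V) b (LinearMap.mk₂ ℝ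
        (fun X Y => φ X (B Y) Z) (by simp) (by simp) (by simp) (by simp))
      simp only [LinearMap.mk₂_apply, ht] at this
      simp [Fintype.sum_prod_type, Fin.sum_univ_four, hb, hAx, hBx, hCx] at this
      linarith
    refine b.toBasis.ext fun ⟨i, p⟩ => ?_
    fin_cases i
    · fin_cases p <;> simp [hb, h₁, h₂, hx]
    · rw [hef']
      fin_cases p <;> simp [hb, h₁, h₂, hx]
  have hB : ∀ X Z, φ X (B X) Z = 0 := fun X Z => by
    by_cases hX : X = 0
    · simp [hX]
    have := key (‖X‖⁻¹ • X) (by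
      rw [real_inner_self_eq_norm_sq, norm_smul, norm_inv, norm_norm,
        inv_mul_cancel₀ (norm_ne_zero_iff.2 hX), one_pow])
    simpa [hX] using congrArg (fun β : V →ₗ[ℝ] ℝ => β Z) this
  have hB₁₂ : ∀ X Y Z, φ (B X) Y Z = φ X (B Y) Z := fun X Y Z => by
    have := hB (X + Y) Z
    simp only [map_add, LinearMap.add_apply, hB] at this
    rw [hs' (B X)]
    linarith
  have hB₁₃ : ∀ X Y Z, φ (B X) Y Z = φ X Y (B Z) := fun X Y Z => by
    rw [hs, hB₁₂, ← hs]
  -- Both `A` and `B` may be moved between arguments. Moving them to different arguments makes them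
  -- commute, whereas AB = -BA = C.
  have hC : ∀ X Y Z, φ (C X) Y Z = 0 := fun X Y Z => by
    have : φ (A (B X)) Y Z = φ (B (A X)) Y Z := by rw [h₁₂, hB₁₃, ← h₁₂, ← hB₁₃]
    rw [h.AB, h.BA, map_neg, LinearMap.neg_apply, LinearMap.neg_apply] at this
    linarith
  refine TriForm.ext fun X Y Z => ?_
  have := hC (C X) Y Z
  rw [h.cplxC.sq] at this
  simpa using this

/-- When y is fixed by P, the tensor built from (y, -y) is invariant under cyclic permutation, hence
totally skew, and its contraction with `B` is expressed by the trace of y. -/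
theorem eq_zero_of_skewProj_eq_self (hD : Module.finrank ℝ V = 8) {y : TriForm V}
    (hy : y ∈ quatForms A B C) (hP : skewProj A B C y = y) (ht : traceMap y = 0) : y = 0 := by
  have hy' : -y ∈ quatForms A B C := Submodule.neg_mem _ hy
  obtain ⟨hs, hA⟩ := h.pairTensor_mem hy hy'
  have hc : ∀ X Y Z, pairTensor B C y (-y) X Y Z = pairTensor B C y (-y) Y Z X := fun X Y Z => by
    have e := h.cyclicSum_pairTensor hy
    rw [hP] at e
    have e₁ := congrArg (fun φ : TriForm V => φ X Y Z) e
    have e₂ := congrArg (fun φ : TriForm V => φ Y Z X) e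
    simp only [LinearMap.smul_apply, cyclicSum_apply, smul_eq_mul] at e₁ e₂
    linarith
  refine h.eq_zero_of_pairTensor_neg hy (h.eq_zero_of_totallySkew hD hs hc hA fun Z => ?_)
  have hβ : ∀ J : V →L[ℝ] V, IsOrthogonalComplex J →
      ∑ i, y (J (stdOrthonormalBasis ℝ V i)) (J (stdOrthonormalBasis ℝ V i)) (C Z) = 0 :=
    fun J hJ => by
      have := hJ.sum_apply_apply
        (LinearMap.mk₂ ℝ (fun X Y => y X Y (C Z)) (by simp) (by simp) (by simp) (by simp))
      simp only [LinearMap.mk₂_apply] at this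
      rw [this, ← traceMap_eq_sum, ht, LinearMap.zero_apply]
  have e : ∀ v, pairTensor B C y (-y) v (B v) Z = -y (B v) (B v) (C Z) - y (C v) (C v) (C Z) := by
    intro v
    simp [hy.2.2.2, h.CB, h.cplxB.sq, h.cplxC.sq]
  simp only [e, Finset.sum_sub_distrib, Finset.sum_neg_distrib, hβ B h.cplxB, hβ C h.cplxC,
    neg_zero, sub_zero]

theorem partL_eq_zero (hD : Module.finrank ℝ V = 8) (z : quatForms A B C) :
    partL h.skewEnd h.leeEnd
      (2 * ((Module.finrank ℝ V : ℝ) - 4) / (3 * ((Module.finrank ℝ V : ℝ) - 2))) z = 0 := by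
  have hp := h.isProjectionPair hD.ge
  have hD₂ : (Module.finrank ℝ V : ℝ) - 2 ≠ 0 := by rw [hD]; norm_num
  generalize 2 * ((Module.finrank ℝ V : ℝ) - 4) / (3 * ((Module.finrank ℝ V : ℝ) - 2)) = l
    at hp ⊢
  set y := partL h.skewEnd h.leeEnd l z with hy
  have hP : h.skewEnd y = y := by simp [hy, partL, hp.idem_P]
  have hR : h.leeEnd y = 0 := by
    simp [hy, partL, hp.compress, smul_smul, inv_mul_cancel₀ hp.ne_zero]
  exact Subtype.ext (h.eq_zero_of_skewProj_eq_self hD y.2 (congrArg Subtype.val hP)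
    (h.traceMap_eq_zero_of_leeEnd hD₂ hR))

end IsQuaternionicTriple

end DimensionEight

/-! ### Reduction of triples for an abstract pair of projections -/

section Reduction

variable {M : Type*} [AddCommGroup M] [Module ℝ M]

/-- The components of `y` outside the triple of types `t` vanish. -/
def VanishesOutside (P R : M →ₗ[ℝ] M) (y : Fin 3 → M) (t : TypeTriple) : Prop :=
  ∀ A, ∀ i ∉ t A, components P R i (combine i A y) = 0

/-- A pair of projections whose relations are exactly those recorded by `reduceMask b`. -/
structure IsReductionPair (P R : M →ₗ[ℝ] M) (l : ℝ) (b : Bool) : Prop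
    extends IsProjectionPair P R l where
  partL_eq_zero : b = false → ∀ z, partL P R l z = 0
  exists_R : ∃ g, R g = g ∧ g ≠ 0
  exists_ker : ∃ k, P k = 0 ∧ R k = 0 ∧ k ≠ 0
  exists_P : b = true → ∃ k, P k = k ∧ R k = 0 ∧ k ≠ 0

/-- The reduction of triples of types which is computed by `reduceMask`. -/
def MaskReduces (b : Bool) (t t' : TypeTriple) : Prop :=
  ∃ m < 4096, sortedMask m = true ∧ ∃ σ : Equiv.Perm (Fin 3), t = typeOfMask m ∘ σ ∧
    t' = typeOfMask (reduceMask b m) ∘ σ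

theorem exists_maskReduces (b : Bool) (t : TypeTriple) : ∃ t', MaskReduces b t t' := by
  obtain ⟨m, hm, σ, hs, e⟩ := exists_sortedMask t
  exact ⟨_, m, hm, hs, σ.symm, by simp [e, Function.comp_assoc], rfl⟩

theorem MaskReduces.comp {b : Bool} {t t' : TypeTriple} (h : MaskReduces b t t')
    (σ : Equiv.Perm (Fin 3)) : MaskReduces b (t ∘ σ) (t' ∘ σ) := by
  obtain ⟨m, hm, hs, τ, rfl, rfl⟩ := h
  exact ⟨m, hm, hs, τ * σ, rfl, rfl⟩

theorem checkMask_of_sortedMask (b : Bool) {m : ℕ} (hm : m < 4096) (hs : sortedMask m = true) :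
    checkMask b m = true := by
  have := allBelow_iff.1 (reduceMask_counts b).1 m hm
  simpa [hs] using this

theorem VanishesOutside.comp {P R : M →ₗ[ℝ] M} {y : Fin 3 → M} {t : TypeTriple}
    (h : VanishesOutside P R y t) (σ : Equiv.Perm (Fin 3)) :
    VanishesOutside P R (y ∘ σ) (t ∘ σ) := fun A i hi => by
  obtain ⟨ε, -, e⟩ := combine_comp i A y σ
  rw [e, map_smul, h _ _ hi, smul_zero]

theorem vanishesOutside_comp_iff {P R : M →ₗ[ℝ] M} {y : Fin 3 → M} {t : TypeTriple}
    (σ : Equiv.Perm (Fin 3)) :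
    VanishesOutside P R (y ∘ σ) (t ∘ σ) ↔ VanishesOutside P R y t := by
  refine ⟨fun h => ?_, fun h => h.comp σ⟩
  have := h.comp σ.symm
  simpa [Function.comp_assoc] using this

/-- Circuits give that the computed triple is an upper bound, support vectors that nothing smaller
is. Both are transported from the sorted representative by permuting the three structures. -/
theorem IsReductionPair.isLeast {P R : M →ₗ[ℝ] M} {l : ℝ} {b : Bool}
    (h : IsReductionPair P R l b) {t t' : TypeTriple} (ht : MaskReduces b t t') :
    IsLeast {s | ∀ y, VanishesOutside P R y t → VanishesOutside P R y s} t' := by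
  obtain ⟨m, hm, hs, σ, rfl, rfl⟩ := ht
  constructor
  · intro y hy
    have := h.components_eq_zero_of_reduceMask h.partL_eq_zero (checkMask_of_sortedMask b hm hs)
      (y := y ∘ ⇑σ.symm) ((vanishesOutside_comp_iff σ).1
        (by simpa [Function.comp_assoc] using hy))
    refine (vanishesOutside_comp_iff σ.symm).1 ?_
    simpa [Function.comp_assoc, VanishesOutside] using this
  · intro s hs A i hi
    by_contra hi'
    obtain ⟨y, hy, hy'⟩ := h.exists_components_ne_zero h.exists_R h.exists_ker h.exists_P hi
    obtain ⟨ε, hε, e⟩ := combine_comp i A y σ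
    have := hs (y ∘ σ) ((vanishesOutside_comp_iff σ).2 hy) A i hi'
    rw [e, map_smul, smul_eq_zero] at this
    exact this.elim hε hy'

end Reduction

/-! ### From triples of forms back to solutions of the relations -/

section Relations

set_option maxSynthPendingDepth 5

variable {V : Type*} [NormedAddCommGroup V] [InnerProductSpace ℝ V]

theorem quatForms_eq (Q : Fin 3 → V →L[ℝ] V) (i : Fin 3) :
    quatForms (Q i) (Q (i + 1)) (Q (i + 2)) = quatForms (Q 0) (Q 1) (Q 2) := by
  fin_cases i
  exacts [rfl, quatForms_rotate _ _ _, (quatForms_rotate _ _ _).trans (quatForms_rotate _ _ _)]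

/-- The solution of the relations given by three elements of `quatForms`. -/
noncomputable def relationTensors (Q : Fin 3 → V →L[ℝ] V)
    (y : Fin 3 → quatForms (Q 0) (Q 1) (Q 2)) (i : Fin 3) : TriForm V :=
  pairTensor (Q (i + 1)) (Q (i + 2)) (y (i + 1)) (y (i + 2))

variable {Q : Fin 3 → V →L[ℝ] V} (hQ : IsHyperHermitian Q)
include hQ

theorem satisfiesRelations_relationTensors (y : Fin 3 → quatForms (Q 0) (Q 1) (Q 2)) :
    SatisfiesRelations Q (relationTensors Q y) := by
  have hy : ∀ i j, (y j : TriForm V) ∈ quatForms (Q i) (Q (i + 1)) (Q (i + 2)) := fun i j => by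
    rw [quatForms_eq]
    exact (y j).2
  refine ⟨fun i => (hQ.isQuaternionicTriple i).pairTensor_mem (hy i _) (hy i _),
    fun i X Y Z => ?_⟩
  have := (hQ.isQuaternionicTriple i).pairTensor_relation (hy i i) (hy i (i + 1)) (hy i (i + 2))
    X Y Z
  fin_cases i <;> exact this

/-- Each form is recovered from the tensor two places further on, and each tensor is rebuilt from
two of the forms by its own relation. -/
theorem SatisfiesRelations.exists_relationTensors {ψ : Fin 3 → TriForm V}
    (hψ : SatisfiesRelations Q ψ) : ∃ y, relationTensors Q y = ψ := by
  have hy : ∀ i, recoverForm (Q i) (Q (i + 1)) (ψ (i + 2)) ∈ quatForms (Q 0) (Q 1) (Q 2) :=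
    fun i => by
      rw [← quatForms_eq Q i]
      exact (hQ.isQuaternionicTriple i).recoverForm_mem (hψ.hermitian _)
  refine ⟨fun i => ⟨_, hy i⟩, funext fun i => ?_⟩
  have := (hQ.isQuaternionicTriple i).pairTensor_recoverForm (hψ.hermitian i)
    (hψ.hermitian (i + 1)) (hψ.hermitian (i + 2)) (hψ.cyclic i)
  fin_cases i <;> exact this

variable [FiniteDimensional ℝ V]

omit hQ in
theorem formComponents_eq (Q : Fin 3 → V →L[ℝ] V) (i : Fin 3) :
    formComponents (Q i) (Q (i + 1)) (Q (i + 2)) = formComponents (Q 0) (Q 1) (Q 2) := by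
  fin_cases i
  exacts [rfl, formComponents_rotate _ _ _,
    (formComponents_rotate _ _ _).trans (formComponents_rotate _ _ _)]

theorem hasTypeLE_relationTensors_iff (hD : 8 ≤ Module.finrank ℝ V)
    (y : Fin 3 → quatForms (Q 0) (Q 1) (Q 2)) (t : TypeTriple) :
    HasTypeLE Q (relationTensors Q y) t ↔ VanishesOutside hQ.isQuaternionicTriple_zero.skewEnd
      hQ.isQuaternionicTriple_zero.leeEnd y t := by
  have hD₂ : (Module.finrank ℝ V : ℝ) - 2 ≠ 0 := by
    have : (8 : ℝ) ≤ Module.finrank ℝ V := by exact_mod_cast hD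
    linarith
  have hy : ∀ i j, (y j : TriForm V) ∈ quatForms (Q i) (Q (i + 1)) (Q (i + 2)) := fun i j => by
    rw [quatForms_eq]
    exact (y j).2
  refine forall_congr' fun A => ?_
  have hA := hQ.isQuaternionicTriple A
  rw [hA.cplxA.mem_ghClass_iff hD₂ ((satisfiesRelations_relationTensors hQ y).hermitian A)]
  refine forall₂_congr fun i _ => ?_
  rw [relationTensors, hA.ghPart_pairTensor_eq_zero_iff (hy A _) (hy A _), formComponents_eq,
    ← Submodule.coe_eq_zero, hQ.isQuaternionicTriple_zero.coe_components]
  rfl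

theorem isReductionPair (hD : Module.finrank ℝ V = 8 ∨ 12 ≤ Module.finrank ℝ V) :
    IsReductionPair hQ.isQuaternionicTriple_zero.skewEnd hQ.isQuaternionicTriple_zero.leeEnd
      (2 * ((Module.finrank ℝ V : ℝ) - 4) / (3 * ((Module.finrank ℝ V : ℝ) - 2)))
      (decide (12 ≤ Module.finrank ℝ V)) where
  toIsProjectionPair := hQ.isQuaternionicTriple_zero.isProjectionPair (by omega)
  partL_eq_zero hb := hQ.isQuaternionicTriple_zero.partL_eq_zero (by
    rw [decide_eq_false_iff_not] at hb; omega)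
  exists_R := hQ.isQuaternionicTriple_zero.exists_leeEnd_eq_self (by omega)
  exists_ker := hQ.isQuaternionicTriple_zero.exists_skewEnd_eq_zero (by omega)
  exists_P hb := hQ.isQuaternionicTriple_zero.exists_skewEnd_eq_self (by simpa using hb)

theorem MaskReduces.reducesTo (hD : Module.finrank ℝ V = 8 ∨ 12 ≤ Module.finrank ℝ V)
    {t t' : TypeTriple} (ht : MaskReduces (decide (12 ≤ Module.finrank ℝ V)) t t') :
    ReducesTo Q t t' := by
  have hD' : 8 ≤ Module.finrank ℝ V := by omega
  have := (isReductionPair hQ hD).isLeast ht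
  refine ⟨fun ψ hψ h => ?_, fun s hs => this.2 fun y hy => ?_⟩
  · obtain ⟨y, rfl⟩ := hψ.exists_relationTensors hQ
    rw [hasTypeLE_relationTensors_iff hQ hD'] at h ⊢
    exact this.1 y h
  · rw [← hasTypeLE_relationTensors_iff hQ hD'] at hy ⊢
    exact hs _ (satisfiesRelations_relationTensors hQ y) hy

-- Without 𝒲₁ and 𝒲₂ components, the difference of the two forms is killed by both P and 1 - P.
omit hQ in
theorem VanishesOutside.eq_of_lee {M : Type*} [AddCommGroup M] [Module ℝ M] {P R : M →ₗ[ℝ] M}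
    {y : Fin 3 → M} (h : VanishesOutside P R y fun _ => {3}) (A : Fin 3) :
    y (A + 1) = y (A + 2) := by
  have h₀ := h A 0 (by simp)
  have h₁ := h A 1 (by simp)
  simp only [components, combine, combineSign, Matrix.cons_val_zero, Matrix.cons_val_one,
    LinearMap.sub_apply, LinearMap.id_apply, neg_smul, one_smul, ← sub_eq_add_neg] at h₀ h₁
  rwa [h₀, sub_zero, sub_eq_zero] at h₁

/-- A common Lee form comes for free: when all three tensors lie in 𝒲₄ the three forms coincide, and
each Lee form is the same multiple of the trace of that one form. The structure in the definition of
the Lee form undoes the one produced by `traceMap_pairTensor`. -/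
theorem isLCHyperKahlerTensor_iff (hD : 8 ≤ Module.finrank ℝ V) {ψ : Fin 3 → TriForm V}
    (hψ : SatisfiesRelations Q ψ) :
    IsLCHyperKahlerTensor Q ψ ↔ HasTypeLE Q ψ fun _ => {3} := by
  have hg : ∀ A : V →L[ℝ] V, ghClass A {3} = grayHervella₄ A := fun A => by
    simp [ghClass, grayHervella]
  refine ⟨fun h A => by rw [hg]; exact h.1 A, fun h => ⟨fun A => by rw [← hg]; exact h A, ?_⟩⟩
  obtain ⟨y, rfl⟩ := hψ.exists_relationTensors hQ
  rw [hasTypeLE_relationTensors_iff hQ hD] at h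
  have h₁ : ∀ i, y i = y 0 := fun i => by
    fin_cases i
    exacts [rfl, (h.eq_of_lee 2).symm, h.eq_of_lee 1]
  have key : ∀ i X, leeForm (Q i) (relationTensors Q y i) X =
      2 * traceMap (y 0 : TriForm V) X / ((Module.finrank ℝ V : ℝ) / 2 - 1) := fun i X => by
    have hi := hQ.isQuaternionicTriple i
    have hy : (y 0 : TriForm V) ∈ quatForms (Q i) (Q (i + 1)) (Q (i + 2)) := by
      rw [quatForms_eq]
      exact (y 0).2
    rw [leeForm, ← traceMap_apply, relationTensors, h₁ (i + 1), h₁ (i + 2),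
      hi.traceMap_pairTensor hy]
    simp [hi.cplxA.sq]
  exact fun i j => funext fun X => by rw [key, key]

omit hQ in
theorem hasTypeLE_bot_iff {ψ : Fin 3 → TriForm V} : HasTypeLE Q ψ ⊥ ↔ ∀ i, ψ i = 0 := by
  simp [HasTypeLE, ghClass]

omit hQ in
theorem HasTypeLE.mono {ψ : Fin 3 → TriForm V} {t t' : TypeTriple} (h : HasTypeLE Q ψ t)
    (ht : t ≤ t') : HasTypeLE Q ψ t' := fun A =>
  (biSup_mono fun _ hi => ht A hi : ghClass (Q A) (t A) ≤ ghClass (Q A) (t' A)) (h A)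

omit hQ in
theorem ReducesTo.self {t t' : TypeTriple} (h : ReducesTo Q t t') : ReducesTo Q t' t' :=
  ⟨fun _ _ h => h, fun _ hs => h.2 fun ψ hψ hψt => hs ψ hψ (h.1 ψ hψ hψt)⟩

omit hQ in
theorem ReducesTo.forall_eq_zero_iff {t t' : TypeTriple} (h : ReducesTo Q t t') :
    (∀ ψ, SatisfiesRelations Q ψ → HasTypeLE Q ψ t → ∀ i, ψ i = 0) ↔ t' = ⊥ := by
  simp only [← hasTypeLE_bot_iff (Q := Q)]
  exact ⟨fun h' => le_bot_iff.1 (h.2 h'), fun e => e ▸ h.1⟩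

theorem ReducesTo.forall_isLC_iff (hD : 8 ≤ Module.finrank ℝ V) {t t' : TypeTriple}
    (h : ReducesTo Q t t') :
    (∀ ψ, SatisfiesRelations Q ψ → HasTypeLE Q ψ t → IsLCHyperKahlerTensor Q ψ) ↔
      t' ≤ fun _ => {3} := by
  refine ⟨fun h' => h.2 fun ψ hψ hψt => (isLCHyperKahlerTensor_iff hQ hD hψ).1 (h' ψ hψ hψt),
    fun e ψ hψ hψt => (isLCHyperKahlerTensor_iff hQ hD hψ).2 ((h.1 ψ hψ hψt).mono e)⟩

/-- A nonzero solution with only 𝒲₄ components comes from one form y, used three times, with R y =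
y. If 𝒲₄ were missing for one structure, then R y = 0 and y = 0. So no reduced triple lies strictly
between zero and the full 𝒲₄ triple. -/
theorem ReducesTo.eq_lee (hD : 8 ≤ Module.finrank ℝ V) {t t' : TypeTriple}
    (h : ReducesTo Q t t') (hle : t' ≤ fun _ => {3}) (hne : t' ≠ ⊥) : t' = fun _ => {3} := by
  rw [Ne, ← h.self.forall_eq_zero_iff] at hne
  push Not at hne
  obtain ⟨ψ, hψ, hψt, i, hi⟩ := hne
  obtain ⟨y, rfl⟩ := hψ.exists_relationTensors hQ
  have hl := hψt.mono hle
  rw [hasTypeLE_relationTensors_iff hQ hD] at hl hψt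
  have hy : ∀ i, y i = y 0 := fun i => by
    fin_cases i
    exacts [rfl, (hl.eq_of_lee 2).symm, hl.eq_of_lee 1]
  have h₀ : y 0 ≠ 0 := fun e => hi (by
    rw [relationTensors, hy (i + 1), hy (i + 2), e]
    exact pairTensor_zero _ _)
  refine le_antisymm hle fun A j hj => ?_
  obtain rfl : j = 3 := by simpa using hj
  by_contra hA
  have h₃ := hψt A 3 hA
  have h₂ := hl A 2 (by simp)
  simp only [components, combine, combineSign, Matrix.cons_val, one_smul, hy (A + 1), hy (A + 2),
    LinearMap.sub_apply, LinearMap.id_apply] at h₂ h₃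
  rw [h₃, sub_zero, ← two_smul ℝ, smul_eq_zero] at h₂
  exact h₂.elim two_ne_zero h₀

end Relations

/-! ### Counting unordered triples -/

section Counting

variable {V : Type*} [NormedAddCommGroup V] [InnerProductSpace ℝ V] [FiniteDimensional ℝ V]

theorem typeOfMask_zero : typeOfMask 0 = ⊥ := by decide

theorem typeOfMask_lee : typeOfMask 0x888 = fun _ => {3} := by decide

theorem reduceMask_and_self (b : Bool) (m : ℕ) : reduceMask b m &&& m = reduceMask b m := by
  refine Nat.eq_of_testBit_eq fun k => ?_
  have hu : ∀ l, (unionWithin l m).testBit k = true → m.testBit k = true := fun l h => by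
    obtain ⟨s, -, hs, hk⟩ := exists_supp_of_testBit_unionWithin h
    rw [← hs, Nat.testBit_and, Bool.and_eq_true] at hk
    exact hk.2
  have : (reduceMask b m).testBit k = true → m.testBit k = true := by
    simp only [reduceMask, Nat.testBit_or, Bool.or_eq_true]
    rintro ((h | h) | h)
    · exact hu _ h
    · exact hu _ h
    · cases b
      · simp at h
      · exact hu _ h
  rw [Nat.testBit_and]
  cases h : (reduceMask b m).testBit k
  · simp
  · simp [this h]

theorem reduceMask_lt (b : Bool) {m : ℕ} (hm : m < 4096) : reduceMask b m < 4096 :=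
  ((reduceMask_and_self b m).symm.trans_le Nat.and_le_right).trans_lt hm

theorem MaskReduces.le {b : Bool} {t t' : TypeTriple} (h : MaskReduces b t t') : t' ≤ t := by
  obtain ⟨m, -, -, σ, rfl, rfl⟩ := h
  exact fun A => typeOfMask_mono (reduceMask_and_self b m) (σ A)

theorem exists_maskReduces_of_unordered_eq {b : Bool} {t s t' : TypeTriple}
    (h : MaskReduces b t t') (e : unordered t = unordered s) :
    ∃ σ : Equiv.Perm (Fin 3), s = t ∘ σ ∧ MaskReduces b s (t' ∘ σ) := by
  obtain ⟨σ, rfl⟩ := exists_comp_of_unordered_eq e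
  exact ⟨σ, rfl, h.comp σ⟩

variable {Q : Fin 3 → V →L[ℝ] V} (hQ : IsHyperHermitian Q)
  (hD : Module.finrank ℝ V = 8 ∨ 12 ≤ Module.finrank ℝ V) {t t' : TypeTriple}
  (h : MaskReduces (decide (12 ≤ Module.finrank ℝ V)) t t')
include hQ hD h

/-- Reduction is idempotent and commutes with permutations, so the triples that arise as reductions
are its fixed points. -/
theorem MaskReduces.unordered_mem_hyperHermitianTypes_iff :
    unordered t ∈ hyperHermitianTypes Q ↔ t' = t := by
  have hr := h.reducesTo hQ hD
  refine ⟨?_, fun e => ⟨t, t', hr, by rw [e]⟩⟩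
  rintro ⟨s, s', hs, e⟩
  obtain ⟨σ, rfl, h'⟩ := exists_maskReduces_of_unordered_eq h e
  have := (h'.reducesTo hQ hD).unique hs.self
  exact σ.surjective.injective_comp_right this

theorem MaskReduces.unordered_mem_forcesHyperKahler_iff :
    unordered t ∈ forcesHyperKahler Q ↔ t' = ⊥ := by
  refine ⟨fun hu => (h.reducesTo hQ hD).forall_eq_zero_iff.1 (hu t rfl), ?_⟩
  rintro rfl s hs
  obtain ⟨σ, rfl, h'⟩ := exists_maskReduces_of_unordered_eq h hs.symm
  exact (h'.reducesTo hQ hD).forall_eq_zero_iff.2 rfl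

theorem MaskReduces.unordered_mem_forcesLCHyperKahler_iff :
    unordered t ∈ forcesLCHyperKahler Q ↔ t' = fun _ => {3} := by
  have hD' : 8 ≤ Module.finrank ℝ V := by omega
  rw [forcesLCHyperKahler, Set.mem_sdiff, h.unordered_mem_forcesHyperKahler_iff hQ hD]
  refine ⟨fun hu => (h.reducesTo hQ hD).eq_lee hQ hD'
    (((h.reducesTo hQ hD).forall_isLC_iff hQ hD').1 (hu.1 t rfl)) hu.2, ?_⟩
  rintro rfl
  refine ⟨fun s hs => ?_, fun e => ?_⟩
  · obtain ⟨σ, rfl, h'⟩ := exists_maskReduces_of_unordered_eq h hs.symm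
    exact ((h'.reducesTo hQ hD).forall_isLC_iff hQ hD').2 le_rfl
  · simpa using congrFun e 0

omit h

theorem ncard_hyperHermitianTypes : (hyperHermitianTypes Q).ncard = countBelow
    (fun m => sortedMask m && (reduceMask (decide (12 ≤ Module.finrank ℝ V)) m).beq m) 4096 :=
  ncard_eq_countBelow fun m hm hs => by
    have h : MaskReduces (decide (12 ≤ Module.finrank ℝ V)) _ _ :=
      ⟨m, hm, hs, Equiv.refl _, rfl, rfl⟩
    rw [Equiv.coe_refl, Function.comp_id, Function.comp_id] at h
    rw [h.unordered_mem_hyperHermitianTypes_iff hQ hD, Nat.beq_eq]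
    exact ⟨typeOfMask_injOn (reduceMask_lt _ hm) hm, congrArg _⟩

theorem ncard_forcesHyperKahler : (forcesHyperKahler Q).ncard = countBelow
    (fun m => sortedMask m && (reduceMask (decide (12 ≤ Module.finrank ℝ V)) m).beq 0) 4096 :=
  ncard_eq_countBelow fun m hm hs => by
    have h : MaskReduces (decide (12 ≤ Module.finrank ℝ V)) _ _ :=
      ⟨m, hm, hs, Equiv.refl _, rfl, rfl⟩
    rw [Equiv.coe_refl, Function.comp_id, Function.comp_id] at h
    rw [h.unordered_mem_forcesHyperKahler_iff hQ hD, Nat.beq_eq, ← typeOfMask_zero]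
    exact ⟨typeOfMask_injOn (reduceMask_lt _ hm) (by norm_num), congrArg _⟩

theorem ncard_forcesLCHyperKahler : (forcesLCHyperKahler Q).ncard = countBelow
    (fun m => sortedMask m && (reduceMask (decide (12 ≤ Module.finrank ℝ V)) m).beq 0x888) 4096 :=
  ncard_eq_countBelow fun m hm hs => by
    have h : MaskReduces (decide (12 ≤ Module.finrank ℝ V)) _ _ :=
      ⟨m, hm, hs, Equiv.refl _, rfl, rfl⟩
    rw [Equiv.coe_refl, Function.comp_id, Function.comp_id] at h
    rw [h.unordered_mem_forcesLCHyperKahler_iff hQ hD, Nat.beq_eq, ← typeOfMask_lee]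
    exact ⟨typeOfMask_injOn (reduceMask_lt _ hm) (by norm_num), congrArg _⟩

end Counting

/-! ### Almost hyper-Hermitian manifolds -/

section HyperHermitianManifold

variable {E : Type*} [NormedAddCommGroup E] [NormedSpace ℝ E] [FiniteDimensional ℝ E]
  {M : Type*} [TopologicalSpace M] [ChartedSpace E M] [IsManifold 𝓘(ℝ, E) ∞ M]
  [RiemannianBundle (fun x : M => TangentSpace 𝓘(ℝ, E) x)]
  [IsContMDiffRiemannianBundle 𝓘(ℝ, E) ∞ E (fun x : M => TangentSpace 𝓘(ℝ, E) x)]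

namespace AlmostHyperHermitian

variable (S : AlmostHyperHermitian E M)

omit [FiniteDimensional ℝ E] [RiemannianBundle (fun x : M => TangentSpace 𝓘(ℝ, E) x)]
  [IsContMDiffRiemannianBundle 𝓘(ℝ, E) ∞ E (fun x : M => TangentSpace 𝓘(ℝ, E) x)] in
theorem exists_section {x : M} (v : TangentSpace 𝓘(ℝ, E) x) :
    ∃ Y : ∀ x : M, TangentSpace 𝓘(ℝ, E) x, Y x = v ∧ MDiffAt (T% Y) x :=
  ⟨FiberBundle.extend E v, by simp, FiberBundle.mdifferentiableAt_extend ..⟩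

/-- Since the connection is metric, the derivatives of Y cancel and ⟨Y, (∇_X A) Z⟩ remains. -/
theorem nablaOmega_eq_inner (i : Fin 3) {x : M} (X Y : TangentSpace 𝓘(ℝ, E) x)
    {Z : ∀ x : M, TangentSpace 𝓘(ℝ, E) x} (hZ : MDiffAt (T% Z) x) :
    S.nablaOmega i x X Y (Z x) =
      inner ℝ Y (S.nabla (fun y => S.Q i y (Z y)) x X - S.Q i x (S.nabla Z x X)) := by
  obtain ⟨X, rfl, -⟩ := exists_section X
  obtain ⟨Y, rfl, hY⟩ := exists_section Y
  rw [S.nablaOmega_apply i X Y Z hY hZ,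
    S.metric x Y (fun y => S.Q i y (Z y)) hY (S.mdifferentiableAt_apply i hZ), inner_sub_right]
  ring

theorem nabla_neg {x : M} {Z : ∀ x : M, TangentSpace 𝓘(ℝ, E) x} (hZ : MDiffAt (T% Z) x)
    (X : TangentSpace 𝓘(ℝ, E) x) : S.nabla (fun y => -Z y) x X = -S.nabla Z x X := by
  have h := S.nabla.isCovariantDerivativeOn.smul_const (-1 : ℝ) hZ (x := x)
  have e : (fun y => -Z y) = (-1 : ℝ) • Z := by
    ext y
    simp
  rw [e, h]
  simp

/-- Skewness comes from ω(Y, Z) = -ω(Z, Y). The remaining conditions are Leibniz rules for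
identities between the endomorphism fields. -/
theorem satisfiesRelations (x : M) :
    SatisfiesRelations (fun i => S.Q i x) (fun i => S.nablaOmega i x) := by
  have hq := fun y i => (S.hyperHermitian y).isQuaternionicTriple i
  refine ⟨fun i => ⟨fun X Y Z => ?_, fun X Y Z => ?_⟩, fun i X Y Z => ?_⟩
  · obtain ⟨X, rfl, -⟩ := exists_section X
    obtain ⟨Y, rfl, hY⟩ := exists_section Y
    obtain ⟨Z, rfl, hZ⟩ := exists_section Z
    have e : (fun y => (inner ℝ (Y y) (S.Q i y (Z y)) : ℝ)) =
        fun y => -inner ℝ (Z y) (S.Q i y (Y y)) := funext fun y => by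
      rw [real_inner_comm, (hq y i).cplxA.skew]
    rw [S.nablaOmega_apply i X Y Z hY hZ, S.nablaOmega_apply i X Z Y hZ hY, e, mvfderiv_fun_neg]
    have e₁ := (hq x i).cplxA.skew (Y x) (S.nabla Z x (X x))
    have e₂ := (hq x i).cplxA.skew (Z x) (S.nabla Y x (X x))
    rw [real_inner_comm] at e₁ e₂
    simp only [neg_apply]
    linarith
  · obtain ⟨Z, rfl, hZ⟩ := exists_section Z
    -- Differentiating A² = -1 shows that ∇A anticommutes with A.
    have e : (fun y => S.Q i y (S.Q i y (Z y))) = fun y => -Z y :=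
      funext fun y => (hq y i).cplxA.sq _
    rw [S.nablaOmega_eq_inner i X _ (S.mdifferentiableAt_apply i hZ), S.nablaOmega_eq_inner i X _ hZ,
      e, S.nabla_neg hZ, (hq x i).cplxA.skew]
    simp only [map_sub, map_neg, (hq x i).cplxA.sq, inner_sub_right, inner_neg_right]
    ring
  · obtain ⟨Z, rfl, hZ⟩ := exists_section Z
    have hAZ := S.mdifferentiableAt_apply i hZ
    have hBZ := S.mdifferentiableAt_apply (i + 1) hZ
    -- Differentiating CB = -A gives ∇A = -(∇C)B - C(∇B), and skewness of C turns this into the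
    -- relation.
    have e : (fun y => S.Q (i + 2) y (S.Q (i + 1) y (Z y))) = fun y => -S.Q i y (Z y) :=
      funext fun y => (hq y i).CB _
    rw [S.nablaOmega_eq_inner i X _ hZ, S.nablaOmega_eq_inner (i + 1) X _ hZ,
      S.nablaOmega_eq_inner (i + 2) X _ hBZ, e, S.nabla_neg hAZ, (hq x i).cplxC.skew]
    simp only [map_sub, (hq x i).CB, inner_sub_right, inner_neg_right]
    ring

/-- The smallest triple consists of the modules whose component is nonzero at some point, since
membership in a class is tested componentwise at each point. -/
theorem exists_hasExactType (hD : (Module.finrank ℝ E : ℝ) - 2 ≠ 0) :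
    ∃ t, S.HasExactType t := by
  classical
  have key : ∀ s : TypeTriple, S.HasTypeLE s ↔
      ∀ A, ∀ i ∉ s A, ∀ x, ghPart (S.Q A x) i (S.nablaOmega A x) = 0 := fun s => by
    have : S.HasTypeLE s ↔ ∀ x A, ∀ i ∉ s A, ghPart (S.Q A x) i (S.nablaOmega A x) = 0 :=
      forall₂_congr fun x A => ((S.hyperHermitian x).isQuaternionicTriple A).cplxA.mem_ghClass_iff
        hD ((S.satisfiesRelations x).hermitian A) _
    rw [this]
    exact ⟨fun h A i hi x => h x A i hi, fun h x A i hi => h A i hi x⟩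
  refine ⟨fun A => Finset.univ.filter fun i =>
    ¬∀ x, ghPart (S.Q A x) i (S.nablaOmega A x) = 0, ?_, fun s hs A i hi => ?_⟩
  · rw [Set.mem_ofPred_eq, key]
    intro A i hi
    simpa using hi
  · by_contra hi'
    exact (Finset.mem_filter.1 hi).2 ((key s).1 hs A i hi')

variable (hD : Module.finrank ℝ E = 8 ∨ 12 ≤ Module.finrank ℝ E) {t t' : TypeTriple}
  (h : MaskReduces (decide (12 ≤ Module.finrank ℝ E)) t t')
include hD h

theorem reducesTo (x : M) : ReducesTo (fun i => S.Q i x) t t' :=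
  MaskReduces.reducesTo (V := TangentSpace 𝓘(ℝ, E) x) (S.hyperHermitian x) hD h

theorem eq_of_hasExactType (ht : S.HasExactType t) : t' = t :=
  le_antisymm h.le
    (ht.2 fun x => (S.reducesTo hD h x).1 _ (S.satisfiesRelations x) (ht.1 x))

theorem isHyperKahler (ht : S.HasTypeLE t) (h' : t' = ⊥) : S.IsHyperKahler := fun i x =>
  (S.reducesTo hD h x).forall_eq_zero_iff.2 h' _ (S.satisfiesRelations x) (ht x) i

theorem isLCHyperKahler (ht : S.HasTypeLE t) (h' : t' = fun _ => {3}) : S.IsLCHyperKahler :=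
  fun x => ((S.reducesTo hD h x).forall_isLC_iff (S.hyperHermitian x)
    (show 8 ≤ Module.finrank ℝ E by omega)).2 h'.le _ (S.satisfiesRelations x) (ht x)

end AlmostHyperHermitian

end HyperHermitianManifold

theorem mainTheorem10 (n : ℕ) (hn : 2 ≤ n)
    {V : Type v} [NormedAddCommGroup V] [InnerProductSpace ℝ V] [FiniteDimensional ℝ V]
    (hV : Module.finrank ℝ V = 4 * n)
    (Q : Fin 3 → V →L[ℝ] V) (hQ : IsHyperHermitian Q) :
    -- there are 816 unordered triples of types, and the relations reduce every triple of types
    Nat.card (Sym GHType 3) = 816 ∧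
    (∀ t, ∃ t', ReducesTo Q t t') ∧
    -- the counts in dimension at least 12
    (3 ≤ n →
      (hyperHermitianTypes Q).ncard = 167 ∧
      (forcesHyperKahler Q).ncard = 276 ∧
      (forcesLCHyperKahler Q).ncard = 44 ∧
      (manifoldTypes.{u} n).ncard ≤ 167) ∧
    -- the counts in dimension 8
    (n = 2 →
      (hyperHermitianTypes Q).ncard = 144 ∧
      (forcesHyperKahler Q).ncard = 316 ∧
      (forcesLCHyperKahler Q).ncard = 44 ∧
      (manifoldTypes.{u} n).ncard ≤ 144) ∧
    -- the relations hold on every almost hyper-Hermitian manifold of dimension `4n`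
    manifoldTypes.{u} n ⊆ hyperHermitianTypes Q ∧
    ∀ (M : Type u) [TopologicalSpace M]
      [ChartedSpace (EuclideanSpace ℝ (Fin (4 * n))) M]
      [IsManifold 𝓘(ℝ, EuclideanSpace ℝ (Fin (4 * n))) ∞ M]
      [RiemannianBundle (fun x : M => TangentSpace 𝓘(ℝ, EuclideanSpace ℝ (Fin (4 * n))) x)]
      [IsContMDiffRiemannianBundle 𝓘(ℝ, EuclideanSpace ℝ (Fin (4 * n))) ∞
        (EuclideanSpace ℝ (Fin (4 * n)))
        (fun x : M => TangentSpace 𝓘(ℝ, EuclideanSpace ℝ (Fin (4 * n))) x)]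
      (S : AlmostHyperHermitian (EuclideanSpace ℝ (Fin (4 * n))) M),
      (∀ x, SatisfiesRelations (fun i => S.Q i x) (fun i => S.nablaOmega i x)) ∧
      (∃ t, S.HasExactType t) ∧
      ∀ t, S.HasTypeLE t →
        (unordered t ∈ forcesHyperKahler Q → S.IsHyperKahler) ∧
        (unordered t ∈ forcesLCHyperKahler Q → S.IsLCHyperKahler) := by
  have hE : Module.finrank ℝ (EuclideanSpace ℝ (Fin (4 * n))) = 4 * n := by simp
  -- The mask reduction depends on the space only through its dimension, so conclusions about `V`
  -- pass to the tangent spaces.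
  have hb : Module.finrank ℝ V = Module.finrank ℝ (EuclideanSpace ℝ (Fin (4 * n))) :=
    hV.trans hE.symm
  have hD : Module.finrank ℝ V = 8 ∨ 12 ≤ Module.finrank ℝ V := by omega
  have hD' : Module.finrank ℝ (EuclideanSpace ℝ (Fin (4 * n))) = 8 ∨
      12 ≤ Module.finrank ℝ (EuclideanSpace ℝ (Fin (4 * n))) := hb ▸ hD
  have hM : manifoldTypes.{u} n ⊆ hyperHermitianTypes Q := by
    rintro s ⟨M, _, _, _, _, _, S, t, ht, rfl⟩
    obtain ⟨t', h⟩ := exists_maskReduces (decide (12 ≤ Module.finrank ℝ V)) t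
    exact (h.unordered_mem_hyperHermitianTypes_iff hQ hD).2
      (S.eq_of_hasExactType hD' (hb ▸ h) ht)
  have hN : (manifoldTypes.{u} n).ncard ≤ (hyperHermitianTypes Q).ncard :=
    Set.ncard_le_ncard hM (Set.toFinite _)
  refine ⟨card_sym_ghType, fun t => ?_, fun h3 => ?_, fun h2 => ?_, hM, ?_⟩
  · obtain ⟨t', h⟩ := exists_maskReduces (decide (12 ≤ Module.finrank ℝ V)) t
    exact ⟨t', h.reducesTo hQ hD⟩
  · have hd : decide (12 ≤ Module.finrank ℝ V) = true := by
      rw [decide_eq_true_iff]; omega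
    have h₁ := ncard_hyperHermitianTypes hQ hD
    have h₂ := ncard_forcesHyperKahler hQ hD
    have h₃ := ncard_forcesLCHyperKahler hQ hD
    rw [hd] at h₁ h₂ h₃
    obtain ⟨-, c₁, c₂, c₃⟩ := reduceMask_counts true
    exact ⟨h₁.trans c₁, h₂.trans c₂, h₃.trans c₃, hN.trans (h₁.trans c₁).le⟩
  · have hd : decide (12 ≤ Module.finrank ℝ V) = false := by
      rw [decide_eq_false_iff_not]; omega
    have h₁ := ncard_hyperHermitianTypes hQ hD
    have h₂ := ncard_forcesHyperKahler hQ hD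
    have h₃ := ncard_forcesLCHyperKahler hQ hD
    rw [hd] at h₁ h₂ h₃
    obtain ⟨-, c₁, c₂, c₃⟩ := reduceMask_counts false
    exact ⟨h₁.trans c₁, h₂.trans c₂, h₃.trans c₃, hN.trans (h₁.trans c₁).le⟩
  · intro M _ _ _ _ _ S
    refine ⟨S.satisfiesRelations, S.exists_hasExactType ?_, fun t ht => ?_⟩
    · have : (2 : ℝ) ≤ n := by exact_mod_cast hn
      rw [hE]
      push_cast
      linarith
    · obtain ⟨t', h⟩ := exists_maskReduces (decide (12 ≤ Module.finrank ℝ V)) t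
      exact ⟨fun hu => S.isHyperKahler hD' (hb ▸ h) ht
          ((h.unordered_mem_forcesHyperKahler_iff hQ hD).1 hu),
        fun hu => S.isLCHyperKahler hD' (hb ▸ h) ht
          ((h.unordered_mem_forcesLCHyperKahler_iff hQ hD).1 hu)⟩
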